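/- **Lemma 3.4.** *Conventions.* For a tempered distribution $u$ on $\mathbb R^2$ (variables $(x,t)$) let $\hat u(\xi,\tau)=\int e^{-ix\xi-it\tau}u(x,t)\,dx\,dt$, and put $\langle a\rangle=(1+a^2)^{1/2}$. For continuous $h:\mathbb R\to\mathbb R$ and $s,b\in\mathbb R$ let $$\|u\|_{X^{s,b}_{\tau=h(\xi)}}=\big\|\langle\tau-h(\xi)\rangle^{b}\langle\xi\rangle^{s}\,\hat u(\xi,\tau)\big\|_{L^2(\mathbb R^2)},$$ $X^{s,b}_{\tau=h(\xi)}$ being the set of tempered distributions for which $\hat u$ is a function and this norm is finite. Let $\eta_0:\mathbb R\to[0,1]$ be even, smooth, supported in $[-8/5,8/5]$ and equal to $1$ on $[-5/4,5/4]$, let $\eta_k(\xi)=\eta_0(\xi/2^k)-\eta_0(\xi/2^{k-1})$ for $k\ge1$, let $P_k$ be the Fourier multiplier with symbol $\eta_k(\xi)$, and $P_{\le m}=\sum_{k=0}^mP_k$. For $s\in\mathbb R$, $\bar F^{s}_{\tau=\xi^3}$ is the set of tempered distributions with $$\|v\|_{\bar F^{s}_{\tau=\xi^3}}^2=\sum_{k\ge1}2^{2sk}\Big(\sum_{j\ge0}2^{j/2}\big\|\eta_j(\tau-\xi^3)\,\eta_k(\xi)\,\hat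 v\big\|_{L^2(\mathbb R^2)}\Big)^2+\|P_{\le0}v\|_{L^2_xL^\infty_t}^2<\infty .$$ Let $\psi:\mathbb R\to\mathbb R$ be smooth and compactly supported. (a) Let $s_1\ge0$, $-1<s_2<-1/2$ and $s_1-s_2<1$. There is $\theta_0=\theta_0(s_1,s_2)>0$ such that for all $0<\theta<\theta_0$ there is a constant $C$, independent of $\lambda$, such that for all $0<\lambda\le1$, all $u\in X^{s_1,1/2+\theta}_{\tau=-\lambda\xi^2}$ and all $v\in\bar F^{s_2}_{\tau=\xi^3}$, the product $uv=\lim_{m\to\infty}(P_{\le m}u)(P_{\le m}v)$ exists in $\mathcal S'(\mathbb R^2)$ (all $P_{\le m}u$, $P_{\le m}v$ being functions) and $$\|\psi(t)\,uv\|_{X^{s_1,-1/2+2\theta}_{\tau=-\lambda\xi^2}}\le C\lambda^{-1/2}\,\|u\|_{X^{s_1,1/2+\theta}_{\tau=-\lambda\xi^2}}\,\|v\|_{\bar F^{s_2}_{\tau=\xi^3}} .$$ (b) Let $s_1\ge0$ and $s_2-s_1<-1/2$. There is $\theta_0=\theta_0(s_1,s_2)>0$ such that for all $0<\theta<\theta_0$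 there is a constant $C$, independent of $\lambda$, such that for all $0<\lambda\le1$ and all $u,w\in X^{s_1,1/2+\theta}_{\tau=-\lambda\xi^2}$, the distributions $u$ and $w$ are functions, their pointwise product $u\bar w$ is a tempered distribution and $$\|\psi(t)\,\partial_x(u\bar w)\|_{X^{s_2,-1/2+2\theta}_{\tau=\xi^3}}\le C\lambda^{-1/2}\,\|u\|_{X^{s_1,1/2+\theta}_{\tau=-\lambda\xi^2}}\,\|w\|_{X^{s_1,1/2+\theta}_{\tau=-\lambda\xi^2}} .$$ The constants $C$ may depend on $s_1,s_2,\theta,\psi$ and, in (a), $\eta_0$. -/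

import Mathlib

open MeasureTheory SchwartzMap Filter Topology
open scoped ENNReal ContDiff FourierTransform LineDeriv

noncomputable section

namespace NLSKdV

/-- The plane `ℝ²` with its Euclidean structure, used both for space-time points
`p = (x, t)` (`p.fst = x`, `p.snd = t`) and for frequency points `(ξ, τ)`. -/
abbrev Plane : Type := WithLp 2 (ℝ × ℝ)

/-- The tempered distribution `u` is (integration against) the function `f`.  Such an `f` is
locally integrable and unique up to null sets. -/
def IsFun (u : 𝓢'(Plane, ℂ)) (f : Plane → ℂ) : Prop :=
  ∀ φ : 𝓢(Plane, ℂ), Integrable (fun p => f p * φ p) volume ∧ u φ = ∫ p, f p * φ p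

/-- The space-time Fourier transform `û(ξ, τ) = ∫ e^{-ixξ} e^{-itτ} u(x, t) dx dt` of the tempered
distribution `u` is the function `f`.  Mathlib's `𝓕` has the kernel `e^{-2πi⟨p, ζ⟩}`, so that
`(𝓕 u)(ζ) = û(2πζ)`. -/
def HasFourierFun (u : 𝓢'(Plane, ℂ)) (f : Plane → ℂ) : Prop :=
  IsFun (𝓕 u) (fun ζ => f ((2 * Real.pi) • ζ))

/-- The Japanese bracket `⟨x⟩ = (1 + |x|²)^{1/2}`. -/
def jb (x : ℝ) : ℝ := Real.sqrt (1 + x ^ 2)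

/-- The norm `‖⟨τ - h(ξ)⟩^b ⟨ξ⟩^s û(ξ, τ)‖_{L²(ℝ²)}` of `X^{s,b}_{τ=h(ξ)}`; it is `∞` if `û` is not
a function. (The infimum is over the a.e. equal representatives of `û`.) -/
def XNorm (h : ℝ → ℝ) (s b : ℝ) (u : 𝓢'(Plane, ℂ)) : ℝ≥0∞ :=
  ⨅ (f : Plane → ℂ) (_ : HasFourierFun u f),
    eLpNorm (fun p : Plane => ((jb (p.snd - h p.fst) ^ b * jb p.fst ^ s : ℝ) : ℂ) * f p) 2 volume

/-- The dispersion relation `τ = -λξ²` of the scaled Schrödinger equation. -/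
def hSchr (lam : ℝ) (ξ : ℝ) : ℝ := -lam * ξ ^ 2

/-- The dispersion relation `τ = ξ³` of the Airy equation. -/
def hAiry (ξ : ℝ) : ℝ := ξ ^ 3

/-- `η₀ : ℝ → [0, 1]` is even and smooth, supported in `[-8/5, 8/5]`, equal to `1` on
`[-5/4, 5/4]`. -/
structure IsCutoff (η₀ : ℝ → ℝ) : Prop where
  even : ∀ ξ, η₀ (-ξ) = η₀ ξ
  smooth : ContDiff ℝ ∞ η₀
  mem_Icc : ∀ ξ, η₀ ξ ∈ Set.Icc (0 : ℝ) 1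
  support_subset : Function.support η₀ ⊆ Set.Icc (-(8 / 5)) (8 / 5)
  eq_one : ∀ ξ ∈ Set.Icc (-(5 / 4) : ℝ) (5 / 4), η₀ ξ = 1

/-- The inhomogeneous dyadic partition of unity: `η₀` for `k = 0` and
`η_k(ξ) = η₀(ξ/2^k) - η₀(ξ/2^{k-1})` for `k ≥ 1`. -/
def eta (η₀ : ℝ → ℝ) : ℕ → ℝ → ℝ
  | 0 => η₀
  | k + 1 => fun ξ => η₀ (ξ / 2 ^ (k + 1)) - η₀ (ξ / 2 ^ k)

/-- The spatial Littlewood–Paley operator `P_k`, the Fourier multiplier with symbol `η_k(ξ)`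
(in Mathlib's frequency variable `ζ`, `ξ = 2πζ`). -/
def P (η₀ : ℝ → ℝ) (k : ℕ) (u : 𝓢'(Plane, ℂ)) : 𝓢'(Plane, ℂ) :=
  TemperedDistribution.fourierMultiplierCLM ℂ
    (fun ζ : Plane => ((eta η₀ k (2 * Real.pi * ζ.fst) : ℝ) : ℂ)) u

/-- `P_{≤ m} = ∑_{k ≤ m} P_k`. -/
def Ple (η₀ : ℝ → ℝ) (m : ℕ) (u : 𝓢'(Plane, ℂ)) : 𝓢'(Plane, ℂ) :=
  ∑ k ∈ Finset.range (m + 1), P η₀ k u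

/-- `∑_{j ≥ 0} 2^{j/2} ‖η_j(τ - h(ξ)) f(ξ, τ)‖_{L²}`. -/
def YNorm (η₀ : ℝ → ℝ) (h : ℝ → ℝ) (f : Plane → ℂ) : ℝ≥0∞ :=
  ∑' j : ℕ, (2 : ℝ≥0∞) ^ ((j : ℝ) / 2) *
    eLpNorm (fun p : Plane => ((eta η₀ j (p.snd - h p.fst) : ℝ) : ℂ) * f p) 2 volume

/-- `‖η_k(ξ) û‖_{Y^k_{τ=h(ξ)}}`; it is `∞` if `η_k(ξ) û` is not a function. -/
def YPieceNorm (η₀ : ℝ → ℝ) (h : ℝ → ℝ) (k : ℕ) (u : 𝓢'(Plane, ℂ)) : ℝ≥0∞ :=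
  ⨅ (f : Plane → ℂ) (_ : HasFourierFun (P η₀ k u) f), YNorm η₀ h f

/-- The mixed norm `‖g‖_{L²_x L^∞_t}`. -/
def L2xLinftyt (g : Plane → ℂ) : ℝ≥0∞ :=
  (∫⁻ x : ℝ, (eLpNorm (fun t : ℝ => g (WithLp.toLp 2 (x, t))) ∞ volume) ^ (2 : ℕ)) ^ (1 / 2 : ℝ)

/-- `‖P_{≤0} u‖_{L²_x L^∞_t}`; it is `∞` if `P_{≤0} u` is not a function. -/
def lowNorm (η₀ : ℝ → ℝ) (u : 𝓢'(Plane, ℂ)) : ℝ≥0∞ :=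
  ⨅ (g : Plane → ℂ) (_ : IsFun (Ple η₀ 0 u) g), L2xLinftyt g

/-- The norm of `F̄^s_{τ=ξ³}`:
`‖u‖² = ∑_{k ≥ 1} 2^{2sk} ‖η_k(ξ) û‖²_{Y^k_{τ=ξ³}} + ‖P_{≤0} u‖²_{L²_x L^∞_t}`. -/
def FbarNorm (η₀ : ℝ → ℝ) (s : ℝ) (u : 𝓢'(Plane, ℂ)) : ℝ≥0∞ :=
  ((∑' k : ℕ, (2 : ℝ≥0∞) ^ (2 * s * ((k : ℝ) + 1)) * YPieceNorm η₀ hAiry (k + 1) u ^ (2 : ℕ))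
    + lowNorm η₀ u ^ (2 : ℕ)) ^ (1 / 2 : ℝ)

/-- The product `z = uv` of two tempered distributions, one of which may be rougher than a function:
all `P_{≤m} u` and `P_{≤m} v` are functions, and their pointwise products are tempered distributions
that converge to `z` in `𝓢'(ℝ²)` as `m → ∞`.  There is at most one such `z`. -/
def HasProduct (η₀ : ℝ → ℝ) (u v z : 𝓢'(Plane, ℂ)) : Prop :=
  ∃ (U V : ℕ → Plane → ℂ) (Z : ℕ → 𝓢'(Plane, ℂ)),
    (∀ m, IsFun (Ple η₀ m u) (U m)) ∧ (∀ m, IsFun (Ple η₀ m v) (V m)) ∧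
    (∀ m, IsFun (Z m) (fun p => U m p * V m p)) ∧ Tendsto Z atTop (𝓝 z)

/-- Multiplication of a tempered distribution by the function `ψ(t)` of the time variable. -/
def mulTime (ψ : ℝ → ℝ) (u : 𝓢'(Plane, ℂ)) : 𝓢'(Plane, ℂ) :=
  TemperedDistribution.smulLeftCLM ℂ (fun p : Plane => ((ψ p.snd : ℝ) : ℂ)) u

/-- The distributional derivative `∂_x`. -/
def dx (u : 𝓢'(Plane, ℂ)) : 𝓢'(Plane, ℂ) :=
  ∂_{(WithLp.toLp 2 ((1 : ℝ), (0 : ℝ)) : Plane)} u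

end NLSKdV

end

open MeasureTheory SchwartzMap Filter Topology
open scoped ENNReal ContDiff FourierTransform LineDeriv

noncomputable section

namespace NLSKdV

/-! ### The Japanese bracket -/

/-! On the Fourier side a product is a convolution. A weighted L² bound for a convolution with
kernel `K` follows from Cauchy–Schwarz once `∫ K(ζ, η)² dη` is bounded uniformly in `ζ`
(`lintegral_sq_conv_le`). The work lies in these kernel integrals. Multiplication by `ψ(t)` is
convolution in `τ` with a Schwartz function, and the weights vary slowly in `τ`, so it only costs a
constant (`exists_fourier_mulTime`).

Part (b). The output modulation weight is at most 1 and is discarded. Since `s₂ - s₁ < -1/2`, the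
derivative and the spatial weights leave a factor `|ξ|^{1/2}`. The two Schrödinger modulations
differ by an affine function of the inner frequency with slope of size `2λ|ξ|`, so the kernel
integral is `≲ 1/(λ|ξ|)` (`schr_kernel_le`). This absorbs `|ξ|` and leaves `λ^{-1}`, whose square
root is the stated loss.

Part (a), high frequencies. Take `v` at spatial frequency `N` and modulation at most of order `L`.
Let `x` be the frequency of `v` and `ρ` its modulation; the modulation of `u` is then `τ + λ(ξ-x)² -
x³ - ρ`. Where its `x`-derivative is at least `x²` in size, a change of variables gains `N^{-2}`.
Where it is smaller, the resonance identity forces one of the three modulations to be `≳ N³`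
(`modulation_large`). Either way the squared kernel integrates to `≲ N^{-2+12θ} L`
(`airy_kernel_le`), uniformly in `λ`. The factor `L^{1/2}` is the weight in the norm of `v`, and
`N^{s₁-s₂-1+6θ}` is summable for small `θ` (`high_le`).

Part (a), low frequencies. `P_{≤0} v` reproduces itself under convolution in `x` with a Schwartz
function, so it is bounded and Lipschitz in `x` (`exists_low_bounds`). Multiplication by such a
function preserves `L²_t H^s_x` for `0 ≤ s < 1`, by the difference quotient description of the norm
(`exists_low_mul_bound`); here `s₁ < 1 + s₂ < 1/2`.

The truncated products converge by dominated convergence on the Fourier side, the majorants being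
finite by the same estimates (`tendsto_low_product`, `exists_tendsto_high_product`). -/

lemma jb_pos (x : ℝ) : 0 < jb x := Real.sqrt_pos.2 (by positivity)

lemma one_le_jb (x : ℝ) : 1 ≤ jb x := by
  rw [jb, Real.one_le_sqrt]; nlinarith [sq_nonneg x]

lemma abs_le_jb (x : ℝ) : |x| ≤ jb x := by
  rw [jb, ← Real.sqrt_sq_eq_abs]; exact Real.sqrt_le_sqrt (by linarith)

lemma jb_sq (x : ℝ) : jb x ^ 2 = 1 + x ^ 2 := Real.sq_sqrt (by positivity)

lemma jb_le_one_add_abs (x : ℝ) : jb x ≤ 1 + |x| := by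
  refine Real.sqrt_le_iff.2 ⟨by positivity, ?_⟩
  nlinarith [abs_nonneg x, sq_abs x]

lemma jb_neg (x : ℝ) : jb (-x) = jb x := by simp [jb]

lemma jb_add_le (x y : ℝ) : jb (x + y) ≤ 2 * (jb x * jb y) := by
  have hx := one_le_jb x
  have hy := one_le_jb y
  have h1 := abs_le_jb x
  have h2 := abs_le_jb y
  refine (jb_le_one_add_abs _).trans ?_
  have := abs_add_le x y
  have h3 : jb (x + y) ≤ jb x + jb y := by
    refine Real.sqrt_le_iff.2 ⟨by positivity, ?_⟩
    have e1 := jb_sq x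
    have e2 := jb_sq y
    have e3 : x * y ≤ jb x * jb y := by
      calc x * y ≤ |x| * |y| := by rw [← abs_mul]; exact le_abs_self _
        _ ≤ _ := by gcongr
    nlinarith
  by_cases hh : 1 + |x + y| ≤ 2 * (jb x * jb y)
  · exact hh
  · nlinarith [mul_nonneg (sub_nonneg.2 hx) (sub_nonneg.2 hy), jb_sq x, jb_sq y, sq_abs x, sq_abs y]

@[fun_prop]
lemma continuous_jb : Continuous jb := by unfold jb; fun_prop

lemma continuous_jb_rpow (r : ℝ) : Continuous fun x => jb x ^ r :=
  continuous_jb.rpow_const fun x => Or.inl (jb_pos x).ne'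

/-- The integral of `⟨y⟩^{-r}`. -/
def jbInt (r : ℝ) : ℝ≥0∞ := ∫⁻ y : ℝ, ENNReal.ofReal (jb y ^ (-r))

lemma jbInt_lt_top {r : ℝ} (hr : 1 < r) : jbInt r < ⊤ := by
  have h := integrable_rpow_neg_one_add_norm_sq (E := ℝ) (μ := volume) (r := r) (by simpa using hr)
  have h2 : (fun y : ℝ => jb y ^ (-r)) = fun y => (1 + ‖y‖ ^ 2) ^ (-r / 2) := by
    ext y
    rw [jb, Real.sqrt_eq_rpow, ← Real.rpow_mul (by positivity), Real.norm_eq_abs, sq_abs]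
    congr 1; ring
  rw [← h2] at h
  have := h.hasFiniteIntegral
  rw [hasFiniteIntegral_iff_ofReal (ae_of_all _ fun y => (Real.rpow_nonneg (jb_pos y).le _))] at this
  exact this

/-! ### One-dimensional changes of variables -/

/-- Change of variables `y = G x` with Jacobian at least `c`. It is localized to `A` because the
phases below are only piecewise monotone. -/
lemma setLIntegral_comp_le_of_injOn {A : Set ℝ} (hA : MeasurableSet A) {G G' : ℝ → ℝ}
    (hG : ∀ x, HasDerivAt G (G' x) x) (hinj : Set.InjOn G A) {c : ℝ} (hc : 0 < c)
    (hG' : ∀ x ∈ A, c ≤ |G' x|) (w : ℝ → ℝ≥0∞) :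
    ∫⁻ x in A, w (G x) ≤ (ENNReal.ofReal c)⁻¹ * ∫⁻ y, w y := by
  have hc0 : ENNReal.ofReal c ≠ 0 := by simpa using hc
  rw [← ENNReal.div_eq_inv_mul, ENNReal.le_div_iff_mul_le (Or.inl hc0) (Or.inl ENNReal.ofReal_ne_top)]
  rw [mul_comm, ← lintegral_const_mul' _ _ ENNReal.ofReal_ne_top]
  calc ∫⁻ x in A, ENNReal.ofReal c * w (G x)
      ≤ ∫⁻ x in A, ENNReal.ofReal |G' x| * w (G x) := by
        refine setLIntegral_mono' hA fun x hx => ?_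
        gcongr; exact hG' x hx
    _ = ∫⁻ y in G '' A, w y :=
        (lintegral_image_eq_lintegral_abs_deriv_mul hA
          (fun x _ => (hG x).hasDerivWithinAt) hinj w).symm
    _ ≤ _ := setLIntegral_le_lintegral _ _

lemma setLIntegral_comp_le_of_deriv_ge {A : Set ℝ} (hA : Convex ℝ A) {G G' : ℝ → ℝ}
    (hG : ∀ x, HasDerivAt G (G' x) x) {c : ℝ} (hc : 0 < c)
    (hG' : ∀ x ∈ A, c ≤ G' x) (w : ℝ → ℝ≥0∞) :
    ∫⁻ x in A, w (G x) ≤ (ENNReal.ofReal c)⁻¹ * ∫⁻ y, w y := by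
  refine setLIntegral_comp_le_of_injOn hA.ordConnected.measurableSet hG ?_ hc
    (fun x hx => (hG' x hx).trans (le_abs_self _)) w
  refine (strictMonoOn_of_deriv_pos hA (fun x _ => (hG x).continuousAt.continuousWithinAt)
    fun x hx => ?_).injOn
  rw [(hG x).deriv]
  exact hc.trans_le (hG' x (interior_subset hx))

lemma setLIntegral_comp_le_of_deriv_le {A : Set ℝ} (hA : Convex ℝ A) {G G' : ℝ → ℝ}
    (hG : ∀ x, HasDerivAt G (G' x) x) {c : ℝ} (hc : 0 < c)
    (hG' : ∀ x ∈ A, G' x ≤ -c) (w : ℝ → ℝ≥0∞) :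
    ∫⁻ x in A, w (G x) ≤ (ENNReal.ofReal c)⁻¹ * ∫⁻ y, w y := by
  refine setLIntegral_comp_le_of_injOn hA.ordConnected.measurableSet hG ?_ hc
    (fun x hx => (by linarith [hG' x hx] : c ≤ -G' x).trans (neg_le_abs _)) w
  refine (strictAntiOn_of_deriv_neg hA (fun x _ => (hG x).continuousAt.continuousWithinAt)
    fun x hx => ?_).injOn
  rw [(hG x).deriv]
  linarith [hG' x (interior_subset hx)]

lemma lintegral_comp_affine_le {m : ℝ} (hm : m ≠ 0) (a : ℝ) (w : ℝ → ℝ≥0∞) :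
    ∫⁻ x, w (a + m * x) ≤ (ENNReal.ofReal |m|)⁻¹ * ∫⁻ y, w y := by
  have := setLIntegral_comp_le_of_injOn (A := Set.univ) MeasurableSet.univ
    (G := fun x => a + m * x) (G' := fun _ => m)
    (fun x => by simpa using ((hasDerivAt_id x).const_mul m).const_add a)
    (fun x _ y _ h => by simpa [hm] using h) (abs_pos.2 hm) (fun _ _ => le_rfl) w
  simpa using this

/-! ### Cauchy–Schwarz in `ℝ≥0∞` -/

lemma sq_lintegral_mul_le {α : Type*} [MeasurableSpace α] (μ : Measure α) {f g : α → ℝ≥0∞}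
    (hf : AEMeasurable f μ) (hg : AEMeasurable g μ) :
    (∫⁻ x, f x * g x ∂μ) ^ 2 ≤ (∫⁻ x, f x ^ 2 ∂μ) * ∫⁻ x, g x ^ 2 ∂μ := by
  have h := ENNReal.lintegral_mul_le_Lp_mul_Lq μ Real.HolderConjugate.two_two hf hg
  have h2 := pow_le_pow_left₀ (zero_le) h 2
  refine h2.trans (le_of_eq ?_)
  rw [mul_pow, ← ENNReal.rpow_natCast, ← ENNReal.rpow_natCast, ← ENNReal.rpow_mul,
    ← ENNReal.rpow_mul]
  norm_num

/-! ### The resonance identity and the kernel of the Schrödinger–Airy interaction -/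

/-- The frequencies `ξ₂` of dyadic size `N`. -/
def annulus (N : ℝ) : Set ℝ := {x | 5 / 8 * N ≤ |x| ∧ |x| ≤ 8 / 5 * N}

lemma measurableSet_annulus (N : ℝ) : MeasurableSet (annulus N) :=
  (measurableSet_le measurable_const measurable_abs).inter
    (measurableSet_le measurable_abs measurable_const)

lemma volume_annulus_le (N : ℝ) : volume (annulus N) ≤ ENNReal.ofReal (16 / 5 * N) := by
  have : annulus N ⊆ Set.Icc (-(8 / 5 * N)) (8 / 5 * N) := fun x hx => abs_le.1 hx.2
  refine (measure_mono this).trans ?_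
  rw [Real.volume_Icc]
  apply ENNReal.ofReal_le_ofReal; linarith

lemma volume_Icc_neg_self (L : ℝ) :
    volume (Set.Icc (-(8 / 5 * L)) (8 / 5 * L)) = ENNReal.ofReal (16 / 5 * L) := by
  rw [Real.volume_Icc]; congr 1; ring

/-- If the phase `G(x) = τ + λ(ξ - x)² - x³` is nearly stationary at `x`, then one of the three
modulations is `≳ N³`. -/
lemma modulation_large {lam N x ξ τ ρ : ℝ} (hl : 0 < lam) (hl1 : lam ≤ 1) (hN : 2 ≤ N)
    (hx : x ∈ annulus N) (hD : |-(2 * lam * (ξ - x)) - 3 * x ^ 2| < x ^ 2) :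
    N ^ 3 / 63 ≤ |τ + lam * ξ ^ 2| ∨ N ^ 3 / 63 ≤ |τ + lam * (ξ - x) ^ 2 - x ^ 3 - ρ| ∨
      N ^ 3 / 63 ≤ |ρ| := by
  by_contra! hcon
  obtain ⟨h1, h2, h3⟩ := hcon
  have hxN := hx.1
  have hx1 : 5 / 4 ≤ |x| := by linarith
  have hsum : |x * (-(2 * x ^ 2) - lam * (-x)  - (-(2 * lam * (ξ - x)) - 3 * x ^ 2))| <
      N ^ 3 / 21 := by
    -- The resonance identity: the alternating sum of the modulations is `x(x² + 2λξ - λx)`. The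
    -- term `2λξ` is then eliminated in favour of the phase derivative `D`, giving `x(-2x² + λx -
    -- D)`.
    have e : x * (-(2 * x ^ 2) - lam * (-x) - (-(2 * lam * (ξ - x)) - 3 * x ^ 2)) =
        (τ + lam * ξ ^ 2) - (τ + lam * (ξ - x) ^ 2 - x ^ 3 - ρ) - ρ := by ring
    rw [e]
    calc _ ≤ |τ + lam * ξ ^ 2| + |τ + lam * (ξ - x) ^ 2 - x ^ 3 - ρ| + |ρ| :=
          (abs_sub _ _).trans (by gcongr; exact abs_sub _ _)
      _ < _ := by linarith
  rw [abs_mul] at hsum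
  -- As `|D| < x²` and `λx ≤ |x| ≤ 4x²/5` (because `|x| ≥ 5/4`), the bracket is at most `-x²/5`.
  -- Then `(5/8)³/5 = 25/512 > 1/21`, which contradicts three modulations each below `N³/63`.
  have hb : x ^ 2 / 5 ≤ |-(2 * x ^ 2) - lam * (-x) - (-(2 * lam * (ξ - x)) - 3 * x ^ 2)| := by
    set D := -(2 * lam * (ξ - x)) - 3 * x ^ 2
    have hD' := abs_lt.1 hD
    have hlx : lam * x ≤ 4 / 5 * x ^ 2 := by
      calc lam * x ≤ lam * |x| := by gcongr; exact le_abs_self x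
        _ ≤ 1 * |x| := by gcongr
        _ ≤ 4 / 5 * |x| ^ 2 := by nlinarith
        _ = _ := by rw [sq_abs]
    rw [le_abs]; right
    linarith [hD'.1]
  have h4 : (5 / 8 * N) ^ 3 / 5 ≤ |x| * (x ^ 2 / 5) := by
    have : (5 / 8 * N) ^ 3 ≤ |x| ^ 3 := by gcongr
    rw [← sq_abs x]; nlinarith
  have h5 : |x| * (x ^ 2 / 5) ≤ |x| * |-(2 * x ^ 2) - lam * (-x) - (-(2 * lam * (ξ - x)) - 3 * x ^ 2)| := by
    gcongr
  have hN3 : 0 < N ^ 3 := by positivity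
  nlinarith

lemma jb_rpow_neg_le {x M r : ℝ} (hM : 0 < M) (hx : M ≤ |x|) (hr : 0 ≤ r) :
    jb x ^ (-r) ≤ M ^ (-r) :=
  Real.rpow_le_rpow_of_nonpos hM (hx.trans (abs_le_jb x)) (by linarith)

lemma jb_rpow_le_one {x r : ℝ} (hr : r ≤ 0) : jb x ^ r ≤ 1 :=
  Real.rpow_le_one_of_one_le_of_nonpos (one_le_jb x) hr

/-- Case distinction by `modulation_large`. A large output or Schrödinger modulation gives the first
term directly. A large `ρ` gives no decay by itself but forces `L ≳ N³`, so the factor `L N^{-3}`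
can be inserted for free; the remaining decaying factor is kept to be integrated in `ρ`. -/
lemma kernel_pointwise {θ lam N L x ξ τ ρ : ℝ} (hθ : 0 < θ) (hθ1 : θ ≤ 1 / 4) (hl : 0 < lam)
    (hl1 : lam ≤ 1) (hN : 2 ≤ N) (hx : x ∈ annulus N) (hρ : |ρ| ≤ 8 / 5 * L)
    (hD : |-(2 * lam * (ξ - x)) - 3 * x ^ 2| < x ^ 2) :
    jb (τ + lam * ξ ^ 2) ^ (-1 + 4 * θ) *
        jb (τ + lam * (ξ - x) ^ 2 - x ^ 3 - ρ) ^ (-(1 + 2 * θ)) ≤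
      63 * N ^ (-3 + 12 * θ) + 101 * L * N ^ (-3 : ℝ) *
        jb (τ + lam * (ξ - x) ^ 2 - x ^ 3 - ρ) ^ (-(1 + 2 * θ)) := by
  have hN0 : 0 < N := by linarith
  have hL : 0 ≤ L := by linarith [abs_nonneg ρ]
  have hN3 : 0 < N ^ 3 / 63 := by positivity
  have e1 : jb (τ + lam * ξ ^ 2) ^ (-1 + 4 * θ) ≤ 1 := jb_rpow_le_one (by linarith)
  have e2 : jb (τ + lam * (ξ - x) ^ 2 - x ^ 3 - ρ) ^ (-(1 + 2 * θ)) ≤ 1 :=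
    jb_rpow_le_one (by linarith)
  have p1 : 0 ≤ jb (τ + lam * ξ ^ 2) ^ (-1 + 4 * θ) := Real.rpow_nonneg (jb_pos _).le _
  have p2 : 0 ≤ jb (τ + lam * (ξ - x) ^ 2 - x ^ 3 - ρ) ^ (-(1 + 2 * θ)) :=
    Real.rpow_nonneg (jb_pos _).le _
  have p3 : 0 ≤ N ^ (-3 + 12 * θ) := Real.rpow_nonneg hN0.le _
  have p4 : 0 ≤ N ^ (-3 : ℝ) := Real.rpow_nonneg hN0.le _
  have key : ∀ a : ℝ, 0 ≤ a → a ≤ 1 → (N ^ 3 / 63) ^ (-a) ≤ 63 * N ^ (-(3 * a)) := by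
    intro a ha ha1
    rw [Real.div_rpow (by positivity) (by norm_num), ← Real.rpow_natCast, ← Real.rpow_mul hN0.le,
      Real.rpow_neg (by norm_num : (0 : ℝ) ≤ 63), div_inv_eq_mul, mul_comm]
    have : (63 : ℝ) ^ a ≤ 63 := by
      calc (63 : ℝ) ^ a ≤ 63 ^ (1 : ℝ) := Real.rpow_le_rpow_of_exponent_le (by norm_num) ha1
        _ = 63 := by simp
    have e : ((3 : ℕ) : ℝ) * -a = -(3 * a) := by push_cast; ring
    rw [e]
    gcongr
  rcases modulation_large (τ := τ) (ρ := ρ) hl hl1 hN hx hD with h | h | h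
  · have := (jb_rpow_neg_le hN3 h (by linarith : 0 ≤ 1 - 4 * θ)).trans
      (key (1 - 4 * θ) (by linarith) (by linarith))
    rw [show -(1 - 4 * θ) = -1 + 4 * θ by ring, show -(3 * (1 - 4 * θ)) = -3 + 12 * θ by ring] at this
    have h3 := mul_le_mul this e2 p2 (by positivity)
    have : 0 ≤ 101 * L * N ^ (-3 : ℝ) *
        jb (τ + lam * (ξ - x) ^ 2 - x ^ 3 - ρ) ^ (-(1 + 2 * θ)) := by positivity
    linarith
  · have h2 : jb (τ + lam * (ξ - x) ^ 2 - x ^ 3 - ρ) ^ (-(1 + 2 * θ)) ≤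
        63 * N ^ (-3 + 12 * θ) := by
      calc _ ≤ jb (τ + lam * (ξ - x) ^ 2 - x ^ 3 - ρ) ^ (-1 : ℝ) :=
            Real.rpow_le_rpow_of_exponent_le (one_le_jb _) (by linarith)
        _ ≤ _ := jb_rpow_neg_le hN3 h zero_le_one
        _ ≤ _ := key 1 zero_le_one le_rfl
        _ ≤ _ := by
          gcongr
          · linarith
          · linarith
    have h3 := mul_le_mul e1 h2 p2 zero_le_one
    have : 0 ≤ 101 * L * N ^ (-3 : ℝ) *
        jb (τ + lam * (ξ - x) ^ 2 - x ^ 3 - ρ) ^ (-(1 + 2 * θ)) := by positivity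
    linarith
  -- From `N³/63 ≤ |ρ| ≤ 8L/5`, since `63 · 8/5 = 100.8`.
  · have h4 : 1 ≤ 101 * L * N ^ (-3 : ℝ) := by
      rw [Real.rpow_neg hN0.le, ← div_eq_mul_inv, le_div_iff₀ (by positivity)]
      have : N ^ (3 : ℝ) = N ^ 3 := by exact_mod_cast Real.rpow_natCast N 3
      rw [this]; linarith
    have h5 := mul_le_mul (e1.trans h4) le_rfl p2 (by positivity)
    linarith [mul_nonneg (by norm_num : (0 : ℝ) ≤ 63) p3]

/-- The phase function has derivative bounded below off the nearly stationary set, so the kernel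
integrates to `≲ N⁻²` there. -/
lemma setLIntegral_phase_le {lam N ξ : ℝ} (hN : 2 ≤ N) (t : ℝ) (w : ℝ → ℝ≥0∞) :
    ∫⁻ x in annulus N ∩ {x | x ^ 2 ≤ |-(2 * lam * (ξ - x)) - 3 * x ^ 2|},
        w (t + lam * (ξ - x) ^ 2 - x ^ 3) ≤
      3 * ((ENNReal.ofReal (25 / 64 * N ^ 2))⁻¹ * ∫⁻ y, w y) := by
  -- `c = (5N/8)²` is the least value of `x²` on the annulus.
  set c := 25 / 64 * N ^ 2
  have hc : 0 < c := by positivity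
  set D : ℝ → ℝ := fun x => -(2 * lam * (ξ - x)) - 3 * x ^ 2
  have hG : ∀ x, HasDerivAt (fun x => t + lam * (ξ - x) ^ 2 - x ^ 3) (D x) x := by
    intro x
    have h1 : HasDerivAt (fun x => ξ - x) (-1) x := by
      simpa using (hasDerivAt_id x).const_sub ξ
    have h2 := (((h1.pow 2).const_mul lam).const_add t).sub (hasDerivAt_pow 3 x)
    exact h2.congr_deriv (by simp only [D]; push_cast; ring)
  -- `D` is a concave quadratic with vertex at `λ/3`. Hence `{D ≥ c}` is convex, while `{D ≤ -c}`
  -- becomes two convex sets after cutting at the vertex. On each of the three the phase is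
  -- monotone, whence the factor 3.
  have hD : ∀ x y a b : ℝ, 0 ≤ a → 0 ≤ b → a + b = 1 →
      D (a * x + b * y) = a * D x + b * D y + 3 * (a * b * (x - y) ^ 2) := by
    intro x y a b ha hb hab
    obtain rfl : b = 1 - a := by linarith
    simp only [D]; ring
  have c1 : Convex ℝ {x | c ≤ D x} := by
    intro x hx y hy a b ha hb hab
    simp only [Set.mem_ofPred_eq, smul_eq_mul] at *
    rw [hD x y a b ha hb hab]
    have : 0 ≤ a * b * (x - y) ^ 2 := by positivity
    obtain rfl : b = 1 - a := by linarith
    nlinarith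
  have hanti : ∀ x y, lam / 3 ≤ x → x ≤ y → D y ≤ D x := by
    intro x y h1 h2; simp only [D]; nlinarith
  have hmono : ∀ x y, y ≤ lam / 3 → x ≤ y → D x ≤ D y := by
    intro x y h1 h2; simp only [D]; nlinarith
  have c2 : Convex ℝ {x | lam / 3 ≤ x ∧ D x ≤ -c} := by
    refine Set.OrdConnected.convex ⟨fun x hx y hy z hz => ⟨hx.1.trans hz.1, ?_⟩⟩
    exact (hanti x z hx.1 hz.1).trans hx.2
  have c3 : Convex ℝ {x | x ≤ lam / 3 ∧ D x ≤ -c} := by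
    refine Set.OrdConnected.convex ⟨fun x hx y hy z hz => ⟨hz.2.trans hy.1, ?_⟩⟩
    exact (hmono z y hy.1 hz.2).trans hy.2
  have hsub : annulus N ∩ {x | x ^ 2 ≤ |D x|} ⊆
      {x | c ≤ D x} ∪ ({x | lam / 3 ≤ x ∧ D x ≤ -c} ∪ {x | x ≤ lam / 3 ∧ D x ≤ -c}) := by
    rintro x ⟨hx, hx2⟩
    have h1 : c ≤ |D x| := by
      refine le_trans ?_ hx2
      rw [← sq_abs x]
      have : (5 / 8 * N) ^ 2 ≤ |x| ^ 2 := by gcongr; exact hx.1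
      simp only [c]; nlinarith
    rcases le_abs.1 h1 with h | h
    · exact Or.inl h
    · rcases le_total (lam / 3) x with h3 | h3
      · exact Or.inr (Or.inl ⟨h3, by linarith⟩)
      · exact Or.inr (Or.inr ⟨h3, by linarith⟩)
  calc _ ≤ ∫⁻ x in {x | c ≤ D x} ∪ ({x | lam / 3 ≤ x ∧ D x ≤ -c} ∪ {x | x ≤ lam / 3 ∧ D x ≤ -c}),
          w (t + lam * (ξ - x) ^ 2 - x ^ 3) := lintegral_mono_set hsub
    _ ≤ _ := (lintegral_union_le _ _ _).trans
        (add_le_add le_rfl (lintegral_union_le _ _ _))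
    _ ≤ (ENNReal.ofReal c)⁻¹ * (∫⁻ y, w y) + ((ENNReal.ofReal c)⁻¹ * (∫⁻ y, w y) +
          (ENNReal.ofReal c)⁻¹ * ∫⁻ y, w y) := by
        gcongr
        · exact setLIntegral_comp_le_of_deriv_ge c1 hG hc (fun x hx => hx) w
        · exact setLIntegral_comp_le_of_deriv_le c2 hG hc (fun x hx => hx.2) w
        · exact setLIntegral_comp_le_of_deriv_le c3 hG hc (fun x hx => hx.2) w
    _ = _ := by ring

/-- The constant of `airy_kernel_le`. -/
def airyConst (θ : ℝ) : ℝ≥0∞ := 1000 * (jbInt (1 + 2 * θ) + 1)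

lemma airyConst_lt_top {θ : ℝ} (hθ : 0 < θ) : airyConst θ < ⊤ :=
  ENNReal.mul_lt_top (by norm_num)
    (ENNReal.add_lt_top.2 ⟨jbInt_lt_top (by linarith), ENNReal.one_lt_top⟩)

/-- The three contributions are `N^{-2} · L` off the nearly stationary set, and `N^{-3+12θ} · N · L`
and `L N^{-3} · N` on it. Each is `≲ N^{-2+12θ} L` because `N ≥ 2`, and none depends on `λ`. -/
lemma airy_kernel_le {θ lam N L : ℝ} (hθ : 0 < θ) (hθ1 : θ ≤ 1 / 4) (hl : 0 < lam)
    (hl1 : lam ≤ 1) (hN : 2 ≤ N) (hL : 0 ≤ L) (ξ τ : ℝ) :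
    ∫⁻ x in annulus N, ∫⁻ ρ in Set.Icc (-(8 / 5 * L)) (8 / 5 * L),
        ENNReal.ofReal (jb (τ + lam * ξ ^ 2) ^ (-1 + 4 * θ) *
          jb (τ + lam * (ξ - x) ^ 2 - x ^ 3 - ρ) ^ (-(1 + 2 * θ))) ≤
      airyConst θ * ENNReal.ofReal (N ^ (-2 + 12 * θ) * L) := by
  have hN0 : 0 < N := by linarith
  set I := Set.Icc (-(8 / 5 * L)) (8 / 5 * L)
  set w : ℝ → ℝ≥0∞ := fun y => ENNReal.ofReal (jb y ^ (-(1 + 2 * θ))) with hw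
  have hwm : Measurable w := (continuous_jb_rpow _).measurable.ennreal_ofReal
  set E : Set ℝ := {x | x ^ 2 ≤ |-(2 * lam * (ξ - x)) - 3 * x ^ 2|} with hE
  have hEm : MeasurableSet E := measurableSet_le (by fun_prop) (by fun_prop)
  set c₁ := ENNReal.ofReal (63 * N ^ (-3 + 12 * θ))
  set c₂ := ENNReal.ofReal (101 * L * N ^ (-3 : ℝ))
  have hpt : ∀ x ∈ annulus N, ∀ ρ ∈ I,
      ENNReal.ofReal (jb (τ + lam * ξ ^ 2) ^ (-1 + 4 * θ) *
          jb (τ + lam * (ξ - x) ^ 2 - x ^ 3 - ρ) ^ (-(1 + 2 * θ))) ≤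
        E.indicator (fun x => w (τ + lam * (ξ - x) ^ 2 - x ^ 3 - ρ)) x +
          (c₁ + c₂ * w (τ + lam * (ξ - x) ^ 2 - x ^ 3 - ρ)) := by
    intro x hx ρ hρ
    have p2 : 0 ≤ jb (τ + lam * (ξ - x) ^ 2 - x ^ 3 - ρ) ^ (-(1 + 2 * θ)) :=
      Real.rpow_nonneg (jb_pos _).le _
    by_cases hxE : x ∈ E
    · rw [Set.indicator_of_mem hxE]
      refine le_add_right (ENNReal.ofReal_le_ofReal ?_)
      exact mul_le_of_le_one_left p2 (jb_rpow_le_one (by linarith))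
    · have hD : |-(2 * lam * (ξ - x)) - 3 * x ^ 2| < x ^ 2 := not_le.1 hxE
      rw [Set.indicator_of_notMem hxE, zero_add]
      refine (ENNReal.ofReal_le_ofReal (kernel_pointwise hθ hθ1 hl hl1 hN hx
        (abs_le.2 hρ) hD)).trans ?_
      rw [ENNReal.ofReal_add (by positivity) (by positivity),
        ENNReal.ofReal_mul (p := 101 * L * _) (by positivity)]
  have hwm2 : Measurable fun p : ℝ × ℝ => w (τ + lam * (ξ - p.1) ^ 2 - p.1 ^ 3 - p.2) := by
    fun_prop
  have hJ : ∀ x, ∫⁻ ρ in I, w (τ + lam * (ξ - x) ^ 2 - x ^ 3 - ρ) ≤ jbInt (1 + 2 * θ) := by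
    intro x
    refine (setLIntegral_le_lintegral _ _).trans (le_of_eq ?_)
    exact lintegral_sub_left_eq_self w _
  have hvI : volume I = ENNReal.ofReal (16 / 5 * L) := volume_Icc_neg_self L
  -- For fixed `ρ` the quantity `τ - ρ` is a constant of the phase. Integrating in `x` first gains
  -- `N^{-2}`, and the `ρ` integral then costs the length of `I`.
  have t1 : ∫⁻ x in annulus N, ∫⁻ ρ in I,
      E.indicator (fun x => w (τ + lam * (ξ - x) ^ 2 - x ^ 3 - ρ)) x ≤
      3 * ((ENNReal.ofReal (25 / 64 * N ^ 2))⁻¹ * jbInt (1 + 2 * θ)) * ENNReal.ofReal (16 / 5 * L) := by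
    rw [lintegral_lintegral_swap]
    · calc _ ≤ ∫⁻ ρ in I, 3 * ((ENNReal.ofReal (25 / 64 * N ^ 2))⁻¹ * jbInt (1 + 2 * θ)) := by
            refine lintegral_mono fun ρ => ?_
            rw [lintegral_indicator hEm, Measure.restrict_restrict hEm, Set.inter_comm]
            have := setLIntegral_phase_le (lam := lam) (ξ := ξ) hN (τ - ρ) w
            refine (le_of_eq ?_).trans this
            congr 1; ext x; congr 1; ring
        _ = _ := by rw [setLIntegral_const, hvI]
    · refine Measurable.aemeasurable ?_
      have : (Function.uncurry fun x ρ => E.indicator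
          (fun x => w (τ + lam * (ξ - x) ^ 2 - x ^ 3 - ρ)) x) =
          (E ×ˢ Set.univ).indicator fun p : ℝ × ℝ => w (τ + lam * (ξ - p.1) ^ 2 - p.1 ^ 3 - p.2) := by
        ext ⟨x, ρ⟩
        by_cases hx : x ∈ E <;> simp [hx]
      rw [this]
      exact hwm2.indicator (hEm.prod MeasurableSet.univ)
  have t2 : ∫⁻ x in annulus N, ∫⁻ ρ in I, c₁ ≤
      c₁ * ENNReal.ofReal (16 / 5 * L) * ENNReal.ofReal (16 / 5 * N) := by
    rw [setLIntegral_const, setLIntegral_const, hvI]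
    gcongr
    exact volume_annulus_le N
  have t3 : ∫⁻ x in annulus N, ∫⁻ ρ in I, c₂ * w (τ + lam * (ξ - x) ^ 2 - x ^ 3 - ρ) ≤
      c₂ * jbInt (1 + 2 * θ) * ENNReal.ofReal (16 / 5 * N) := by
    calc _ ≤ ∫⁻ x in annulus N, c₂ * jbInt (1 + 2 * θ) := by
          refine lintegral_mono fun x => ?_
          rw [lintegral_const_mul' _ _ ENNReal.ofReal_ne_top]
          gcongr; exact hJ x
      _ ≤ _ := by
        rw [setLIntegral_const]
        gcongr; exact volume_annulus_le N
  calc _ ≤ ∫⁻ x in annulus N, ∫⁻ ρ in I,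
        (E.indicator (fun x => w (τ + lam * (ξ - x) ^ 2 - x ^ 3 - ρ)) x +
          (c₁ + c₂ * w (τ + lam * (ξ - x) ^ 2 - x ^ 3 - ρ))) :=
        setLIntegral_mono' (measurableSet_annulus N) fun x hx =>
          setLIntegral_mono' measurableSet_Icc fun ρ hρ => hpt x hx ρ hρ
    _ = ∫⁻ x in annulus N, ((∫⁻ ρ in I, E.indicator (fun x => w (τ + lam * (ξ - x) ^ 2 - x ^ 3 - ρ)) x)
          + ((∫⁻ ρ in I, c₁) + ∫⁻ ρ in I, c₂ * w (τ + lam * (ξ - x) ^ 2 - x ^ 3 - ρ))) := by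
        congr 1; ext x
        rw [lintegral_add_right _ (by fun_prop), lintegral_add_left (by fun_prop)]
    _ = _ := by
        rw [lintegral_add_right, lintegral_add_left]
        · fun_prop
        · refine Measurable.add (by fun_prop) ?_
          exact Measurable.lintegral_prod_right' (f := fun p : ℝ × ℝ =>
            c₂ * w (τ + lam * (ξ - p.1) ^ 2 - p.1 ^ 3 - p.2)) (by fun_prop)
    _ ≤ _ := add_le_add t1 (add_le_add t2 t3)
    _ ≤ _ := by
      set X := ENNReal.ofReal (N ^ (-2 + 12 * θ) * L)
      set J := jbInt (1 + 2 * θ)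
      have hNle : N ^ (-2 : ℝ) ≤ N ^ (-2 + 12 * θ) :=
        Real.rpow_le_rpow_of_exponent_le (by linarith) (by linarith)
      have hN2 : N ^ (-2 : ℝ) = (N ^ 2)⁻¹ := by
        rw [Real.rpow_neg hN0.le]; norm_cast
      have b1 : 3 * ((ENNReal.ofReal (25 / 64 * N ^ 2))⁻¹ * J) * ENNReal.ofReal (16 / 5 * L) ≤
          30 * X * J := by
        have : (ENNReal.ofReal (25 / 64 * N ^ 2))⁻¹ * ENNReal.ofReal (16 / 5 * L) ≤ 10 * X := by
          rw [← ENNReal.ofReal_inv_of_pos (by positivity), ← ENNReal.ofReal_mul (by positivity),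
            show (10 : ℝ≥0∞) = ENNReal.ofReal 10 by simp, ← ENNReal.ofReal_mul (by norm_num)]
          apply ENNReal.ofReal_le_ofReal
          rw [hN2] at hNle
          rw [mul_inv]
          have : (N ^ 2)⁻¹ * L ≤ N ^ (-2 + 12 * θ) * L := by gcongr
          have p : 0 ≤ (N ^ 2)⁻¹ * L := by positivity
          nlinarith
        calc _ = 3 * J * ((ENNReal.ofReal (25 / 64 * N ^ 2))⁻¹ * ENNReal.ofReal (16 / 5 * L)) := by ring
          _ ≤ 3 * J * (10 * X) := by gcongr
          _ = _ := by ring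
      have b2 : c₁ * ENNReal.ofReal (16 / 5 * L) * ENNReal.ofReal (16 / 5 * N) ≤ 700 * X := by
        rw [← ENNReal.ofReal_mul (by positivity), ← ENNReal.ofReal_mul (by positivity),
            show (700 : ℝ≥0∞) = ENNReal.ofReal 700 by simp, ← ENNReal.ofReal_mul (by norm_num)]
        apply ENNReal.ofReal_le_ofReal
        have e : N ^ (-2 + 12 * θ) = N ^ (-3 + 12 * θ) * N := by
          rw [← Real.rpow_add_one hN0.ne']; ring_nf
        rw [e]
        have p : 0 ≤ N ^ (-3 + 12 * θ) * N * L := by positivity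
        nlinarith
      have b3 : c₂ * J * ENNReal.ofReal (16 / 5 * N) ≤ 700 * X * J := by
        have : c₂ * ENNReal.ofReal (16 / 5 * N) ≤ 700 * X := by
          rw [← ENNReal.ofReal_mul (by positivity),
            show (700 : ℝ≥0∞) = ENNReal.ofReal 700 by simp, ← ENNReal.ofReal_mul (by norm_num)]
          apply ENNReal.ofReal_le_ofReal
          have e : N ^ (-2 : ℝ) = N ^ (-3 : ℝ) * N := by
            rw [← Real.rpow_add_one hN0.ne']; norm_num
          rw [e] at hNle
          have : N ^ (-3 : ℝ) * N * L ≤ N ^ (-2 + 12 * θ) * L := by gcongr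
          have p : 0 ≤ N ^ (-3 : ℝ) * N * L := by positivity
          nlinarith
        calc _ = c₂ * ENNReal.ofReal (16 / 5 * N) * J := by ring
          _ ≤ _ := by gcongr
      calc _ ≤ 30 * X * J + (700 * X + 700 * X * J) := add_le_add b1 (add_le_add b2 b3)
        _ ≤ 1000 * X * J + 1000 * X := by
          calc _ = 730 * (X * J) + 700 * X := by ring
            _ ≤ 1000 * (X * J) + 1000 * X := by gcongr <;> norm_num
            _ = _ := by ring
        _ = _ := by rw [airyConst]; ring

/-- The kernel of the Schrödinger–Schrödinger interaction. -/
lemma schr_kernel_le {r lam ξ : ℝ} (hl : 0 < lam) (hξ : ξ ≠ 0) (τ : ℝ) :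
    ∫⁻ x, ∫⁻ t, ENNReal.ofReal (jb (t + lam * x ^ 2) ^ (-r) *
        jb (t - τ + lam * (x - ξ) ^ 2) ^ (-r)) ≤
      (ENNReal.ofReal (2 * lam * |ξ|))⁻¹ * jbInt r ^ 2 := by
  set w : ℝ → ℝ≥0∞ := fun y => ENNReal.ofReal (jb y ^ (-r)) with hw
  have hwm : Measurable w := (continuous_jb_rpow _).measurable.ennreal_ofReal
  -- Translating `t` by `-λx²` removes the first phase. In the second the terms quadratic in `x`
  -- cancel, leaving an affine function of slope `-2λξ`.
  have h1 : ∀ x, ∫⁻ t, ENNReal.ofReal (jb (t + lam * x ^ 2) ^ (-r) *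
        jb (t - τ + lam * (x - ξ) ^ 2) ^ (-r)) =
      ∫⁻ s, w s * w ((s - τ + lam * ξ ^ 2) + (-(2 * lam * ξ)) * x) := by
    intro x
    rw [← lintegral_add_right_eq_self _ (-(lam * x ^ 2))]
    congr 1; ext s
    rw [ENNReal.ofReal_mul (Real.rpow_nonneg (jb_pos _).le _)]
    simp only [w]
    congr 4 <;> ring
  simp_rw [h1]
  rw [lintegral_lintegral_swap (by fun_prop)]
  calc _ ≤ ∫⁻ s, w s * ((ENNReal.ofReal (2 * lam * |ξ|))⁻¹ * jbInt r) := by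
        refine lintegral_mono fun s => ?_
        dsimp only
        rw [lintegral_const_mul' _ _ ENNReal.ofReal_ne_top]
        gcongr
        have := lintegral_comp_affine_le (m := -(2 * lam * ξ)) (by simp [hl.ne', hξ])
          (s - τ + lam * ξ ^ 2) w
        rwa [abs_neg, abs_mul, abs_of_pos (by positivity : 0 < 2 * lam)] at this
    _ = _ := by
        rw [lintegral_mul_const _ hwm, sq, ← mul_assoc, mul_comm (∫⁻ s, w s), mul_assoc]
        rfl

/-! ### Tempered distributions that are functions -/

lemma integrable_schwartz_mul {p : ℝ≥0∞} [hp : Fact (1 ≤ p)] {f : Plane → ℂ} (hf : MemLp f p volume)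
    (φ : 𝓢(Plane, ℂ)) : Integrable (fun x => f x * φ x) volume := by
  have := ENNReal.HolderConjugate.inv_one_sub_inv' hp.out
  exact hf.integrable_mul (φ.memLp (1 - p⁻¹)⁻¹ volume)

lemma exists_isFun_of_memLp {p : ℝ≥0∞} [Fact (1 ≤ p)] {f : Plane → ℂ} (hf : MemLp f p volume) :
    ∃ T : 𝓢'(Plane, ℂ), IsFun T f := by
  refine ⟨Lp.toTemperedDistribution (hf.toLp f), fun φ => ⟨integrable_schwartz_mul hf φ, ?_⟩⟩
  rw [Lp.toTemperedDistribution_apply]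
  refine integral_congr_ae ?_
  filter_upwards [hf.coeFn_toLp] with x hx
  rw [hx, smul_eq_mul, mul_comm]

lemma isFun_toTemperedDistribution {p : ℝ≥0∞} [Fact (1 ≤ p)] (f : Lp (α := Plane) ℂ p volume) :
    IsFun (Lp.toTemperedDistribution f) f := by
  refine fun φ => ⟨integrable_schwartz_mul (Lp.memLp f) φ, ?_⟩
  rw [Lp.toTemperedDistribution_apply]
  exact integral_congr_ae (ae_of_all _ fun x => by simp [mul_comm])

lemma exists_schwartz_of_contDiff {g : Plane → ℝ} (hg : ContDiff ℝ ∞ g) (hc : HasCompactSupport g) :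
    ∃ φ : 𝓢(Plane, ℂ), ∀ x, φ x = (g x : ℂ) := by
  have h1 : HasCompactSupport (fun x => (g x : ℂ)) := hc.comp_left (g := fun r : ℝ => (r : ℂ)) rfl
  have h2 : ContDiff ℝ ∞ (fun x => (g x : ℂ)) := Complex.ofRealCLM.contDiff.comp hg
  exact ⟨h1.toSchwartzMap h2, fun x => rfl⟩

lemma IsFun.locallyIntegrable {u : 𝓢'(Plane, ℂ)} {f : Plane → ℂ} (h : IsFun u f) :
    LocallyIntegrable f volume := by
  intro x
  let b : ContDiffBump x := ⟨1, 2, by norm_num, by norm_num⟩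
  obtain ⟨φ, hφ⟩ := exists_schwartz_of_contDiff (b.contDiff (n := (⊤ : ℕ∞))) b.hasCompactSupport
  refine ⟨Metric.ball x 1, Metric.ball_mem_nhds x one_pos, ?_⟩
  refine ((h φ).1.integrableOn (s := Metric.ball x 1)).congr_fun (fun y hy => ?_)
    Metric.isOpen_ball.measurableSet
  have : b y = 1 := b.one_of_mem_closedBall (Metric.ball_subset_closedBall hy)
  simp [hφ, this]

lemma IsFun.aestronglyMeasurable {u : 𝓢'(Plane, ℂ)} {f : Plane → ℂ} (h : IsFun u f) :
    AEStronglyMeasurable f volume := h.locallyIntegrable.aestronglyMeasurable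

lemma IsFun.ae_eq {u : 𝓢'(Plane, ℂ)} {f g : Plane → ℂ} (hf : IsFun u f) (hg : IsFun u g) :
    f =ᵐ[volume] g := by
  have := ae_eq_zero_of_integral_contDiff_smul_eq_zero
    (hf.locallyIntegrable.sub hg.locallyIntegrable) fun r hr hc => by
      obtain ⟨φ, hφ⟩ := exists_schwartz_of_contDiff hr hc
      have e : (fun x => r x • (f - g) x) = fun x => f x * φ x - g x * φ x := by
        ext x; simp [hφ]; ring
      rw [e, integral_sub (hf φ).1 (hg φ).1, ← (hf φ).2, ← (hg φ).2, sub_self]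
  filter_upwards [this] with x hx
  exact sub_eq_zero.1 hx

lemma IsFun.congr {u : 𝓢'(Plane, ℂ)} {f g : Plane → ℂ} (hf : IsFun u f) (h : f =ᵐ[volume] g) :
    IsFun u g := by
  intro φ
  have e : (fun x => f x * φ x) =ᵐ[volume] fun x => g x * φ x := by
    filter_upwards [h] with x hx; rw [hx]
  exact ⟨(hf φ).1.congr e, (hf φ).2.trans (integral_congr_ae e)⟩

lemma IsFun.add {u v : 𝓢'(Plane, ℂ)} {f g : Plane → ℂ} (hf : IsFun u f) (hg : IsFun v g) :
    IsFun (u + v) (fun x => f x + g x) := by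
  intro φ
  have e : (fun x => (f x + g x) * φ x) = fun x => f x * φ x + g x * φ x := by ext x; ring
  refine ⟨by rw [e]; exact (hf φ).1.add (hg φ).1, ?_⟩
  rw [e, integral_add (hf φ).1 (hg φ).1, ← (hf φ).2, ← (hg φ).2]
  rfl

lemma IsFun.zero : IsFun (0 : 𝓢'(Plane, ℂ)) (fun _ => 0) := fun φ => ⟨by simp, by simp⟩

lemma IsFun.sum {ι : Type*} (s : Finset ι) {u : ι → 𝓢'(Plane, ℂ)} {f : ι → Plane → ℂ}
    (h : ∀ i ∈ s, IsFun (u i) (f i)) : IsFun (∑ i ∈ s, u i) (fun x => ∑ i ∈ s, f i x) := by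
  classical
  induction s using Finset.induction_on with
  | empty => simpa using IsFun.zero
  | insert i s hi ih =>
    simp_rw [Finset.sum_insert hi]
    exact (h i (Finset.mem_insert_self i s)).add
      (ih fun j hj => h j (Finset.mem_insert_of_mem hj))

lemma IsFun.smulLeft {u : 𝓢'(Plane, ℂ)} {f g : Plane → ℂ} (hf : IsFun u f)
    (hg : g.HasTemperateGrowth) :
    IsFun (TemperedDistribution.smulLeftCLM ℂ g u) (fun x => g x * f x) := by
  intro φ
  have h := hf (SchwartzMap.smulLeftCLM ℂ g φ)
  have e : (fun x => f x * (SchwartzMap.smulLeftCLM ℂ g φ) x) = fun x => g x * f x * φ x := by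
    ext x
    rw [SchwartzMap.smulLeftCLM_apply_apply hg, smul_eq_mul]; ring
  rw [e] at h
  exact h

lemma IsFun.const_smul {u : 𝓢'(Plane, ℂ)} {f : Plane → ℂ} (hf : IsFun u f) (c : ℂ) :
    IsFun (c • u) (fun x => c * f x) := by
  have := hf.smulLeft (Function.HasTemperateGrowth.const c)
  rwa [TemperedDistribution.smulLeftCLM_const] at this

/-! ### The Fourier transform on `L²` -/

/-- Identifies the distributional Fourier transform with the unitary one on L², so that Plancherel
applies to any pair of representing functions. -/
lemma fourier_toLp_eq {u : 𝓢'(Plane, ℂ)} {U F : Plane → ℂ} (hu : IsFun u U) (hF : IsFun (𝓕 u) F)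
    (hU : MemLp U 2 volume) :
    F =ᵐ[volume] (𝓕 (hU.toLp U) : Lp (α := Plane) ℂ 2 volume) := by
  have h1 : Lp.toTemperedDistribution (hU.toLp U) = u := by
    ext φ
    rw [(isFun_toTemperedDistribution (hU.toLp U) φ).2, (hu φ).2]
    refine integral_congr_ae ?_
    filter_upwards [hU.coeFn_toLp] with x hx
    rw [hx]
  refine hF.ae_eq ?_
  rw [← h1, Lp.fourier_toTemperedDistribution_eq]
  exact isFun_toTemperedDistribution _

lemma eLpNorm_fourier_eq {u : 𝓢'(Plane, ℂ)} {U F : Plane → ℂ} (hu : IsFun u U)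
    (hF : IsFun (𝓕 u) F) (hU : MemLp U 2 volume) : eLpNorm F 2 volume = eLpNorm U 2 volume := by
  rw [eLpNorm_congr_ae (fourier_toLp_eq hu hF hU), ← eLpNorm_congr_ae hU.coeFn_toLp,
    ← Lp.enorm_def, ← Lp.enorm_def, ← ofReal_norm, ← ofReal_norm, Lp.norm_fourier_eq]

lemma exists_isFun_fourier {u : 𝓢'(Plane, ℂ)} {U : Plane → ℂ} (hu : IsFun u U)
    (hU : MemLp U 2 volume) : ∃ F, IsFun (𝓕 u) F ∧ MemLp F 2 volume := by
  have h1 : Lp.toTemperedDistribution (hU.toLp U) = u := by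
    ext φ
    rw [(isFun_toTemperedDistribution (hU.toLp U) φ).2, (hu φ).2]
    refine integral_congr_ae ?_
    filter_upwards [hU.coeFn_toLp] with x hx
    rw [hx]
  refine ⟨(𝓕 (hU.toLp U) : Lp (α := Plane) ℂ 2 volume), ?_, Lp.memLp _⟩
  rw [← h1, Lp.fourier_toTemperedDistribution_eq]
  exact isFun_toTemperedDistribution _

lemma exists_isFun_of_fourier {u : 𝓢'(Plane, ℂ)} {F : Plane → ℂ} (hu : IsFun (𝓕 u) F)
    (hF : MemLp F 2 volume) : ∃ U, IsFun u U ∧ MemLp U 2 volume := by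
  have h1 : Lp.toTemperedDistribution (hF.toLp F) = 𝓕 u := by
    ext φ
    rw [(isFun_toTemperedDistribution (hF.toLp F) φ).2, (hu φ).2]
    refine integral_congr_ae ?_
    filter_upwards [hF.coeFn_toLp] with x hx
    rw [hx]
  refine ⟨(𝓕⁻ (hF.toLp F) : Lp (α := Plane) ℂ 2 volume), ?_, Lp.memLp _⟩
  have : u = 𝓕⁻ (𝓕 u) := (FourierTransform.fourierInv_fourier_eq u).symm
  rw [this, ← h1, Lp.fourierInv_toTemperedDistribution_eq]
  exact isFun_toTemperedDistribution _

/-- Reflection of a Schwartz function. -/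
def reflS (φ : 𝓢(Plane, ℂ)) : 𝓢(Plane, ℂ) :=
  SchwartzMap.compCLMOfContinuousLinearEquiv ℂ (ContinuousLinearEquiv.neg ℝ) φ

lemma reflS_apply (φ : 𝓢(Plane, ℂ)) (x : Plane) : reflS φ x = φ (-x) := rfl

/-- Complex conjugation of a Schwartz function. -/
def conjS (φ : 𝓢(Plane, ℂ)) : 𝓢(Plane, ℂ) :=
  SchwartzMap.postcompCLM (𝕜 := ℝ) (Complex.conjCLE : ℂ →L[ℝ] ℂ) φ

lemma conjS_apply (φ : 𝓢(Plane, ℂ)) (x : Plane) : conjS φ x = (starRingEnd ℂ) (φ x) := rfl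

lemma fourier_schwartz_apply (φ : 𝓢(Plane, ℂ)) (x : Plane) :
    (𝓕 φ) x = ∫ v, Complex.exp (↑(-2 * Real.pi * inner ℝ v x) * Complex.I) * φ v := by
  rw [SchwartzMap.fourier_coe, Real.fourier_eq']
  rfl

lemma fourierInv_schwartz_apply (φ : 𝓢(Plane, ℂ)) (x : Plane) :
    (𝓕⁻ φ) x = ∫ v, Complex.exp (↑(2 * Real.pi * inner ℝ v x) * Complex.I) * φ v := by
  rw [SchwartzMap.fourierInv_coe, Real.fourierInv_eq']
  rfl

lemma fourierInv_eq_fourier_neg (φ : 𝓢(Plane, ℂ)) (x : Plane) : (𝓕⁻ φ) x = (𝓕 φ) (-x) := by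
  rw [fourier_schwartz_apply, fourierInv_schwartz_apply]
  simp only [inner_neg_right, mul_neg, neg_mul, neg_neg]

lemma fourier_fourier_apply (φ : 𝓢(Plane, ℂ)) (x : Plane) : (𝓕 (𝓕 φ)) x = φ (-x) := by
  have h := fourierInv_eq_fourier_neg (𝓕 φ) (-x)
  rw [neg_neg] at h
  rw [← h, FourierTransform.fourierInv_fourier_eq]

lemma fourier_conjS_reflS (φ : 𝓢(Plane, ℂ)) (x : Plane) :
    (𝓕 (conjS (reflS φ))) x = (starRingEnd ℂ) ((𝓕 φ) x) := by
  rw [fourier_schwartz_apply, fourier_schwartz_apply, ← integral_conj,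
    ← integral_neg_eq_self _ volume]
  refine integral_congr_ae (ae_of_all _ fun v => ?_)
  simp only [conjS_apply, reflS_apply, neg_neg, map_mul, ← Complex.exp_conj, Complex.conj_ofReal,
    Complex.conj_I, inner_neg_left]
  congr 2
  push_cast; ring

lemma fourier_compSubConst (φ : 𝓢(Plane, ℂ)) (a x : Plane) :
    (𝓕 (SchwartzMap.compSubConstCLM ℂ a φ)) x =
      Complex.exp (↑(-2 * Real.pi * inner ℝ a x) * Complex.I) * (𝓕 φ) x := by
  rw [fourier_schwartz_apply, fourier_schwartz_apply, ← integral_const_mul,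
    ← integral_add_right_eq_self _ a]
  refine integral_congr_ae (ae_of_all _ fun v => ?_)
  simp only [SchwartzMap.compSubConstCLM_apply, add_sub_cancel_right, inner_add_left]
  rw [← mul_assoc, ← Complex.exp_add]
  congr 2
  push_cast; ring

/-- Complex conjugation of functions and the Fourier transform. -/
lemma IsFun.fourier_conj {u : 𝓢'(Plane, ℂ)} {U F : Plane → ℂ} (hu : IsFun u U)
    (hF : IsFun (𝓕 u) F) {w : 𝓢'(Plane, ℂ)} (hw : IsFun w fun x => (starRingEnd ℂ) (U x)) :
    IsFun (𝓕 w) fun ζ => (starRingEnd ℂ) (F (-ζ)) := by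
  intro φ
  have h := hF (conjS (reflS φ))
  have e : (fun ζ => (starRingEnd ℂ) (F (-ζ)) * φ ζ) =
      fun ζ => (starRingEnd ℂ) ((fun η => F η * conjS (reflS φ) η) (-ζ)) := by
    ext ζ; simp [conjS_apply, reflS_apply]
  refine ⟨?_, ?_⟩
  · rw [e]
    exact (LinearIsometryEquiv.integrable_comp_iff Complex.conjLIE).2 h.1.comp_neg
  · rw [e, integral_conj, integral_neg_eq_self (fun η => F η * conjS (reflS φ) η) volume, ← h.2, TemperedDistribution.fourier_apply,
      TemperedDistribution.fourier_apply, (hw _).2, (hu _).2, ← integral_conj]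
    refine integral_congr_ae (ae_of_all _ fun v => ?_)
    simp [fourier_conjS_reflS]

/-- Modulation corresponds to translation of the Fourier transform. -/
lemma IsFun.fourier_modulate {u : 𝓢'(Plane, ℂ)} {U F : Plane → ℂ} (hu : IsFun u U)
    (hF : IsFun (𝓕 u) F) (a : Plane) {w : 𝓢'(Plane, ℂ)}
    (hw : IsFun w fun x => Complex.exp (↑(-2 * Real.pi * inner ℝ a x) * Complex.I) * U x) :
    IsFun (𝓕 w) fun ζ => F (ζ + a) := by
  intro φ
  have h := hF (SchwartzMap.compSubConstCLM ℂ a φ)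
  have e : (fun ζ => F (ζ + a) * φ ζ) =
      fun ζ => (fun η => F η * SchwartzMap.compSubConstCLM ℂ a φ η) (ζ + a) := by
    ext ζ; simp
  refine ⟨?_, ?_⟩
  · rw [e]; exact h.1.comp_add_right a
  · rw [e, integral_add_right_eq_self (fun η => F η * SchwartzMap.compSubConstCLM ℂ a φ η) a,
      ← h.2, TemperedDistribution.fourier_apply, TemperedDistribution.fourier_apply,
      (hw _).2, (hu _).2]
    refine integral_congr_ae (ae_of_all _ fun v => ?_)
    simp only [fourier_compSubConst]
    ring

/-- Translation corresponds to modulation of the Fourier transform. -/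
lemma IsFun.fourier_translate {u : 𝓢'(Plane, ℂ)} {U F : Plane → ℂ} (hu : IsFun u U)
    (hF : IsFun (𝓕 u) F) (a : Plane) {w : 𝓢'(Plane, ℂ)} (hw : IsFun w fun x => U (x + a)) :
    IsFun (𝓕 w) fun ζ => Complex.exp (↑(2 * Real.pi * inner ℝ a ζ) * Complex.I) * F ζ := by
  intro φ
  set χ := 𝓕 (SchwartzMap.compSubConstCLM ℂ (-a) (𝓕⁻ φ)) with hχ
  have e1 : ∀ ζ, χ ζ = Complex.exp (↑(2 * Real.pi * inner ℝ a ζ) * Complex.I) * φ ζ := by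
    intro ζ
    rw [hχ, fourier_compSubConst, FourierTransform.fourier_fourierInv_eq]
    congr 2; rw [inner_neg_left]; push_cast; ring
  have e2 : ∀ x, (𝓕 χ) x = (𝓕 φ) (x - a) := by
    intro x
    rw [hχ, fourier_fourier_apply, SchwartzMap.compSubConstCLM_apply, fourierInv_eq_fourier_neg]
    congr 1; abel
  have h := hF χ
  have e : (fun ζ => Complex.exp (↑(2 * Real.pi * inner ℝ a ζ) * Complex.I) * F ζ * φ ζ) =
      fun ζ => F ζ * χ ζ := by
    ext ζ; rw [e1]; ring
  rw [e]
  refine ⟨h.1, ?_⟩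
  rw [← h.2, TemperedDistribution.fourier_apply, TemperedDistribution.fourier_apply,
      (hw _).2, (hu _).2, ← integral_sub_right_eq_self _ a]
  refine integral_congr_ae (ae_of_all _ fun v => ?_)
  simp [e2]

lemma memLp_comp_neg {f : Plane → ℂ} {p : ℝ≥0∞} (hf : MemLp f p volume) :
    MemLp (fun x => f (-x)) p volume :=
  hf.comp_measurePreserving (Measure.measurePreserving_neg volume)

lemma memLp_conj {f : Plane → ℂ} {p : ℝ≥0∞} (hf : MemLp f p volume) :
    MemLp (fun x => (starRingEnd ℂ) (f x)) p volume := hf.star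

/-- Parseval's formula in bilinear form. -/
lemma integral_mul_eq_of_fourier {u v : 𝓢'(Plane, ℂ)} {U V F G : Plane → ℂ} (hu : IsFun u U)
    (hF : IsFun (𝓕 u) F) (hv : IsFun v V) (hG : IsFun (𝓕 v) G) (hU : MemLp U 2 volume)
    (hV : MemLp V 2 volume) : ∫ x, U x * V x = ∫ ζ, F ζ * G (-ζ) := by
  have hVc := memLp_conj hV
  obtain ⟨w, hw⟩ := exists_isFun_of_memLp hVc
  have hw' := hv.fourier_conj hG hw
  have e1 := fourier_toLp_eq hu hF hU
  have e2 := fourier_toLp_eq hw hw' hVc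
  have h := Lp.inner_fourier_eq (hVc.toLp _) (hU.toLp U)
  rw [L2.inner_def, L2.inner_def] at h
  have h1 : ∫ x, U x * V x = ∫ x, inner ℂ (hVc.toLp _ x) (hU.toLp U x) := by
    refine integral_congr_ae ?_
    filter_upwards [hVc.coeFn_toLp, hU.coeFn_toLp] with x hx1 hx2
    rw [hx1, hx2]; simp
  rw [h1, ← h]
  refine integral_congr_ae ?_
  filter_upwards [e1, e2] with x hx1 hx2
  rw [← hx1, ← hx2]; simp

lemma IsFun.fourier_of_integrable {u : 𝓢'(Plane, ℂ)} {U : Plane → ℂ} (hu : IsFun u U)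
    (hU : Integrable U volume) : IsFun (𝓕 u) (𝓕 U) := by
  intro φ
  have hcont : Continuous (fun p : Plane × Plane => (innerₗ Plane) p.1 p.2) := continuous_inner
  have hb : MemLp (𝓕 U) ∞ volume := by
    refine memLp_top_of_bound (C := ∫ x, ‖U x‖) ?_ (ae_of_all _ fun x => ?_)
    · exact (VectorFourier.fourierIntegral_continuous Real.continuous_fourierChar hcont
        hU).aestronglyMeasurable
    · exact VectorFourier.norm_fourierIntegral_le_integral_norm _ _ _ _ _
  refine ⟨integrable_schwartz_mul hb φ, ?_⟩
  rw [TemperedDistribution.fourier_apply, (hu _).2]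
  have := VectorFourier.integral_fourierIntegral_smul_eq_flip (μ := (volume : Measure Plane))
    (ν := (volume : Measure Plane)) (L := innerₗ Plane)
    Real.continuous_fourierChar hcont hU φ.integrable
  rw [flip_innerₗ] at this
  exact this.symm

/-- The Fourier transform of a product of `L²` functions is the convolution of the Fourier
transforms. -/
lemma IsFun.fourier_mul {u v z : 𝓢'(Plane, ℂ)} {U V F G : Plane → ℂ} (hu : IsFun u U)
    (hF : IsFun (𝓕 u) F) (hv : IsFun v V) (hG : IsFun (𝓕 v) G) (hU : MemLp U 2 volume)
    (hV : MemLp V 2 volume) (hz : IsFun z fun x => U x * V x) :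
    IsFun (𝓕 z) fun ζ => ∫ η, F η * G (ζ - η) := by
  have hUV : Integrable (fun x => U x * V x) volume := hU.integrable_mul hV
  have e : 𝓕 (fun x => U x * V x) = fun ζ => ∫ η, F η * G (ζ - η) := by
    ext ζ
    -- The value of `𝓕 (UV)` at `ζ` is the integral of `U` against `V` modulated by `ζ`. Parseval
    -- turns it into the convolution, modulation becoming translation by `ζ`.
    have hm : MemLp (fun x => Complex.exp (↑(-2 * Real.pi * inner ℝ ζ x) * Complex.I) * V x) 2
        volume := by
      refine hV.of_le ?_ (ae_of_all _ fun x => ?_)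
      · exact (by fun_prop : Continuous fun x : Plane =>
          Complex.exp (↑(-2 * Real.pi * inner ℝ ζ x) * Complex.I)).aestronglyMeasurable.mul hV.1
      · rw [norm_mul, Complex.norm_exp_ofReal_mul_I, one_mul]
    obtain ⟨w, hw⟩ := exists_isFun_of_memLp hm
    have hw' := hv.fourier_modulate hG ζ hw
    have h := integral_mul_eq_of_fourier hu hF hw hw' hU hm
    rw [Real.fourier_eq']
    have e2 : ∀ η, F η * G (-η + ζ) = F η * G (ζ - η) := fun η => by
      rw [neg_add_eq_sub]
    simp_rw [e2] at h
    rw [← h]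
    refine integral_congr_ae (ae_of_all _ fun v => ?_)
    simp only [smul_eq_mul]
    rw [real_inner_comm]; ring
  rw [← e]
  exact hz.fourier_of_integrable hUV

/-! ### Multiplication by a function of one variable as a convolution on the Fourier side -/

lemma hasTemperateGrowth_comp_inner (a : 𝓢(ℝ, ℂ)) (e : Plane) :
    (fun p : Plane => a (inner ℝ e p)).HasTemperateGrowth :=
  a.hasTemperateGrowth.comp (Function.hasTemperateGrowth_inner_right e)

lemma real_fourierInv_fourier_apply (a : 𝓢(ℝ, ℂ)) (s : ℝ) :
    a s = ∫ ρ, Complex.exp (↑(2 * Real.pi * (ρ * s)) * Complex.I) * (𝓕 a) ρ := by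
  have h : (𝓕⁻ (𝓕 a)) s = a s := by rw [FourierTransform.fourierInv_fourier_eq]
  rw [← h, SchwartzMap.fourierInv_coe, Real.fourierInv_eq']
  refine integral_congr_ae (ae_of_all _ fun ρ => ?_)
  simp [mul_comm]

/-- Insert the Fourier inversion formula for `a` and use Fubini: a multiplier depending only on the
coordinate along `e` averages translates along `e`. It serves by duality for multiplication by
`ψ(t)`; its mirror image below serves for the multiplier `P_0`. -/
lemma fourierInv_smulLeft_fourier (a : 𝓢(ℝ, ℂ)) (e : Plane) (φ : 𝓢(Plane, ℂ)) (x : Plane) :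
    (𝓕⁻ (SchwartzMap.smulLeftCLM ℂ (fun p : Plane => a (inner ℝ e p)) (𝓕 φ))) x =
      ∫ ρ, (𝓕 a) ρ * φ (x + ρ • e) := by
  rw [fourierInv_schwartz_apply]
  have h1 : ∀ p : Plane, Complex.exp (↑(2 * Real.pi * inner ℝ p x) * Complex.I) *
      (SchwartzMap.smulLeftCLM ℂ (fun p : Plane => a (inner ℝ e p)) (𝓕 φ)) p =
      ∫ ρ, Complex.exp (↑(2 * Real.pi * inner ℝ p (x + ρ • e)) * Complex.I) *
        ((𝓕 φ) p * (𝓕 a) ρ) := by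
    intro p
    rw [SchwartzMap.smulLeftCLM_apply_apply (hasTemperateGrowth_comp_inner a e), smul_eq_mul,
      real_fourierInv_fourier_apply a, mul_comm (∫ ρ, _), ← mul_assoc, ← integral_const_mul]
    refine integral_congr_ae (ae_of_all _ fun ρ => ?_)
    simp only
    rw [inner_add_right, inner_smul_right, real_inner_comm p e,
      show Complex.exp (↑(2 * Real.pi * (inner ℝ p x + ρ * inner ℝ p e)) * Complex.I) =
        Complex.exp (↑(2 * Real.pi * inner ℝ p x) * Complex.I) *
          Complex.exp (↑(2 * Real.pi * (ρ * inner ℝ p e)) * Complex.I) by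
        rw [← Complex.exp_add]; congr 1; push_cast; ring]
    ring
  simp_rw [h1]
  rw [integral_integral_swap]
  · refine integral_congr_ae (ae_of_all _ fun ρ => ?_)
    have h2 : φ (x + ρ • e) = (𝓕⁻ (𝓕 φ)) (x + ρ • e) := by
      rw [FourierTransform.fourierInv_fourier_eq]
    simp only
    rw [h2, fourierInv_schwartz_apply, ← integral_const_mul]
    refine integral_congr_ae (ae_of_all _ fun p => ?_)
    simp only
    ring
  · have h3 : Integrable (fun q : Plane × ℝ => (𝓕 φ) q.1 * (𝓕 a) q.2) (volume.prod volume) :=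
      (𝓕 φ).integrable.mul_prod (𝓕 a).integrable
    refine h3.mono ?_ (ae_of_all _ fun q => ?_)
    · exact (by fun_prop : Continuous fun q : Plane × ℝ =>
        Complex.exp (↑(2 * Real.pi * inner ℝ q.1 (x + q.2 • e)) * Complex.I)).aestronglyMeasurable.mul
          h3.1
    · simp only [Function.uncurry]
      rw [norm_mul, Complex.norm_exp_ofReal_mul_I, one_mul]

lemma fourier_smulLeft_fourierInv (a : 𝓢(ℝ, ℂ)) (e : Plane) (φ : 𝓢(Plane, ℂ)) (x : Plane) :
    (𝓕 (SchwartzMap.smulLeftCLM ℂ (fun p : Plane => a (inner ℝ e p)) (𝓕⁻ φ))) x =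
      ∫ ρ, (𝓕 a) ρ * φ (x - ρ • e) := by
  have h0 : 𝓕⁻ φ = 𝓕 (reflS φ) := by
    ext y
    rw [fourierInv_eq_fourier_neg, fourier_schwartz_apply, fourier_schwartz_apply,
      ← integral_neg_eq_self _ volume]
    simp [reflS_apply]
  have h := fourierInv_smulLeft_fourier a e (reflS φ) (-x)
  rw [fourierInv_eq_fourier_neg, neg_neg, ← h0] at h
  rw [h]
  refine integral_congr_ae (ae_of_all _ fun ρ => ?_)
  simp only [reflS_apply]
  congr 2
  rw [neg_add, neg_neg, sub_eq_add_neg]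

/-! ### Functions of polynomially weighted `L²` -/

lemma exists_isFun_of_weighted {f : Plane → ℂ} {M : ℝ}
    (hf : MemLp (fun x : Plane => (((1 + ‖x‖ ^ 2) ^ (-M) : ℝ) : ℂ) * f x) 2 volume) :
    ∃ T : 𝓢'(Plane, ℂ), IsFun T f := by
  obtain ⟨T, hT⟩ := exists_isFun_of_memLp hf
  have hg : (fun x : Plane => (((1 + ‖x‖ ^ 2) ^ M : ℝ) : ℂ)).HasTemperateGrowth :=
    Function.Complex.hasTemperateGrowth_ofReal.comp (Function.hasTemperateGrowth_one_add_norm_sq_rpow _ M)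
  refine ⟨_, (hT.smulLeft hg).congr (ae_of_all _ fun x => ?_)⟩
  have hp : (0 : ℝ) < 1 + ‖x‖ ^ 2 := by positivity
  simp only
  rw [← mul_assoc, ← Complex.ofReal_mul, ← Real.rpow_add hp]
  simp

/-- Weights comparable from below to a negative power of `1 + |x|²`, and slowly varying in the
direction of the second coordinate. -/
structure IsWeight (W : Plane → ℝ) (C : ℝ) : Prop where
  measurable : Measurable W
  pos : ∀ x, 0 < W x
  lower : ∃ c M : ℝ, 0 < c ∧ ∀ x : Plane, c * (1 + ‖x‖ ^ 2) ^ (-M) ≤ W x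
  shift : ∀ (x : Plane) (ρ : ℝ), W (x + ρ • (WithLp.toLp 2 ((0 : ℝ), (1 : ℝ)) : Plane)) ≤ C * jb ρ * W x

lemma exists_isFun_of_isWeight {W : Plane → ℝ} {C : ℝ} (hW : IsWeight W C) {f : Plane → ℂ}
    (hfm : AEStronglyMeasurable f volume)
    (hf : ∫⁻ x, (ENNReal.ofReal (W x) * ‖f x‖ₑ) ^ 2 < ⊤) : ∃ T : 𝓢'(Plane, ℂ), IsFun T f := by
  obtain ⟨c, M, hc, hl⟩ := hW.lower
  refine exists_isFun_of_weighted (M := M) ?_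
  have hm : MemLp (fun x => ((W x : ℝ) : ℂ) * f x) 2 volume := by
    refine ⟨(Complex.measurable_ofReal.comp hW.measurable).aestronglyMeasurable.mul hfm, ?_⟩
    rw [eLpNorm_lt_top_iff_lintegral_rpow_enorm_lt_top (by norm_num) (by norm_num)]
    refine lt_of_le_of_lt (lintegral_mono fun x => ?_) hf
    simp only [enorm_mul, ENNReal.toReal_ofNat]
    rw [← ENNReal.rpow_natCast, ← ofReal_norm (W x : ℂ), Complex.norm_real, Real.norm_eq_abs,
      abs_of_pos (hW.pos x)]
    norm_num
  refine (hm.const_mul ((c⁻¹ : ℝ) : ℂ)).of_le ?_ (ae_of_all _ fun x => ?_)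
  · refine AEStronglyMeasurable.mul ?_ hfm
    refine (Complex.measurable_ofReal.comp ?_).aestronglyMeasurable
    fun_prop
  · have hp : (0 : ℝ) < (1 + ‖x‖ ^ 2) ^ (-M) := by positivity
    rw [norm_mul, norm_mul, norm_mul, Complex.norm_real, Complex.norm_real, Complex.norm_real,
      Real.norm_of_nonneg hp.le, Real.norm_of_nonneg (hW.pos x).le,
      Real.norm_of_nonneg (by positivity), ← mul_assoc]
    gcongr
    rw [le_inv_mul_iff₀ hc]
    exact hl x

lemma lintegral_schwartz_jb_lt_top (a : 𝓢(ℝ, ℂ)) :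
    ∫⁻ ρ, ‖a ρ‖ₑ * ENNReal.ofReal (jb ρ) < ⊤ := by
  have h : Integrable (fun ρ => ‖a ρ‖ + ‖ρ‖ ^ 1 * ‖a ρ‖) volume :=
    a.integrable.norm.add (a.integrable_pow_mul volume 1)
  refine lt_of_le_of_lt (lintegral_mono fun ρ => ?_) h.hasFiniteIntegral
  rw [Real.enorm_of_nonneg (by positivity), ← ofReal_norm, ← ENNReal.ofReal_mul (norm_nonneg _)]
  apply ENNReal.ofReal_le_ofReal
  have := jb_le_one_add_abs ρ
  simp only [pow_one, Real.norm_eq_abs ρ]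
  nlinarith [norm_nonneg (a ρ)]

/-- Young's inequality for convolution in the second variable, in a weighted `L²` space. -/
lemma lintegral_weighted_conv_le {W : Plane → ℝ} {C : ℝ} (hW : IsWeight W C)
    (hC : 0 ≤ C) (a : 𝓢(ℝ, ℂ)) {H : Plane → ℂ} (hH : Measurable H) :
    ∫⁻ x, (ENNReal.ofReal (W x) * ∫⁻ ρ, ‖a ρ‖ₑ *
        ‖H (x - ρ • (WithLp.toLp 2 ((0 : ℝ), (1 : ℝ)) : Plane))‖ₑ) ^ 2 ≤
      (ENNReal.ofReal C * ∫⁻ ρ, ‖a ρ‖ₑ * ENNReal.ofReal (jb ρ)) ^ 2 *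
        ∫⁻ x, (ENNReal.ofReal (W x) * ‖H x‖ₑ) ^ 2 := by
  set e : Plane := WithLp.toLp 2 ((0 : ℝ), (1 : ℝ))
  set g : Plane → ℝ≥0∞ := fun x => ENNReal.ofReal (W x) * ‖H x‖ₑ with hg
  have hgm : Measurable g := hW.measurable.ennreal_ofReal.mul hH.enorm
  set α : ℝ → ℝ≥0∞ := fun ρ => ‖a ρ‖ₑ * ENNReal.ofReal (jb ρ) with hα
  have hαm : Measurable α := by
    have := a.continuous.measurable.enorm
    have := continuous_jb.measurable.ennreal_ofReal
    fun_prop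
  have h1 : ∀ x, ENNReal.ofReal (W x) * ∫⁻ ρ, ‖a ρ‖ₑ * ‖H (x - ρ • e)‖ₑ ≤
      ENNReal.ofReal C * ∫⁻ ρ, α ρ * g (x - ρ • e) := by
    intro x
    rw [← lintegral_const_mul' _ _ ENNReal.ofReal_ne_top,
      ← lintegral_const_mul' _ _ ENNReal.ofReal_ne_top]
    refine lintegral_mono fun ρ => ?_
    have h := hW.shift (x - ρ • e) ρ
    rw [sub_add_cancel] at h
    calc _ ≤ ENNReal.ofReal (C * jb ρ * W (x - ρ • e)) * (‖a ρ‖ₑ * ‖H (x - ρ • e)‖ₑ) := by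
          gcongr
      _ = _ := by
          rw [ENNReal.ofReal_mul (by have := jb_pos ρ; positivity), ENNReal.ofReal_mul hC]
          simp only [hα, hg]; ring
  -- Cauchy–Schwarz with respect to the finite measure `α(ρ) dρ`, in place of Minkowski's
  -- inequality.
  have h2 : ∀ x, (∫⁻ ρ, α ρ * g (x - ρ • e)) ^ 2 ≤ (∫⁻ ρ, α ρ) * ∫⁻ ρ, α ρ * g (x - ρ • e) ^ 2 := by
    intro x
    have hs : ∀ ρ, (α ρ ^ (1 / 2 : ℝ)) ^ 2 = α ρ := fun ρ => by
      rw [← ENNReal.rpow_natCast, ← ENNReal.rpow_mul]; norm_num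
    have := sq_lintegral_mul_le (volume : Measure ℝ) (f := fun ρ => α ρ ^ (1 / 2 : ℝ))
      (g := fun ρ => α ρ ^ (1 / 2 : ℝ) * g (x - ρ • e)) (by fun_prop) (by fun_prop)
    refine (le_of_eq ?_).trans (this.trans (le_of_eq ?_))
    · congr 2; ext ρ
      rw [← mul_assoc (α ρ ^ (1 / 2 : ℝ)), ← sq, hs]
    · simp_rw [mul_pow, hs]
  have hswap : ∫⁻ x, ∫⁻ ρ, α ρ * g (x - ρ • e) ^ 2 = (∫⁻ ρ, α ρ) * ∫⁻ x, g x ^ 2 := by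
    rw [lintegral_lintegral_swap (by fun_prop), ← lintegral_mul_const _ hαm]
    congr 1; ext ρ
    rw [lintegral_const_mul _ (by fun_prop)]
    congr 1
    exact lintegral_sub_right_eq_self (fun x => g x ^ 2) (ρ • e)
  calc _ ≤ ∫⁻ x, ENNReal.ofReal C ^ 2 * ((∫⁻ ρ, α ρ) * ∫⁻ ρ, α ρ * g (x - ρ • e) ^ 2) := by
        refine lintegral_mono fun x => ?_
        refine (pow_le_pow_left₀ zero_le (h1 x) 2).trans ?_
        rw [mul_pow]
        gcongr
        exact h2 x
    _ = _ := by
        have hm : Measurable fun x => ∫⁻ ρ, α ρ * g (x - ρ • e) ^ 2 :=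
          Measurable.lintegral_prod_right' (f := fun q : Plane × ℝ =>
            α q.2 * g (q.1 - q.2 • e) ^ 2) (by fun_prop)
        rw [lintegral_const_mul _ (by fun_prop), lintegral_const_mul _ hm, hswap]
        ring

/-- Multiplication by `ψ(t)` is bounded on the spaces with slowly varying weights. -/
lemma exists_fourier_mulTime {ψ : ℝ → ℝ} (hψ : ContDiff ℝ ∞ ψ) (hc : HasCompactSupport ψ) {C : ℝ}
    (hC : 0 ≤ C) : ∃ K : ℝ, 0 < K ∧ ∀ W : Plane → ℝ, IsWeight W C →
      ∀ (z : 𝓢'(Plane, ℂ)) (H : Plane → ℂ), Measurable H → IsFun (𝓕 z) H →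
      ∫⁻ x, (ENNReal.ofReal (W x) * ‖H x‖ₑ) ^ 2 < ⊤ →
      ∃ H', IsFun (𝓕 (mulTime ψ z)) H' ∧
        ∫⁻ x, (ENNReal.ofReal (W x) * ‖H' x‖ₑ) ^ 2 ≤
          ENNReal.ofReal K * ∫⁻ x, (ENNReal.ofReal (W x) * ‖H x‖ₑ) ^ 2 := by
  have h1 : HasCompactSupport (fun x => (ψ x : ℂ)) := hc.comp_left (g := fun r : ℝ => (r : ℂ)) rfl
  have h2 : ContDiff ℝ ∞ (fun x => (ψ x : ℂ)) := Complex.ofRealCLM.contDiff.comp hψ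
  set a : 𝓢(ℝ, ℂ) := h1.toSchwartzMap h2 with ha
  set e : Plane := WithLp.toLp 2 ((0 : ℝ), (1 : ℝ)) with he
  obtain ⟨A, hA⟩ : ∃ A : 𝓢(ℝ, ℂ), A = 𝓕 a := ⟨_, rfl⟩
  set B := (ENNReal.ofReal C * ∫⁻ ρ, ‖A ρ‖ₑ * ENNReal.ofReal (jb ρ)) ^ 2
  have hB : B < ⊤ := ENNReal.pow_lt_top
    (ENNReal.mul_lt_top ENNReal.ofReal_lt_top (lintegral_schwartz_jb_lt_top _))
  refine ⟨B.toReal + 1, by positivity, fun W hW z H hHm hH hfin => ?_⟩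
  have ham := A.continuous.measurable
  set G : Plane → ℝ≥0∞ := fun x => ∫⁻ ρ, ‖A ρ‖ₑ * ‖H (x - ρ • e)‖ₑ with hG
  have hGm : Measurable G := Measurable.lintegral_prod_right' (f := fun q : Plane × ℝ =>
            ‖A q.2‖ₑ * ‖H (q.1 - q.2 • e)‖ₑ) (by fun_prop)
  have hle : ∫⁻ x, (ENNReal.ofReal (W x) * G x) ^ 2 ≤
      B * ∫⁻ x, (ENNReal.ofReal (W x) * ‖H x‖ₑ) ^ 2 := lintegral_weighted_conv_le hW hC _ hHm
  have hfinG : ∫⁻ x, (ENNReal.ofReal (W x) * G x) ^ 2 < ⊤ :=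
    hle.trans_lt (ENNReal.mul_lt_top hB hfin)
  have hGfin : ∀ᵐ x, G x < ⊤ := by
    have := ae_lt_top' ((hW.measurable.ennreal_ofReal.mul hGm).pow_const 2).aemeasurable hfinG.ne
    filter_upwards [this] with x hx
    by_contra hcon
    simp only [Pi.mul_apply] at hx
    rw [not_lt, top_le_iff] at hcon
    rw [hcon, ENNReal.mul_top (by simpa using hW.pos x)] at hx
    simp at hx
  -- The majorant `G` lies in the weighted L² space, hence is itself a tempered distribution. Its
  -- integrability against Schwartz functions justifies Fubini below.
  have hGint : ∀ φ : 𝓢(Plane, ℂ), ∫⁻ x, G x * ‖φ x‖ₑ < ⊤ := by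
    have hm : AEStronglyMeasurable (fun x => ((G x).toReal : ℂ)) volume :=
      (Complex.measurable_ofReal.comp hGm.ennreal_toReal).aestronglyMeasurable
    have henorm : ∀ x, G x < ⊤ → ‖((G x).toReal : ℂ)‖ₑ = G x := by
      intro x hx
      rw [← ofReal_norm, Complex.norm_real, Real.norm_of_nonneg ENNReal.toReal_nonneg,
        ENNReal.ofReal_toReal hx.ne]
    obtain ⟨T, hT⟩ := exists_isFun_of_isWeight hW hm (by
      refine lt_of_le_of_lt (le_of_eq (lintegral_congr_ae ?_)) hfinG
      filter_upwards [hGfin] with x hx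
      rw [henorm x hx])
    intro φ
    refine lt_of_le_of_lt (le_of_eq (lintegral_congr_ae ?_)) (hT φ).1.hasFiniteIntegral
    filter_upwards [hGfin] with x hx
    rw [enorm_mul, henorm x hx]
  have hint : ∀ φ : 𝓢(Plane, ℂ), Integrable
      (fun q : Plane × ℝ => A q.2 * H (q.1 - q.2 • e) * φ q.1) (volume.prod volume) := by
    intro φ
    have hφm := φ.continuous.measurable
    refine ⟨Measurable.aestronglyMeasurable (by fun_prop), ?_⟩
    rw [HasFiniteIntegral, lintegral_prod _ (by fun_prop)]
    refine lt_of_le_of_lt (le_of_eq ?_) (hGint φ)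
    congr 1; ext x
    simp only [enorm_mul]
    rw [lintegral_mul_const _ (by fun_prop)]
  refine ⟨fun x => ∫ ρ, A ρ * H (x - ρ • e), ?_, ?_⟩
  · intro φ
    have e1 : ∀ x, (∫ ρ, A ρ * H (x - ρ • e)) * φ x = ∫ ρ, A ρ * H (x - ρ • e) * φ x :=
      fun x => (integral_mul_const _ _).symm
    simp_rw [e1]
    refine ⟨(hint φ).integral_prod_left, ?_⟩
    have e2 : (𝓕 (mulTime ψ z)) φ = (𝓕 z) (𝓕⁻ (SchwartzMap.smulLeftCLM ℂ
        (fun p : Plane => a (inner ℝ e p)) (𝓕 φ))) := by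
      rw [TemperedDistribution.fourier_apply, TemperedDistribution.fourier_apply,
        FourierTransform.fourier_fourierInv_eq, mulTime,
        TemperedDistribution.smulLeftCLM_apply_apply]
      congr 3
      ext p
      rw [show inner ℝ e p = p.snd by simp [he]]
      rfl
    rw [e2, (hH _).2]
    simp_rw [fourierInv_smulLeft_fourier, ← hA]
    rw [integral_integral_swap (hint φ)]
    have e3 : ∀ p, H p * ∫ ρ, A ρ * φ (p + ρ • e) = ∫ ρ, A ρ * H p * φ (p + ρ • e) := by
      intro p; rw [← integral_const_mul]
      exact integral_congr_ae (ae_of_all _ fun ρ => by simp only; ring)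
    simp_rw [e3]
    -- The shear `(x, ρ) ↦ (x + ρe, ρ)` preserves measure and so carries the integrability in `hint`
    -- to the translated integrand.
    have hmp : MeasurePreserving (fun q : Plane × ℝ => (q.1 + q.2 • e, q.2))
        (volume.prod volume) (volume.prod volume) := by
      have : MeasurePreserving (fun q : ℝ × Plane => (q.1, q.2 + q.1 • e))
          ((volume : Measure ℝ).prod (volume : Measure Plane)) (volume.prod volume) :=
        (MeasurePreserving.id _).skew_product (g := fun ρ x => x + ρ • e)
          (by simp only [Function.uncurry_def]; fun_prop)
          (ae_of_all _ fun ρ => map_add_right_eq_self _ _)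
      exact (Measure.measurePreserving_swap.comp this).comp Measure.measurePreserving_swap
    rw [integral_integral_swap]
    · refine integral_congr_ae (ae_of_all _ fun ρ => ?_)
      refine Eq.trans ?_
        (integral_add_right_eq_self (fun x => A ρ * H (x - ρ • e) * φ x) (ρ • e))
      simp
    · have := hmp.integrable_comp_of_integrable (hint φ)
      refine this.congr (ae_of_all _ fun q => ?_)
      simp [Function.uncurry]
  · refine (lintegral_mono fun x => ?_).trans (hle.trans ?_)
    · gcongr
      refine (enorm_integral_le_lintegral_enorm _).trans (le_of_eq ?_)
      simp only [enorm_mul, hG]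
    · gcongr
      rw [ENNReal.le_ofReal_iff_toReal_le hB.ne (by positivity)]
      linarith

/-! ### Weights and integrals over the plane -/

/-- The weight of the space `X^{s,b}_{τ=h(ξ)}` in Mathlib's frequency variable `ζ = (ξ, τ) / 2π`. -/
def wt (h : ℝ → ℝ) (s b : ℝ) (ζ : Plane) : ℝ :=
  jb (2 * Real.pi * ζ.snd - h (2 * Real.pi * ζ.fst)) ^ b * jb (2 * Real.pi * ζ.fst) ^ s

lemma wt_pos (h : ℝ → ℝ) (s b : ℝ) (ζ : Plane) : 0 < wt h s b ζ :=
  mul_pos (Real.rpow_pos_of_pos (jb_pos _) _) (Real.rpow_pos_of_pos (jb_pos _) _)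

lemma measurable_plane_fst : Measurable fun p : Plane => p.fst := by fun_prop

lemma measurable_plane_snd : Measurable fun p : Plane => p.snd := by fun_prop

lemma continuous_wt {h : ℝ → ℝ} (hh : Continuous h) (s b : ℝ) : Continuous (wt h s b) := by
  unfold wt
  exact ((continuous_jb_rpow b).comp (by fun_prop)).mul ((continuous_jb_rpow s).comp (by fun_prop))

lemma one_le_wt {h : ℝ → ℝ} {s b : ℝ} (hs : 0 ≤ s) (hb : 0 ≤ b) (ζ : Plane) : 1 ≤ wt h s b ζ :=
  one_le_mul_of_one_le_of_one_le (Real.one_le_rpow (one_le_jb _) hb)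
    (Real.one_le_rpow (one_le_jb _) hs)

lemma jb_mul_le {c : ℝ} (hc : 1 ≤ c) (x : ℝ) : jb (c * x) ≤ c * jb x := by
  refine Real.sqrt_le_iff.2 ⟨by have := jb_pos x; positivity, ?_⟩
  rw [mul_pow, mul_pow, jb_sq]
  nlinarith [sq_nonneg x]

lemma plane_norm_sq (p : Plane) : ‖p‖ ^ 2 = p.fst ^ 2 + p.snd ^ 2 := by
  rw [WithLp.prod_norm_sq_eq_of_L2]; simp

lemma two_pi_le : 2 * Real.pi ≤ 7 := by linarith [Real.pi_lt_d2]

lemma one_le_two_pi : 1 ≤ 2 * Real.pi := by linarith [Real.pi_gt_three]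

/-- The lower bound holds because `h` grows polynomially. The shift bound is `⟨σ⟩ ≤ 2⟨2πρ⟩⟨σ'⟩ ≤
14⟨ρ⟩⟨σ'⟩` raised to a power `b ∈ [-1, 0]`; here `14 = 2 · 7` with `2π ≤ 7`. The constant does not
involve `h`, so for the Schrödinger weight it is uniform in `λ`. -/
lemma isWeight_wt {h : ℝ → ℝ} (hh : Continuous h)
    (hb : ∀ x, |h (2 * Real.pi * x)| ≤ 1000 * (1 + x ^ 2) ^ 2) (s : ℝ) {b : ℝ} (hb1 : -1 ≤ b)
    (hb0 : b ≤ 0) : IsWeight (wt h s b) 14 where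
  measurable := (continuous_wt hh s b).measurable
  pos := wt_pos h s b
  lower := by
    refine ⟨(1010 : ℝ)⁻¹ * 7 ^ (-|s|), 2 + |s|, by positivity, fun p => ?_⟩
    have hR1 : 1 ≤ 1 + ‖p‖ ^ 2 := by linarith [sq_nonneg ‖p‖]
    have hR0 : 0 < 1 + ‖p‖ ^ 2 := by positivity
    have hp := plane_norm_sq p
    set R := 1 + ‖p‖ ^ 2 with hR
    have h1 : jb (2 * Real.pi * p.snd - h (2 * Real.pi * p.fst)) ≤ 1010 * R ^ (2 : ℝ) := by
      rw [Real.rpow_two]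
      have e1 := jb_le_one_add_abs (2 * Real.pi * p.snd - h (2 * Real.pi * p.fst))
      have e2 := abs_sub (2 * Real.pi * p.snd) (h (2 * Real.pi * p.fst))
      have e3 := hb p.fst
      have e4 : |2 * Real.pi * p.snd| ≤ 7 * R := by
        rw [abs_mul, abs_of_pos (by positivity : 0 < 2 * Real.pi)]
        have : |p.snd| ≤ R := by
          have := abs_le_jb p.snd
          nlinarith [sq_abs p.snd, sq_nonneg (|p.snd| - 1), sq_nonneg p.fst]
        exact mul_le_mul two_pi_le this (abs_nonneg _) (by norm_num)
      have e5 : (1 + p.fst ^ 2) ^ 2 ≤ R ^ 2 := by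
        gcongr; rw [hR, hp]; nlinarith [sq_nonneg p.snd]
      have e6 : R ≤ R ^ 2 := by nlinarith
      nlinarith
    have h2 : (1010 : ℝ)⁻¹ * R ^ (-2 : ℝ) ≤
        jb (2 * Real.pi * p.snd - h (2 * Real.pi * p.fst)) ^ b := by
      calc _ = (1010 * R ^ (2 : ℝ)) ^ (-1 : ℝ) := by
            rw [Real.rpow_neg_one, mul_inv, ← Real.rpow_neg hR0.le]
        _ ≤ jb (2 * Real.pi * p.snd - h (2 * Real.pi * p.fst)) ^ (-1 : ℝ) :=
            Real.rpow_le_rpow_of_nonpos (jb_pos _) h1 (by norm_num)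
        _ ≤ _ := Real.rpow_le_rpow_of_exponent_le (one_le_jb _) hb1
    have h3 : 7 ^ (-|s|) * R ^ (-|s|) ≤ jb (2 * Real.pi * p.fst) ^ s := by
      have e1 : jb (2 * Real.pi * p.fst) ≤ 7 * R := by
        refine (jb_mul_le one_le_two_pi _).trans (mul_le_mul two_pi_le ?_ (jb_pos _).le (by norm_num))
        have e2 := jb_sq p.fst
        have e3 := one_le_jb p.fst
        nlinarith [sq_nonneg p.snd]
      rw [← Real.mul_rpow (by norm_num) hR0.le]
      calc _ ≤ jb (2 * Real.pi * p.fst) ^ (-|s|) :=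
            Real.rpow_le_rpow_of_nonpos (jb_pos _) e1 (by simp)
        _ ≤ _ := Real.rpow_le_rpow_of_exponent_le (one_le_jb _) (neg_abs_le s)
    calc _ = ((1010 : ℝ)⁻¹ * R ^ (-2 : ℝ)) * (7 ^ (-|s|) * R ^ (-|s|)) := by
          rw [neg_add, Real.rpow_add hR0]; ring
      _ ≤ _ := mul_le_mul h2 h3 (by positivity) (Real.rpow_nonneg (jb_pos _).le _)
  shift x ρ := by
    unfold wt
    have e1 : (x + ρ • (WithLp.toLp 2 ((0 : ℝ), (1 : ℝ)) : Plane)).fst = x.fst := by simp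
    have e2 : (x + ρ • (WithLp.toLp 2 ((0 : ℝ), (1 : ℝ)) : Plane)).snd = x.snd + ρ := by simp
    rw [e1, e2, ← mul_assoc]
    refine mul_le_mul_of_nonneg_right ?_ (Real.rpow_nonneg (jb_pos _).le _)
    set σ := 2 * Real.pi * x.snd - h (2 * Real.pi * x.fst)
    set σ' := 2 * Real.pi * (x.snd + ρ) - h (2 * Real.pi * x.fst)
    have h1 : jb σ ≤ 14 * jb ρ * jb σ' := by
      have := jb_add_le σ' (-(2 * Real.pi * ρ))
      rw [show σ' + -(2 * Real.pi * ρ) = σ by simp only [σ, σ']; ring, jb_neg] at this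
      have e3 : jb (2 * Real.pi * ρ) ≤ 7 * jb ρ :=
        (jb_mul_le one_le_two_pi _).trans (by have := jb_pos ρ; gcongr; exact two_pi_le)
      have p := jb_pos σ'
      calc _ ≤ 2 * (jb σ' * jb (2 * Real.pi * ρ)) := this
        _ ≤ 2 * (jb σ' * (7 * jb ρ)) := by gcongr
        _ = _ := by ring
    have hD : 1 ≤ 14 * jb ρ := by linarith [one_le_jb ρ]
    have hD0 : 0 < 14 * jb ρ := by linarith
    have h2 : (14 * jb ρ * jb σ') ^ b ≤ jb σ ^ b := Real.rpow_le_rpow_of_nonpos (jb_pos _) h1 hb0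
    rw [Real.mul_rpow hD0.le (jb_pos _).le] at h2
    have h3 : (14 * jb ρ)⁻¹ ≤ (14 * jb ρ) ^ b := by
      rw [← Real.rpow_neg_one]
      exact Real.rpow_le_rpow_of_exponent_le hD hb1
    have h4 : (14 * jb ρ)⁻¹ * jb σ' ^ b ≤ jb σ ^ b := by
      refine le_trans ?_ h2
      have := Real.rpow_nonneg (jb_pos σ').le b
      gcongr
    rwa [inv_mul_le_iff₀ hD0] at h4

lemma lintegral_plane {f : Plane → ℝ≥0∞} (hf : Measurable f) :
    ∫⁻ p, f p = ∫⁻ x : ℝ, ∫⁻ t : ℝ, f (WithLp.toLp 2 (x, t)) := by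
  rw [← (WithLp.volume_preserving_toLp ℝ ℝ).lintegral_comp hf, Measure.volume_eq_prod,
    lintegral_prod (fun q : ℝ × ℝ => f (WithLp.toLp 2 q))
      (hf.comp (WithLp.volume_preserving_toLp ℝ ℝ).measurable).aemeasurable]

lemma lintegral_comp_two_pi (g : Plane → ℝ≥0∞) :
    ∫⁻ p, g p = ENNReal.ofReal ((2 * Real.pi) ^ 2) * ∫⁻ p, g ((2 * Real.pi) • p) := by
  have h0 : 2 * Real.pi ≠ 0 := by positivity
  have hfr : Module.finrank ℝ Plane = 2 := by
    rw [(WithLp.linearEquiv 2 ℝ (ℝ × ℝ)).finrank_eq]; simp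
  have h1 := Measure.map_addHaar_smul (volume : Measure Plane) h0
  rw [hfr, abs_of_pos (by positivity)] at h1
  have h2 : ∫⁻ p, g ((2 * Real.pi) • p) = ∫⁻ p, g p ∂(Measure.map (fun p => (2 * Real.pi) • p)
      (volume : Measure Plane)) :=
    (lintegral_map_equiv g (Homeomorph.smulOfNeZero (2 * Real.pi) h0).toMeasurableEquiv).symm
  rw [h2, h1, lintegral_smul_measure, smul_eq_mul, ← mul_assoc, ← ENNReal.ofReal_mul (by positivity),
    mul_inv_cancel₀ (by positivity), ENNReal.ofReal_one, one_mul]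

lemma lintegral_comp_two_pi_le (g : Plane → ℝ≥0∞) : ∫⁻ p, g ((2 * Real.pi) • p) ≤ ∫⁻ p, g p := by
  rw [lintegral_comp_two_pi g]
  refine le_mul_of_one_le_left zero_le ?_
  rw [ENNReal.one_le_ofReal]
  exact one_le_pow₀ one_le_two_pi

/-- Cauchy–Schwarz for weighted convolutions. -/
lemma lintegral_sq_conv_le {K : Plane → Plane → ℝ≥0∞} (hK : Measurable (Function.uncurry K))
    {A B : Plane → ℝ≥0∞} (hA : Measurable A) (hB : Measurable B) {M : ℝ≥0∞}
    (hM : ∀ ζ, ∫⁻ η, K ζ η ^ 2 ≤ M) :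
    ∫⁻ ζ, (∫⁻ η, K ζ η * (A η * B (ζ - η))) ^ 2 ≤ M * ((∫⁻ η, A η ^ 2) * ∫⁻ η, B η ^ 2) := by
  have hm : Measurable fun q : Plane × Plane => A q.2 ^ 2 * B (q.1 - q.2) ^ 2 := by fun_prop
  calc _ ≤ ∫⁻ ζ, M * ∫⁻ η, A η ^ 2 * B (ζ - η) ^ 2 := by
        refine lintegral_mono fun ζ => ?_
        have hKζ : Measurable (K ζ) := hK.comp (measurable_const.prodMk measurable_id)
        refine (sq_lintegral_mul_le volume hKζ.aemeasurable (by fun_prop)).trans ?_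
        simp_rw [mul_pow]
        gcongr
        exact hM ζ
    _ = _ := by
        rw [lintegral_const_mul _ (Measurable.lintegral_prod_right' (f := fun q : Plane × Plane =>
          A q.2 ^ 2 * B (q.1 - q.2) ^ 2) hm), lintegral_lintegral_swap hm.aemeasurable,
          ← lintegral_mul_const _ (by fun_prop)]
        congr 2; ext η
        simp only
        rw [lintegral_const_mul _ (by fun_prop)]
        congr 1
        exact lintegral_sub_right_eq_self (fun x => B x ^ 2) η

/-! ### The norm of `X^{s,b}` in terms of the normalized Fourier transform -/

lemma HasFourierFun.of_isFun {u : 𝓢'(Plane, ℂ)} {F : Plane → ℂ} (h : IsFun (𝓕 u) F) :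
    HasFourierFun u fun p => F ((2 * Real.pi)⁻¹ • p) := by
  unfold HasFourierFun
  have : (fun ζ : Plane => F ((2 * Real.pi)⁻¹ • (2 * Real.pi) • ζ)) = F := by
    ext ζ; rw [smul_smul, inv_mul_cancel₀ (by positivity), one_smul]
  rwa [this]

lemma eLpNorm_two_sq (f : Plane → ℂ) : eLpNorm f 2 volume ^ 2 = ∫⁻ x, ‖f x‖ₑ ^ 2 := by
  rw [eLpNorm_eq_lintegral_rpow_enorm_toReal (by norm_num) (by norm_num), ← ENNReal.rpow_natCast,
    ← ENNReal.rpow_mul]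
  norm_num

lemma enorm_ofReal_of_pos {r : ℝ} (hr : 0 < r) : ‖(r : ℂ)‖ₑ = ENNReal.ofReal r := by
  rw [← ofReal_norm, Complex.norm_real, Real.norm_of_nonneg hr.le]

/-- All representatives of the Fourier transform agree almost everywhere, so any one attains the
infimum; `(2π)²` is the Jacobian of the frequency normalization. -/
lemma XNorm_sq {u : 𝓢'(Plane, ℂ)} {F : Plane → ℂ} (hF : IsFun (𝓕 u) F) (h : ℝ → ℝ) (s b : ℝ) :
    XNorm h s b u ^ 2 = ENNReal.ofReal ((2 * Real.pi) ^ 2) *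
      ∫⁻ ζ, (ENNReal.ofReal (wt h s b ζ) * ‖F ζ‖ₑ) ^ 2 := by
  have key : ∀ f, HasFourierFun u f →
      eLpNorm (fun p : Plane => ((jb (p.snd - h p.fst) ^ b * jb p.fst ^ s : ℝ) : ℂ) * f p) 2 volume ^ 2
        = ENNReal.ofReal ((2 * Real.pi) ^ 2) *
      ∫⁻ ζ, (ENNReal.ofReal (wt h s b ζ) * ‖F ζ‖ₑ) ^ 2 := by
    intro f hf
    rw [eLpNorm_two_sq, lintegral_comp_two_pi]
    congr 1
    refine lintegral_congr_ae ?_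
    have hae : (fun ζ : Plane => f ((2 * Real.pi) • ζ)) =ᵐ[volume] F := IsFun.ae_eq hf hF
    filter_upwards [hae] with ζ hζ
    rw [enorm_mul, enorm_ofReal_of_pos (mul_pos (Real.rpow_pos_of_pos (jb_pos _) _)
      (Real.rpow_pos_of_pos (jb_pos _) _)), hζ]
    simp [wt]
  have hX : XNorm h s b u = eLpNorm (fun p : Plane =>
      ((jb (p.snd - h p.fst) ^ b * jb p.fst ^ s : ℝ) : ℂ) * F ((2 * Real.pi)⁻¹ • p)) 2 volume := by
    refine le_antisymm (iInf₂_le _ (HasFourierFun.of_isFun hF)) (le_iInf₂ fun f hf => ?_)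
    rw [← ENNReal.pow_le_pow_left_iff two_ne_zero, key f hf, key _ (HasFourierFun.of_isFun hF)]
  rw [hX, key _ (HasFourierFun.of_isFun hF)]

lemma IsFun.exists_measurable {u : 𝓢'(Plane, ℂ)} {F : Plane → ℂ} (hF : IsFun u F) :
    ∃ G, Measurable G ∧ IsFun u G :=
  ⟨hF.aestronglyMeasurable.mk F, hF.aestronglyMeasurable.stronglyMeasurable_mk.measurable,
    hF.congr hF.aestronglyMeasurable.ae_eq_mk⟩

lemma exists_of_XNorm_lt_top {h : ℝ → ℝ} {s b : ℝ} {u : 𝓢'(Plane, ℂ)} (hu : XNorm h s b u < ⊤) :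
    ∃ F, Measurable F ∧ IsFun (𝓕 u) F := by
  simp only [XNorm, iInf_lt_iff] at hu
  obtain ⟨f, hf, -⟩ := hu
  exact IsFun.exists_measurable hf

lemma memLp_two_of_weighted {h : ℝ → ℝ} {s b : ℝ} (hs : 0 ≤ s) (hb : 0 ≤ b) {u : 𝓢'(Plane, ℂ)}
    (hu : XNorm h s b u < ⊤) {F : Plane → ℂ} (hF : IsFun (𝓕 u) F) : MemLp F 2 volume := by
  refine ⟨hF.aestronglyMeasurable, ?_⟩
  have h1 : eLpNorm F 2 volume ^ 2 ≤ XNorm h s b u ^ 2 := by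
    rw [XNorm_sq hF, eLpNorm_two_sq]
    refine le_trans ?_ (le_mul_of_one_le_left zero_le
      (ENNReal.one_le_ofReal.2 (one_le_pow₀ one_le_two_pi)))
    refine lintegral_mono fun ζ => ?_
    gcongr
    exact le_mul_of_one_le_left zero_le (ENNReal.one_le_ofReal.2 (one_le_wt hs hb ζ))
  rw [ENNReal.pow_le_pow_left_iff two_ne_zero] at h1
  exact h1.trans_lt hu

lemma continuous_hSchr (lam : ℝ) : Continuous (hSchr lam) := by unfold hSchr; fun_prop

lemma continuous_hAiry : Continuous hAiry := by unfold hAiry; fun_prop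

lemma hSchr_bound {lam : ℝ} (hl : 0 < lam) (hl1 : lam ≤ 1) (x : ℝ) :
    |hSchr lam (2 * Real.pi * x)| ≤ 1000 * (1 + x ^ 2) ^ 2 := by
  have h1 : |hSchr lam (2 * Real.pi * x)| = lam * (2 * Real.pi) ^ 2 * x ^ 2 := by
    rw [hSchr, show -lam * (2 * Real.pi * x) ^ 2 = -(lam * (2 * Real.pi) ^ 2 * x ^ 2) by ring,
      abs_neg, abs_of_nonneg (by positivity)]
  rw [h1]
  have h2 : lam * (2 * Real.pi) ^ 2 ≤ 1 * 7 ^ 2 := by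
    gcongr
    exact two_pi_le
  nlinarith [mul_le_mul_of_nonneg_right h2 (sq_nonneg x), sq_nonneg x, sq_nonneg (x ^ 2)]

lemma hAiry_bound (x : ℝ) : |hAiry (2 * Real.pi * x)| ≤ 1000 * (1 + x ^ 2) ^ 2 := by
  rw [hAiry, abs_pow, abs_mul, abs_of_pos (by positivity : 0 < 2 * Real.pi), mul_pow]
  have h1 : (2 * Real.pi) ^ 3 ≤ 1000 := by
    calc _ ≤ (7 : ℝ) ^ 3 := by gcongr; exact two_pi_le
      _ ≤ _ := by norm_num
  have h2 : |x| ^ 3 ≤ (1 + x ^ 2) ^ 2 := by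
    rw [← sq_abs x]
    nlinarith [sq_nonneg (|x| - 1), abs_nonneg x, sq_nonneg (|x| ^ 2 - |x|), sq_nonneg (|x| ^ 2)]
  exact mul_le_mul h1 h2 (by positivity) (by norm_num)

/-! ### The Schrödinger–Schrödinger interaction -/

lemma jb_rpow_add_le (x y : ℝ) {s : ℝ} (hs : 0 ≤ s) :
    jb (x + y) ^ s ≤ 2 ^ s * (jb x ^ s * jb y ^ s) := by
  rw [← Real.mul_rpow (jb_pos x).le (jb_pos y).le, ← Real.mul_rpow (by norm_num)
    (mul_nonneg (jb_pos x).le (jb_pos y).le)]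
  exact Real.rpow_le_rpow (jb_pos _).le (jb_add_le x y) hs

lemma IsFun.fourier_dx {z : 𝓢'(Plane, ℂ)} {H : Plane → ℂ} (hH : IsFun (𝓕 z) H) :
    IsFun (𝓕 (dx z)) fun ζ => (2 * Real.pi * Complex.I) * (ζ.fst * H ζ) := by
  rw [dx, TemperedDistribution.fourier_lineDerivOp_eq]
  have hg : (fun x : Plane => ((inner ℝ x (WithLp.toLp 2 ((1 : ℝ), (0 : ℝ)) : Plane) : ℝ) : ℂ)).HasTemperateGrowth :=
    Function.Complex.hasTemperateGrowth_ofReal.comp (Function.hasTemperateGrowth_inner_left _)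
  have h := (hH.smulLeft hg).const_smul (2 * Real.pi * Complex.I)
  refine h.congr (ae_of_all _ fun ζ => ?_)
  simp

/-- The symbol of the Schrödinger–Schrödinger interaction. -/
def schrSymbol (lam s₁ s₂ θ : ℝ) (ζ η : Plane) : ℝ :=
  wt hAiry s₂ (-(1 / 2) + 2 * θ) ζ * (2 * Real.pi * |ζ.fst|) *
    ((wt (hSchr lam) s₁ (1 / 2 + θ) η)⁻¹ * (wt (hSchr lam) s₁ (1 / 2 + θ) (η - ζ))⁻¹)

/-- The output modulation has a nonpositive exponent since `θ ≤ 1/4`, and is dropped. The weight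
`⟨ξ⟩^{s₁}` is distributed over the two inputs, and `⟨ξ⟩^{s₂-s₁}|ξ| ≤ |ξ|^{1/2}` is where `s₂ - s₁ <
-1/2` enters. Precisely one power of `|ξ|` survives in the square. -/
lemma schrSymbol_sq_le {lam s₁ s₂ θ : ℝ} (hs₁ : 0 ≤ s₁) (hs : s₂ - s₁ < -(1 / 2)) (hθ1 : θ ≤ 1 / 4)
    (ζ η : Plane) :
    schrSymbol lam s₁ s₂ θ ζ η ^ 2 ≤ 4 ^ s₁ * |2 * Real.pi * ζ.fst| *
      (jb (2 * Real.pi * η.snd + lam * (2 * Real.pi * η.fst) ^ 2) ^ (-(1 + 2 * θ)) *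
        jb (2 * Real.pi * η.snd - 2 * Real.pi * ζ.snd +
          lam * (2 * Real.pi * η.fst - 2 * Real.pi * ζ.fst) ^ 2) ^ (-(1 + 2 * θ))) := by
  have hpi : 0 < 2 * Real.pi := by positivity
  set X := 2 * Real.pi * ζ.fst
  set Y := 2 * Real.pi * η.fst
  have e1 : 2 * Real.pi * (η - ζ).fst = Y - X := by simp [X, Y]; ring
  have e2 : 2 * Real.pi * (η - ζ).snd = 2 * Real.pi * η.snd - 2 * Real.pi * ζ.snd := by simp; ring
  have e3 : 2 * Real.pi * |ζ.fst| = |X| := by simp only [X]; rw [abs_mul, abs_of_pos hpi]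
  unfold schrSymbol wt
  rw [e1, e2, e3]
  simp only [hSchr, neg_mul, sub_neg_eq_add]
  set σ₁ := 2 * Real.pi * η.snd + lam * Y ^ 2
  set σ₂ := 2 * Real.pi * η.snd - 2 * Real.pi * ζ.snd + lam * (Y - X) ^ 2
  set a := jb (2 * Real.pi * ζ.snd - hAiry X) ^ (-(1 / 2) + 2 * θ) with ha
  have ha1 : a ≤ 1 := jb_rpow_le_one (by linarith)
  have ha0 : 0 ≤ a := Real.rpow_nonneg (jb_pos _).le _
  have hsq : ∀ (x r : ℝ), (jb x ^ r) ^ 2 = jb x ^ (2 * r) := fun x r => by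
    rw [← Real.rpow_natCast, ← Real.rpow_mul (jb_pos x).le]; congr 1; push_cast; ring
  have hX : jb X ^ s₁ ≤ 2 ^ s₁ * (jb Y ^ s₁ * jb (Y - X) ^ s₁) := by
    have := jb_rpow_add_le Y (-(Y - X)) hs₁
    rwa [jb_neg, show Y + -(Y - X) = X by ring] at this
  have pX := Real.rpow_pos_of_pos (jb_pos X) s₁
  have pY := Real.rpow_pos_of_pos (jb_pos Y) s₁
  have pYX := Real.rpow_pos_of_pos (jb_pos (Y - X)) s₁
  have hX2 : jb X ^ s₂ * |X| * ((jb Y ^ s₁)⁻¹ * (jb (Y - X) ^ s₁)⁻¹) ≤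
      2 ^ s₁ * (jb X ^ (s₂ - s₁) * |X|) := by
    rw [← mul_inv, ← div_eq_mul_inv, div_le_iff₀ (by positivity), Real.rpow_sub (jb_pos X)]
    have e4 : (2 : ℝ) ^ s₁ * (jb X ^ s₂ / jb X ^ s₁ * |X|) * (jb Y ^ s₁ * jb (Y - X) ^ s₁) =
        jb X ^ s₂ * |X| * (2 ^ s₁ * (jb Y ^ s₁ * jb (Y - X) ^ s₁) / jb X ^ s₁) := by
      field_simp
    rw [e4]
    refine le_mul_of_one_le_right (by have := Real.rpow_nonneg (jb_pos X).le s₂; positivity) ?_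
    rwa [one_le_div pX]
  have hX3 : (jb X ^ (s₂ - s₁) * |X|) ^ 2 ≤ |X| := by
    rw [mul_pow, hsq]
    have : jb X ^ (2 * (s₂ - s₁)) ≤ (jb X)⁻¹ := by
      rw [← Real.rpow_neg_one]
      exact Real.rpow_le_rpow_of_exponent_le (one_le_jb X) (by linarith)
    calc _ ≤ (jb X)⁻¹ * |X| ^ 2 := by gcongr
      _ ≤ _ := by
        rw [inv_mul_le_iff₀ (jb_pos X), sq]
        gcongr
        exact abs_le_jb X
  have e5 : (4 : ℝ) ^ s₁ = (2 ^ s₁) ^ 2 := by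
    rw [← Real.rpow_natCast, ← Real.rpow_mul (by norm_num), mul_comm, Real.rpow_mul (by norm_num)]
    norm_num
  have e6 : ∀ x, jb x ^ (-(1 + 2 * θ)) = ((jb x ^ (1 / 2 + θ))⁻¹) ^ 2 := fun x => by
    rw [inv_pow, hsq, Real.rpow_neg (jb_pos x).le]; congr 2; ring
  rw [e6, e6, e5]
  have p1 := Real.rpow_pos_of_pos (jb_pos σ₁) (1 / 2 + θ)
  have p2 := Real.rpow_pos_of_pos (jb_pos σ₂) (1 / 2 + θ)
  have pX2 := Real.rpow_pos_of_pos (jb_pos X) s₂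
  have pX3 := Real.rpow_pos_of_pos (jb_pos X) (s₂ - s₁)
  calc _ = a ^ 2 * (jb X ^ s₂ * |X| * ((jb Y ^ s₁)⁻¹ * (jb (Y - X) ^ s₁)⁻¹)) ^ 2 *
        (((jb σ₁ ^ (1 / 2 + θ))⁻¹) ^ 2 * ((jb σ₂ ^ (1 / 2 + θ))⁻¹) ^ 2) := by
        rw [mul_inv, mul_inv]; ring
    _ ≤ 1 * (2 ^ s₁ * (jb X ^ (s₂ - s₁) * |X|)) ^ 2 *
        (((jb σ₁ ^ (1 / 2 + θ))⁻¹) ^ 2 * ((jb σ₂ ^ (1 / 2 + θ))⁻¹) ^ 2) := by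
        gcongr
        exact pow_le_one₀ ha0 ha1
    _ = (2 ^ s₁) ^ 2 * (jb X ^ (s₂ - s₁) * |X|) ^ 2 *
        (((jb σ₁ ^ (1 / 2 + θ))⁻¹) ^ 2 * ((jb σ₂ ^ (1 / 2 + θ))⁻¹) ^ 2) := by ring
    _ ≤ _ := by gcongr

/-- The surviving `|ξ|` cancels the `1/(2λ|ξ|)` of `schr_kernel_le`, so the bound is uniform in `ζ`.
At `ξ = 0` the symbol vanishes. -/
lemma lintegral_schrSymbol_le {lam s₁ s₂ θ : ℝ} (hl : 0 < lam) (hs₁ : 0 ≤ s₁)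
    (hs : s₂ - s₁ < -(1 / 2)) (hθ1 : θ ≤ 1 / 4) (ζ : Plane) :
    ∫⁻ η, ENNReal.ofReal (schrSymbol lam s₁ s₂ θ ζ η) ^ 2 ≤
      ENNReal.ofReal (4 ^ s₁) * jbInt (1 + 2 * θ) ^ 2 * ENNReal.ofReal lam⁻¹ := by
  set r := 1 + 2 * θ
  set X := 2 * Real.pi * ζ.fst with hX
  set T := 2 * Real.pi * ζ.snd
  set g : Plane → ℝ≥0∞ := fun p => ENNReal.ofReal (jb (p.snd + lam * p.fst ^ 2) ^ (-r) *
      jb (p.snd - T + lam * (p.fst - X) ^ 2) ^ (-r)) with hg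
  have hgm : Measurable g := by
    have := (continuous_jb_rpow (-r)).measurable
    have h1 : Measurable fun p : Plane => jb (p.snd + lam * p.fst ^ 2) ^ (-r) :=
      this.comp (by fun_prop : Measurable fun p : Plane => p.snd + lam * p.fst ^ 2)
    have h2 : Measurable fun p : Plane => jb (p.snd - T + lam * (p.fst - X) ^ 2) ^ (-r) :=
      this.comp (by fun_prop : Measurable fun p : Plane => p.snd - T + lam * (p.fst - X) ^ 2)
    exact (h1.mul h2).ennreal_ofReal
  calc _ ≤ ∫⁻ η : Plane, ENNReal.ofReal (4 ^ s₁ * |X|) * g ((2 * Real.pi) • η) := by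
        refine lintegral_mono fun η => ?_
        have h := schrSymbol_sq_le (lam := lam) hs₁ hs hθ1 ζ η
        have h0 : 0 ≤ schrSymbol lam s₁ s₂ θ ζ η := by
          have := (wt_pos hAiry s₂ (-(1 / 2) + 2 * θ) ζ).le
          have := (wt_pos (hSchr lam) s₁ (1 / 2 + θ) η).le
          have := (wt_pos (hSchr lam) s₁ (1 / 2 + θ) (η - ζ)).le
          unfold schrSymbol; positivity
        simp only [hg]
        rw [← ENNReal.ofReal_pow h0, ← ENNReal.ofReal_mul (by positivity)]
        refine ENNReal.ofReal_le_ofReal (h.trans (le_of_eq ?_))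
        simp [X, T, r]
    _ = ENNReal.ofReal (4 ^ s₁ * |X|) * ∫⁻ η : Plane, g ((2 * Real.pi) • η) :=
        lintegral_const_mul' _ _ ENNReal.ofReal_ne_top
    _ ≤ ENNReal.ofReal (4 ^ s₁ * |X|) * ∫⁻ η, g η := 
        mul_le_mul_right (lintegral_comp_two_pi_le g) _
    _ ≤ _ := by
        by_cases hX0 : X = 0
        · simp [hX0]
        rw [lintegral_plane hgm]
        refine (mul_le_mul_right (schr_kernel_le hl hX0 T) _).trans ?_
        have hXp : 0 < |X| := abs_pos.2 hX0
        rw [← ENNReal.ofReal_inv_of_pos (by positivity)]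
        calc _ = ENNReal.ofReal (4 ^ s₁ * |X| * (2 * lam * |X|)⁻¹) * jbInt r ^ 2 := by
              rw [← mul_assoc, ← ENNReal.ofReal_mul (by positivity)]
          _ ≤ ENNReal.ofReal (4 ^ s₁ * lam⁻¹) * jbInt r ^ 2 := by
              refine mul_le_mul_left (ENNReal.ofReal_le_ofReal ?_) _
              have e : (4 : ℝ) ^ s₁ * |X| * (2 * lam * |X|)⁻¹ = 4 ^ s₁ * lam⁻¹ / 2 := by
                field_simp
              rw [e]
              exact half_le_self (by positivity)
          _ = _ := by rw [ENNReal.ofReal_mul (by positivity)]; ring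

lemma measurable_schrSymbol (lam s₁ s₂ θ : ℝ) :
    Measurable (Function.uncurry (schrSymbol lam s₁ s₂ θ)) := by
  have h1 := (continuous_wt continuous_hAiry s₂ (-(1 / 2) + 2 * θ)).measurable
  have h2 := (continuous_wt (continuous_hSchr lam) s₁ (1 / 2 + θ)).measurable
  have h3 : Measurable fun q : Plane × Plane => 2 * Real.pi * |q.1.fst| := by
    have : Measurable fun q : Plane × Plane => q.1.fst := measurable_plane_fst.comp measurable_fst
    fun_prop
  exact ((h1.comp measurable_fst).mul h3).mul
    ((h2.comp measurable_snd).inv.mul (h2.comp (measurable_snd.sub measurable_fst)).inv)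

lemma ofReal_inv_wt_cancel {h : ℝ → ℝ} {s b : ℝ} (η : Plane) (x : ℝ≥0∞) :
    ENNReal.ofReal (wt h s b η)⁻¹ * (ENNReal.ofReal (wt h s b η) * x) = x := by
  have := wt_pos h s b η
  rw [← mul_assoc, ← ENNReal.ofReal_mul (by positivity), inv_mul_cancel₀ this.ne',
    ENNReal.ofReal_one, one_mul]

theorem schr_schr_estimate {s₁ s₂ : ℝ} (hs₁ : 0 ≤ s₁) (hs : s₂ - s₁ < -(1 / 2)) {θ : ℝ}
    (hθ : 0 < θ) (hθ1 : θ ≤ 1 / 4) {ψ : ℝ → ℝ} (hψ : ContDiff ℝ ∞ ψ) (hc : HasCompactSupport ψ) :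
    ∃ C : ℝ, 0 < C ∧ ∀ lam : ℝ, 0 < lam → lam ≤ 1 → ∀ u w : 𝓢'(Plane, ℂ),
      XNorm (hSchr lam) s₁ (1 / 2 + θ) u < ⊤ → XNorm (hSchr lam) s₁ (1 / 2 + θ) w < ⊤ →
      ∃ (U W : Plane → ℂ) (z : 𝓢'(Plane, ℂ)), IsFun u U ∧ IsFun w W ∧
        IsFun z (fun p => U p * (starRingEnd ℂ) (W p)) ∧
        XNorm hAiry s₂ (-(1 / 2) + 2 * θ) (mulTime ψ (dx z)) ≤
          ENNReal.ofReal (C * lam ^ (-(1 / 2) : ℝ)) *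
            (XNorm (hSchr lam) s₁ (1 / 2 + θ) u * XNorm (hSchr lam) s₁ (1 / 2 + θ) w) := by
  obtain ⟨K, hK, hmul⟩ := exists_fourier_mulTime hψ hc (C := 14) (by norm_num)
  set J := jbInt (1 + 2 * θ)
  have hJ : J < ⊤ := jbInt_lt_top (by linarith)
  -- All estimates are for squared norms, so the constant is `√D`; the summand 1 only ensures
  -- positivity.
  set D : ℝ := K * (4 ^ s₁ * J.toReal ^ 2) + 1
  have hD : 0 < D := by positivity
  refine ⟨√D, Real.sqrt_pos.2 hD, fun lam hl hl1 u w hu hw => ?_⟩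
  obtain ⟨F, hFm, hF⟩ := exists_of_XNorm_lt_top hu
  obtain ⟨G, hGm, hG⟩ := exists_of_XNorm_lt_top hw
  have hF2 := memLp_two_of_weighted hs₁ (by linarith) hu hF
  have hG2 := memLp_two_of_weighted hs₁ (by linarith) hw hG
  obtain ⟨U, hU, hU2⟩ := exists_isFun_of_fourier hF hF2
  obtain ⟨W, hW, hW2⟩ := exists_isFun_of_fourier hG hG2
  have hWc := memLp_conj hW2
  obtain ⟨wc, hwc⟩ := exists_isFun_of_memLp hWc
  have hwcF := hW.fourier_conj hG hwc
  have hUW : MemLp (fun p => U p * (starRingEnd ℂ) (W p)) 1 volume :=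
    memLp_one_iff_integrable.2 (hU2.integrable_mul hWc)
  obtain ⟨z, hz⟩ := exists_isFun_of_memLp hUW
  refine ⟨U, W, z, hU, hW, hz, ?_⟩
  have hzF := hU.fourier_mul hF hwc hwcF hU2 hWc hz
  have hdz := hzF.fourier_dx
  set H₀ : Plane → ℂ := fun ζ => 2 * Real.pi * Complex.I *
    (ζ.fst * ∫ η, F η * (starRingEnd ℂ) (G (-(ζ - η)))) with hH₀
  set W' := wt hAiry s₂ (-(1 / 2) + 2 * θ) with hW'
  set w₁ := wt (hSchr lam) s₁ (1 / 2 + θ) with hw₁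
  set A : Plane → ℝ≥0∞ := fun η => ENNReal.ofReal (w₁ η) * ‖F η‖ₑ with hA
  -- The Fourier transform of `w̄` is the conjugate of `G(-ζ)`; the reflection makes the integrand
  -- `A(η) B(ζ - η)` a genuine convolution.
  set B : Plane → ℝ≥0∞ := fun η => ENNReal.ofReal (w₁ (-η)) * ‖G (-η)‖ₑ with hB
  have hw₁m : Measurable w₁ := (continuous_wt (continuous_hSchr lam) _ _).measurable
  have hAm : Measurable A := by fun_prop
  have hBm : Measurable B := by fun_prop
  have hpt : ∀ ζ, ENNReal.ofReal (W' ζ) * ‖H₀ ζ‖ₑ ≤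
      ∫⁻ η, ENNReal.ofReal (schrSymbol lam s₁ s₂ θ ζ η) * (A η * B (ζ - η)) := by
    intro ζ
    have hn : ‖H₀ ζ‖ₑ ≤ ENNReal.ofReal (2 * Real.pi * |ζ.fst|) * ∫⁻ η, ‖F η‖ₑ * ‖G (η - ζ)‖ₑ := by
      simp only [hH₀]
      rw [← mul_assoc, enorm_mul]
      gcongr
      · rw [← ofReal_norm]
        apply ENNReal.ofReal_le_ofReal
        simp [abs_of_pos Real.pi_pos]
      · refine (enorm_integral_le_lintegral_enorm _).trans (le_of_eq ?_)
        congr 1; ext η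
        rw [enorm_mul, RCLike.enorm_conj, neg_sub]
    have hp := wt_pos hAiry s₂ (-(1 / 2) + 2 * θ) ζ
    calc _ ≤ ENNReal.ofReal (W' ζ) * (ENNReal.ofReal (2 * Real.pi * |ζ.fst|) *
          ∫⁻ η, ‖F η‖ₑ * ‖G (η - ζ)‖ₑ) := by gcongr
      _ = ∫⁻ η, ENNReal.ofReal (W' ζ) * ENNReal.ofReal (2 * Real.pi * |ζ.fst|) *
          (‖F η‖ₑ * ‖G (η - ζ)‖ₑ) := by
          rw [← mul_assoc, lintegral_const_mul' _ _ (ENNReal.mul_ne_top ENNReal.ofReal_ne_top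
            ENNReal.ofReal_ne_top)]
      _ = _ := by
          congr 1; ext η
          have p1 := wt_pos (hSchr lam) s₁ (1 / 2 + θ) η
          have p2 := wt_pos (hSchr lam) s₁ (1 / 2 + θ) (η - ζ)
          simp only [schrSymbol, hA, hB, neg_sub]
          rw [ENNReal.ofReal_mul (p := wt hAiry s₂ (-(1 / 2) + 2 * θ) ζ * (2 * Real.pi * |ζ.fst|))
            (by positivity), ENNReal.ofReal_mul (p := wt hAiry s₂ (-(1 / 2) + 2 * θ) ζ) hp.le,
            ENNReal.ofReal_mul (p := (wt (hSchr lam) s₁ (1 / 2 + θ) η)⁻¹) (by positivity)]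
          conv_lhs => rw [← ofReal_inv_wt_cancel (h := hSchr lam) (s := s₁) (b := 1 / 2 + θ) η ‖F η‖ₑ,
            ← ofReal_inv_wt_cancel (h := hSchr lam) (s := s₁) (b := 1 / 2 + θ) (η - ζ) ‖G (η - ζ)‖ₑ]
          ring
  have hBint : ∫⁻ η, B η ^ 2 = ∫⁻ η, (ENNReal.ofReal (w₁ η) * ‖G η‖ₑ) ^ 2 :=
    lintegral_neg_eq_self (fun η => (ENNReal.ofReal (w₁ η) * ‖G η‖ₑ) ^ 2)
  have hmain : ∫⁻ ζ, (ENNReal.ofReal (W' ζ) * ‖H₀ ζ‖ₑ) ^ 2 ≤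
      ENNReal.ofReal (4 ^ s₁) * J ^ 2 * ENNReal.ofReal lam⁻¹ *
        ((∫⁻ η, A η ^ 2) * ∫⁻ η, B η ^ 2) := by
    refine (lintegral_mono fun ζ => pow_le_pow_left₀ zero_le (hpt ζ) 2).trans ?_
    exact lintegral_sq_conv_le (K := fun ζ η => ENNReal.ofReal (schrSymbol lam s₁ s₂ θ ζ η))
      (measurable_schrSymbol lam s₁ s₂ θ).ennreal_ofReal hAm hBm
      (lintegral_schrSymbol_le hl hs₁ hs hθ1)
  have hXu := XNorm_sq hF (hSchr lam) s₁ (1 / 2 + θ)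
  have hXw := XNorm_sq hG (hSchr lam) s₁ (1 / 2 + θ)
  have hle : ∀ x : ℝ≥0∞, x ≤ ENNReal.ofReal ((2 * Real.pi) ^ 2) * x := fun x =>
    le_mul_of_one_le_left zero_le (ENNReal.one_le_ofReal.2 (one_le_pow₀ one_le_two_pi))
  have hAfin : ∫⁻ η, A η ^ 2 < ⊤ := ((hle _).trans_eq hXu.symm).trans_lt (ENNReal.pow_lt_top hu)
  have hBfin : ∫⁻ η, B η ^ 2 < ⊤ := by
    rw [hBint]
    exact ((hle _).trans_eq hXw.symm).trans_lt (ENNReal.pow_lt_top hw)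
  have hWt := isWeight_wt continuous_hAiry hAiry_bound s₂ (b := -(1 / 2) + 2 * θ)
    (by linarith) (by linarith)
  obtain ⟨H, hHm, hH⟩ := hdz.exists_measurable
  have hHH : ∫⁻ ζ, (ENNReal.ofReal (W' ζ) * ‖H ζ‖ₑ) ^ 2 =
      ∫⁻ ζ, (ENNReal.ofReal (W' ζ) * ‖H₀ ζ‖ₑ) ^ 2 := by
    refine lintegral_congr_ae ?_
    filter_upwards [hH.ae_eq hdz] with ζ hζ
    rw [hζ]
  have hfin : ∫⁻ ζ, (ENNReal.ofReal (W' ζ) * ‖H ζ‖ₑ) ^ 2 < ⊤ := by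
    rw [hHH]
    refine hmain.trans_lt (ENNReal.mul_lt_top (ENNReal.mul_lt_top (ENNReal.mul_lt_top
      ENNReal.ofReal_lt_top (ENNReal.pow_lt_top hJ)) ENNReal.ofReal_lt_top)
      (ENNReal.mul_lt_top hAfin hBfin))
  obtain ⟨H', hH', hle'⟩ := hmul W' hWt (dx z) H hHm hH hfin
  rw [← ENNReal.pow_le_pow_left_iff two_ne_zero, XNorm_sq hH' hAiry s₂ (-(1 / 2) + 2 * θ)]
  have hconst : ENNReal.ofReal K * (ENNReal.ofReal (4 ^ s₁) * J ^ 2 * ENNReal.ofReal lam⁻¹) ≤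
      ENNReal.ofReal (√D * lam ^ (-(1 / 2) : ℝ)) ^ 2 := by
    rw [← ENNReal.ofReal_toReal hJ.ne, ← ENNReal.ofReal_pow ENNReal.toReal_nonneg,
      ← ENNReal.ofReal_mul (by positivity), ← ENNReal.ofReal_mul (by positivity),
      ← ENNReal.ofReal_mul (by positivity), ← ENNReal.ofReal_pow (by positivity)]
    apply ENNReal.ofReal_le_ofReal
    rw [mul_pow, Real.sq_sqrt hD.le, ← Real.rpow_natCast (lam ^ _), ← Real.rpow_mul hl.le]
    have : lam ^ (-(1 / 2) * ((2 : ℕ) : ℝ)) = lam⁻¹ := by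
      rw [← Real.rpow_neg_one]; norm_num
    rw [this, ← mul_assoc]
    gcongr
    simp only [D]
    linarith
  set a := ENNReal.ofReal ((2 * Real.pi) ^ 2)
  calc _ ≤ a * (ENNReal.ofReal K * (ENNReal.ofReal (4 ^ s₁) * J ^ 2 * ENNReal.ofReal lam⁻¹ *
        ((∫⁻ η, A η ^ 2) * ∫⁻ η, B η ^ 2))) := by
        gcongr
        refine hle'.trans ?_
        rw [hHH]
        gcongr
    _ = (ENNReal.ofReal K * (ENNReal.ofReal (4 ^ s₁) * J ^ 2 * ENNReal.ofReal lam⁻¹)) *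
        (a * (∫⁻ η, A η ^ 2) * ∫⁻ η, B η ^ 2) := by ring
    -- The left side carries the Jacobian `a = (2π)²` once and the product of two squared norms
    -- carries it twice; the extra factor may be inserted because it is at least 1.
    _ ≤ ENNReal.ofReal (√D * lam ^ (-(1 / 2) : ℝ)) ^ 2 *
        (a * (∫⁻ η, A η ^ 2) * (a * ∫⁻ η, B η ^ 2)) := by
        gcongr
        exact hle _
    _ = _ := by
        rw [mul_pow, mul_pow, hXu, hXw, hBint]

/-! ### Cutoff functions -/

lemma IsCutoff.hasCompactSupport {η₀ : ℝ → ℝ} (hη : IsCutoff η₀) : HasCompactSupport η₀ :=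
  HasCompactSupport.of_support_subset_isCompact isCompact_Icc hη.support_subset

lemma IsCutoff.eq_zero {η₀ : ℝ → ℝ} (hη : IsCutoff η₀) {x : ℝ} (hx : 8 / 5 < |x|) : η₀ x = 0 := by
  by_contra h
  have := hη.support_subset h
  exact absurd (abs_le.2 this) (not_le.2 hx)

lemma IsCutoff.eq_one_of_abs_le {η₀ : ℝ → ℝ} (hη : IsCutoff η₀) {x : ℝ} (hx : |x| ≤ 5 / 4) :
    η₀ x = 1 := hη.eq_one x (abs_le.1 hx)

lemma exists_schwartz_real {ψ : ℝ → ℝ} (hψ : ContDiff ℝ ∞ ψ) (hc : HasCompactSupport ψ) :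
    ∃ a : 𝓢(ℝ, ℂ), ∀ x, a x = (ψ x : ℂ) := by
  have h1 : HasCompactSupport (fun x => (ψ x : ℂ)) := hc.comp_left (g := fun r : ℝ => (r : ℂ)) rfl
  have h2 : ContDiff ℝ ∞ (fun x => (ψ x : ℂ)) := Complex.ofRealCLM.contDiff.comp hψ
  exact ⟨h1.toSchwartzMap h2, fun x => rfl⟩

/-- The symbol `η₀(cξ)` as a Schwartz function. -/
lemma IsCutoff.exists_schwartz {η₀ : ℝ → ℝ} (hη : IsCutoff η₀) {c : ℝ} (hc : c ≠ 0) :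
    ∃ a : 𝓢(ℝ, ℂ), ∀ x, a x = (η₀ (c * x) : ℂ) := by
  refine exists_schwartz_real (hη.smooth.comp (contDiff_const.mul contDiff_id)) ?_
  exact hη.hasCompactSupport.comp_homeomorph (Homeomorph.mulLeft₀ c hc)

/-- The unit vector in the direction of the first coordinate. -/
abbrev e₁ : Plane := WithLp.toLp 2 ((1 : ℝ), (0 : ℝ))

lemma inner_e₁ (p : Plane) : inner ℝ e₁ p = p.fst := by simp

lemma hasTemperateGrowth_eta {η₀ : ℝ → ℝ} (hη : IsCutoff η₀) (k : ℕ) :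
    (fun ζ : Plane => ((eta η₀ k (2 * Real.pi * ζ.fst) : ℝ) : ℂ)).HasTemperateGrowth := by
  have key : ∀ c : ℝ, c ≠ 0 →
      (fun ζ : Plane => ((η₀ (c * ζ.fst) : ℝ) : ℂ)).HasTemperateGrowth := by
    intro c hc
    obtain ⟨a, ha⟩ := hη.exists_schwartz hc
    have := hasTemperateGrowth_comp_inner a e₁
    simp only [ha, inner_e₁] at this
    exact this
  have hpi : 2 * Real.pi ≠ 0 := by positivity
  cases k with
  | zero => exact key _ hpi
  | succ k =>
    have h1 := key (2 * Real.pi / 2 ^ (k + 1)) (by positivity)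
    have h2 := key (2 * Real.pi / 2 ^ k) (by positivity)
    have := h1.sub h2
    refine (congrArg Function.HasTemperateGrowth ?_).mp this
    ext ζ
    simp only [eta, Pi.sub_apply, Complex.ofReal_sub]
    congr 3 <;> ring_nf

/-! ### Functions of bounded frequency in `L²_x L^∞_t` -/

lemma L2xLinftyt_congr {f g : Plane → ℂ} (h : f =ᵐ[volume] g) : L2xLinftyt f = L2xLinftyt g := by
  have h1 : ∀ᵐ q : ℝ × ℝ ∂(volume.prod volume), f (WithLp.toLp 2 q) = g (WithLp.toLp 2 q) :=
    (WithLp.volume_preserving_toLp ℝ ℝ).quasiMeasurePreserving.ae h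
  have h2 := Measure.ae_ae_of_ae_prod h1
  unfold L2xLinftyt
  congr 1
  refine lintegral_congr_ae ?_
  filter_upwards [h2] with x hx
  rw [eLpNorm_congr_ae hx]

/-- Integrate over an arbitrary set of times of finite measure, exchange the integrals, and bound
each slice by its essential supremum. The argument never needs measurability of that supremum in
`x`. -/
lemma ae_slice_le {g : Plane → ℂ} (hg : Measurable g) :
    ∀ᵐ t : ℝ, ∫⁻ x : ℝ, ‖g (WithLp.toLp 2 (x, t))‖ₑ ^ 2 ≤ L2xLinftyt g ^ 2 := by
  have hN : L2xLinftyt g ^ 2 = ∫⁻ x : ℝ,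
      (eLpNorm (fun t : ℝ => g (WithLp.toLp 2 (x, t))) ∞ volume) ^ (2 : ℕ) := by
    rw [L2xLinftyt, ← ENNReal.rpow_natCast, ← ENNReal.rpow_mul]; norm_num
  have hm : Measurable fun q : ℝ × ℝ => ‖g (WithLp.toLp 2 q)‖ₑ ^ 2 :=
    ((hg.comp (WithLp.volume_preserving_toLp ℝ ℝ).measurable).enorm).pow_const 2
  refine ae_le_of_forall_setLIntegral_le_of_sigmaFinite ?_ fun S hS hSf => ?_
  · exact Measurable.lintegral_prod_left' hm
  · rw [setLIntegral_const]
    rw [← lintegral_lintegral_swap (f := fun x t => ‖g (WithLp.toLp 2 (x, t))‖ₑ ^ 2)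
      hm.aemeasurable, hN, mul_comm, ← lintegral_const_mul' _ _ hSf.ne]
    refine lintegral_mono fun x => ?_
    calc ∫⁻ t in S, ‖g (WithLp.toLp 2 (x, t))‖ₑ ^ 2
        ≤ ∫⁻ t in S, (eLpNorm (fun t : ℝ => g (WithLp.toLp 2 (x, t))) ∞ volume) ^ 2 := by
          refine lintegral_mono_ae (ae_restrict_of_ae ?_)
          have := enorm_ae_le_eLpNormEssSup (fun t : ℝ => g (WithLp.toLp 2 (x, t))) volume
          filter_upwards [this] with t ht
          rw [eLpNorm_exponent_top]
          gcongr
      _ = _ := by rw [setLIntegral_const, mul_comm]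

/-- Pointwise decay of a Schwartz function and of its difference quotients. -/
lemma exists_schwartz_decay (A : 𝓢(ℝ, ℂ)) : ∃ D : ℝ, 0 < D ∧ (∀ ρ, ‖A ρ‖ ≤ D * jb ρ ^ (-2 : ℝ)) ∧
    ∀ h ρ, |h| ≤ 1 → ‖A (ρ + h) - A ρ‖ ≤ D * |h| * jb ρ ^ (-2 : ℝ) := by
  have key : ∀ B : 𝓢(ℝ, ℂ), ∃ D : ℝ, 0 < D ∧ ∀ ρ, (1 + ρ ^ 2) * ‖B ρ‖ ≤ D := by
    intro B
    obtain ⟨C₀, hC₀, h₀⟩ := B.decay 0 0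
    obtain ⟨C₂, hC₂, h₂⟩ := B.decay 2 0
    refine ⟨C₀ + C₂, by positivity, fun ρ => ?_⟩
    have h0 := h₀ ρ
    have h2 := h₂ ρ
    simp only [norm_iteratedFDeriv_zero, pow_zero, one_mul, Real.norm_eq_abs, sq_abs] at h0 h2
    linarith
  have hjb : ∀ ρ, jb ρ ^ (-2 : ℝ) = (1 + ρ ^ 2)⁻¹ := fun ρ => by
    rw [Real.rpow_neg (jb_pos ρ).le, Real.rpow_two, jb_sq]
  obtain ⟨D₁, hD₁, h₁⟩ := key A
  obtain ⟨D₂, hD₂, h₂⟩ := key (SchwartzMap.derivCLM ℂ ℂ A)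
  have hA' : ∀ ρ, HasDerivAt A (SchwartzMap.derivCLM ℂ ℂ A ρ) ρ := fun ρ => A.hasDerivAt ρ
  refine ⟨D₁ + 3 * D₂, by positivity, fun ρ => ?_, fun h ρ hh => ?_⟩
  · rw [hjb, ← div_eq_mul_inv, le_div_iff₀ (by positivity)]
    linarith [h₁ ρ]
  · have hd : ∀ y ∈ Set.Icc (ρ - 1) (ρ + 1), ‖SchwartzMap.derivCLM ℂ ℂ A y‖ ≤
        3 * D₂ * (1 + ρ ^ 2)⁻¹ := by
      intro y hy
      rw [← div_eq_mul_inv, le_div_iff₀ (by positivity)]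
      have h3 := h₂ y
      -- Brackets are comparable at distance at most 1, so the decay of the derivative passes to the
      -- difference by the mean value inequality.
      have h4 : 1 + ρ ^ 2 ≤ 3 * (1 + y ^ 2) := by
        nlinarith [hy.1, hy.2, sq_nonneg (2 * y - ρ)]
      nlinarith [norm_nonneg (SchwartzMap.derivCLM ℂ ℂ A y)]
    have hm := (convex_Icc (ρ - 1) (ρ + 1)).norm_image_sub_le_of_norm_hasDerivWithin_le
      (f := A) (f' := fun y => SchwartzMap.derivCLM ℂ ℂ A y)
      (fun y _ => (hA' y).hasDerivWithinAt) hd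
      (x := ρ) (y := ρ + h) ⟨by linarith, by linarith⟩
      ⟨by linarith [(abs_le.1 hh).1], by linarith [(abs_le.1 hh).2]⟩
    rw [add_sub_cancel_left, Real.norm_eq_abs] at hm
    rw [hjb]
    refine hm.trans ?_
    have : 0 ≤ |h| * (1 + ρ ^ 2)⁻¹ := by positivity
    nlinarith

/-- The square of the `L²` norm of `⟨ρ⟩⁻²`. -/
lemma lintegral_jb_neg_two_sq : ∫⁻ ρ, ENNReal.ofReal (jb ρ ^ (-2 : ℝ)) ^ 2 = jbInt 4 := by
  unfold jbInt
  congr 1; ext ρ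
  rw [← ENNReal.ofReal_pow (Real.rpow_nonneg (jb_pos ρ).le _), ← Real.rpow_natCast,
    ← Real.rpow_mul (jb_pos ρ).le]
  norm_num

lemma lintegral_decay_slice_le {g : Plane → ℂ} (hg : Measurable g) {N : ℝ} (x t : ℝ)
    (ht : ∫⁻ x : ℝ, ‖g (WithLp.toLp 2 (x, t))‖ₑ ^ 2 ≤ ENNReal.ofReal N ^ 2) :
    ∫⁻ ρ, ENNReal.ofReal (jb ρ ^ (-2 : ℝ)) * ‖g (WithLp.toLp 2 (x, t) + ρ • e₁)‖ₑ ≤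
      ENNReal.ofReal (√((jbInt 4).toReal) * N) := by
  have hJ : jbInt 4 < ⊤ := jbInt_lt_top (by norm_num)
  have e : ∀ ρ : ℝ, (WithLp.toLp 2 (x, t) + ρ • e₁ : Plane) = WithLp.toLp 2 (ρ + x, t) := by
    intro ρ
    rw [← WithLp.toLp_smul, ← WithLp.toLp_add]
    simp [add_comm]
  simp_rw [e]
  have hm : Measurable fun ρ : ℝ => ‖g (WithLp.toLp 2 (ρ + x, t))‖ₑ :=
    (hg.comp ((WithLp.volume_preserving_toLp ℝ ℝ).measurable.comp (by fun_prop))).enorm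
  rw [← ENNReal.pow_le_pow_left_iff two_ne_zero]
  refine (sq_lintegral_mul_le volume
    (continuous_jb_rpow _).measurable.ennreal_ofReal.aemeasurable hm.aemeasurable).trans ?_
  rw [lintegral_jb_neg_two_sq,
    lintegral_add_right_eq_self (fun ρ => ‖g (WithLp.toLp 2 (ρ, t))‖ₑ ^ 2) x,
    ENNReal.ofReal_mul (Real.sqrt_nonneg _), mul_pow]
  refine mul_le_mul' (le_of_eq ?_) ht
  rw [← ENNReal.ofReal_pow (Real.sqrt_nonneg _), Real.sq_sqrt ENNReal.toReal_nonneg,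
    ENNReal.ofReal_toReal hJ.ne]

/-- The symbol of `P_0` lives on `|2πζ| ≤ 8/5`, where `|πζ| ≤ 4/5 < 5/4` and the cutoff of twice the
width equals 1. Thus `P_0 v` is a convolution of itself with a Schwartz function of `x`. -/
lemma P_zero_reproducing {η₀ : ℝ → ℝ} (hη : IsCutoff η₀) {a : 𝓢(ℝ, ℂ)}
    (ha : ∀ x, a x = (η₀ (Real.pi * x) : ℂ)) (v : 𝓢'(Plane, ℂ)) :
    TemperedDistribution.fourierMultiplierCLM ℂ (fun p : Plane => a (inner ℝ e₁ p)) (Ple η₀ 0 v) =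
      Ple η₀ 0 v := by
  have h1 : Ple η₀ 0 v = P η₀ 0 v := by simp [Ple]
  rw [h1, P, TemperedDistribution.fourierMultiplierCLM_fourierMultiplierCLM_apply
    (hasTemperateGrowth_eta hη 0) (hasTemperateGrowth_comp_inner a e₁)]
  congr 2
  ext ζ
  simp only [Pi.mul_apply, inner_e₁, ha, eta]
  by_cases h : |2 * Real.pi * ζ.fst| ≤ 8 / 5
  · have : η₀ (Real.pi * ζ.fst) = 1 := by
      apply hη.eq_one_of_abs_le
      rw [show 2 * Real.pi * ζ.fst = 2 * (Real.pi * ζ.fst) by ring, abs_mul, abs_two] at h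
      linarith
    rw [this]; simp
  · rw [hη.eq_zero (not_le.1 h)]; simp

/-- A function of bounded spatial frequency in `L²_x L^∞_t` is bounded and Lipschitz in `x`. -/
lemma exists_low_bounds {η₀ : ℝ → ℝ} (hη : IsCutoff η₀) : ∃ C : ℝ, 0 < C ∧
    ∀ (v : 𝓢'(Plane, ℂ)) (g : Plane → ℂ), IsFun (Ple η₀ 0 v) g → L2xLinftyt g < ⊤ →
      ∃ g', Measurable g' ∧ IsFun (Ple η₀ 0 v) g' ∧
        (∀ p, ‖g' p‖ ≤ C * (L2xLinftyt g).toReal) ∧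
        ∀ h p, |h| ≤ 1 → ‖g' (p + h • e₁) - g' p‖ ≤ C * |h| * (L2xLinftyt g).toReal := by
  obtain ⟨a, ha⟩ := hη.exists_schwartz Real.pi_ne_zero
  obtain ⟨A, hA⟩ : ∃ A : 𝓢(ℝ, ℂ), A = 𝓕 a := ⟨_, rfl⟩
  obtain ⟨D, hD, hA1, hA2⟩ := exists_schwartz_decay A
  set J := √((jbInt 4).toReal)
  refine ⟨D * J + 1, by positivity, fun v g₀ hg₀ hN₀ => ?_⟩
  obtain ⟨g, hgm, hg⟩ := hg₀.exists_measurable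
  have hLL : L2xLinftyt g₀ = L2xLinftyt g := L2xLinftyt_congr (hg₀.ae_eq hg)
  rw [hLL] at hN₀ ⊢
  set N := (L2xLinftyt g).toReal
  have hNN : L2xLinftyt g = ENNReal.ofReal N := (ENNReal.ofReal_toReal hN₀.ne).symm
  have hN0 : 0 ≤ N := ENNReal.toReal_nonneg
  have hAm := A.continuous.measurable
  -- The times whose slice obeys the L² bound have full measure. The final representative is set to
  -- zero at all other times. As translation along `e₁` does not change `t`, both bounds then hold
  -- at every point.
  set S : Set ℝ := {t | ∫⁻ x : ℝ, ‖g (WithLp.toLp 2 (x, t))‖ₑ ^ 2 ≤ ENNReal.ofReal N ^ 2} with hS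
  have hSm : MeasurableSet S := by
    refine measurableSet_le (Measurable.lintegral_prod_left' (f := fun q : ℝ × ℝ =>
      ‖g (WithLp.toLp 2 q)‖ₑ ^ 2) ?_) measurable_const
    exact ((hgm.comp (WithLp.volume_preserving_toLp ℝ ℝ).measurable).enorm).pow_const 2
  have hSae : ∀ᵐ t, t ∈ S := by
    have := ae_slice_le hgm
    rwa [hNN] at this
  have hSplane : ∀ᵐ p : Plane, p.snd ∈ S := by
    have h2 : ∀ᵐ q : ℝ × ℝ, q.2 ∈ S := Measure.quasiMeasurePreserving_snd.ae hSae
    exact (WithLp.volume_preserving_ofLp ℝ ℝ).quasiMeasurePreserving.ae h2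
  have hslice : ∀ p : Plane, p.snd ∈ S →
      ∫⁻ ρ, ENNReal.ofReal (jb ρ ^ (-2 : ℝ)) * ‖g (p + ρ • e₁)‖ₑ ≤ ENNReal.ofReal (J * N) :=
    fun p hp => lintegral_decay_slice_le hgm p.fst p.snd hp
  have hconv : ∀ (B : ℝ → ℂ) (c : ℝ), 0 ≤ c → (∀ ρ, ‖B ρ‖ ≤ c * jb ρ ^ (-2 : ℝ)) →
      ∀ p : Plane, p.snd ∈ S → ∫⁻ ρ, ‖B ρ‖ₑ * ‖g (p + ρ • e₁)‖ₑ ≤ ENNReal.ofReal (c * (J * N)) := by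
    intro B c hc hB p hp
    rw [ENNReal.ofReal_mul hc]
    refine le_trans ?_ (mul_le_mul_right (hslice p hp) _)
    rw [← lintegral_const_mul' _ _ ENNReal.ofReal_ne_top]
    refine lintegral_mono fun ρ => ?_
    rw [← mul_assoc, ← ENNReal.ofReal_mul hc, ← ofReal_norm (B ρ)]
    gcongr
    exact hB ρ
  set G : Plane → ℂ := fun p => ∫ ρ, A ρ * g (p + ρ • e₁) with hG
  have hGm : Measurable G := by
    have : StronglyMeasurable (fun q : Plane × ℝ => A q.2 * g (q.1 + q.2 • e₁)) :=
      (by fun_prop : Measurable _).stronglyMeasurable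
    exact this.integral_prod_right'.measurable
  have hint : ∀ φ : 𝓢(Plane, ℂ), Integrable
      (fun q : Plane × ℝ => A q.2 * g (q.1 + q.2 • e₁) * φ q.1) (volume.prod volume) := by
    intro φ
    have hφm := φ.continuous.measurable
    refine ⟨Measurable.aestronglyMeasurable (by fun_prop), ?_⟩
    rw [HasFiniteIntegral, lintegral_prod _ (by fun_prop)]
    calc _ ≤ ∫⁻ p, ENNReal.ofReal (D * (J * N)) * ‖φ p‖ₑ := by
          refine lintegral_mono_ae ?_
          filter_upwards [hSplane] with p hp
          simp only [enorm_mul]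
          rw [lintegral_mul_const _ (by fun_prop)]
          gcongr
          exact hconv A D hD.le hA1 p hp
      _ = ENNReal.ofReal (D * (J * N)) * ∫⁻ p, ‖φ p‖ₑ :=
          lintegral_const_mul' _ _ ENNReal.ofReal_ne_top
      _ < ⊤ := ENNReal.mul_lt_top ENNReal.ofReal_lt_top φ.integrable.hasFiniteIntegral
  have hGfun : IsFun (Ple η₀ 0 v) G := by
    intro φ
    have e1 : ∀ p, G p * φ p = ∫ ρ, A ρ * g (p + ρ • e₁) * φ p :=
      fun p => (integral_mul_const _ _).symm
    simp_rw [e1]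
    refine ⟨(hint φ).integral_prod_left, ?_⟩
    conv_lhs => rw [← P_zero_reproducing hη ha v]
    rw [TemperedDistribution.fourierMultiplierCLM_apply_apply, (hg _).2]
    simp_rw [fourier_smulLeft_fourierInv, ← hA]
    rw [integral_integral_swap (hint φ)]
    have e3 : ∀ p, g p * ∫ ρ, A ρ * φ (p - ρ • e₁) = ∫ ρ, A ρ * g p * φ (p - ρ • e₁) := by
      intro p; rw [← integral_const_mul]
      exact integral_congr_ae (ae_of_all _ fun ρ => by simp only; ring)
    simp_rw [e3]
    have hmp : MeasurePreserving (fun q : Plane × ℝ => (q.1 - q.2 • e₁, q.2))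
        (volume.prod volume) (volume.prod volume) := by
      have : MeasurePreserving (fun q : ℝ × Plane => (q.1, q.2 - q.1 • e₁))
          ((volume : Measure ℝ).prod (volume : Measure Plane)) (volume.prod volume) :=
        (MeasurePreserving.id _).skew_product (g := fun ρ x => x - ρ • e₁)
          (by simp only [Function.uncurry_def]; fun_prop)
          (ae_of_all _ fun ρ => map_sub_right_eq_self _ _)
      exact (Measure.measurePreserving_swap.comp this).comp Measure.measurePreserving_swap
    rw [integral_integral_swap]
    · refine integral_congr_ae (ae_of_all _ fun ρ => ?_)
      refine Eq.trans ?_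
        (integral_sub_right_eq_self (fun x => A ρ * g (x + ρ • e₁) * φ x) (ρ • e₁))
      simp
    · have := hmp.integrable_comp_of_integrable (hint φ)
      refine this.congr (ae_of_all _ fun q => ?_)
      simp [Function.uncurry]
  refine ⟨fun p => S.indicator (fun _ => G p) p.snd, ?_, ?_, ?_, ?_⟩
  · have : (fun p : Plane => S.indicator (fun _ => G p) p.snd) =
        {p : Plane | p.snd ∈ S}.indicator G := by
      ext p; by_cases h : p.snd ∈ S <;> simp [h]
    rw [this]
    exact hGm.indicator (measurable_plane_snd hSm)
  · refine hGfun.congr ?_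
    filter_upwards [hSplane] with p hp
    simp [hp]
  · intro p
    by_cases hp : p.snd ∈ S
    · simp only [hp, Set.indicator_of_mem]
      have h1 : ‖G p‖ₑ ≤ ENNReal.ofReal (D * (J * N)) := by
        refine (enorm_integral_le_lintegral_enorm _).trans ?_
        simp only [enorm_mul]
        exact hconv A D hD.le hA1 p hp
      rw [← ofReal_norm, ENNReal.ofReal_le_ofReal_iff (by positivity)] at h1
      nlinarith
    · simp only [hp, Set.indicator_of_notMem, not_false_iff, norm_zero]; positivity
  · intro h p hh
    have e2 : (p + h • e₁).snd = p.snd := by simp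
    simp only [e2]
    by_cases hp : p.snd ∈ S
    · simp only [hp, Set.indicator_of_mem]
      have hI : ∀ (B : ℝ → ℂ), Measurable B → ∀ c : ℝ, 0 ≤ c → (∀ ρ, ‖B ρ‖ ≤ c * jb ρ ^ (-2 : ℝ)) →
          Integrable fun ρ => B ρ * g (p + ρ • e₁) := by
        intro B hBm c hc hB
        refine ⟨Measurable.aestronglyMeasurable (by fun_prop), ?_⟩
        rw [HasFiniteIntegral]
        simp only [enorm_mul]
        exact (hconv B c hc hB p hp).trans_lt ENNReal.ofReal_lt_top
      have hh' : |(-h)| ≤ 1 := by rwa [abs_neg]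
      have hd : ∀ ρ, ‖A (ρ + -h) - A ρ‖ ≤ D * |h| * jb ρ ^ (-2 : ℝ) := fun ρ => by
        have := hA2 (-h) ρ hh'; rwa [abs_neg] at this
      have hs : ∀ ρ, ‖A (ρ + -h)‖ ≤ (D + D * |h|) * jb ρ ^ (-2 : ℝ) := fun ρ => by
        have := norm_add_le (A (ρ + -h) - A ρ) (A ρ)
        rw [sub_add_cancel] at this
        linarith [hd ρ, hA1 ρ]
      -- The translation is moved onto the Schwartz kernel, so that the Lipschitz bound comes from
      -- the smoothness of `A` and requires none of `g`.
      have h3 : G (p + h • e₁) = ∫ ρ, A (ρ + -h) * g (p + ρ • e₁) := by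
        rw [hG]
        simp only
        rw [← integral_add_right_eq_self _ (-h)]
        refine integral_congr_ae (ae_of_all _ fun ρ => ?_)
        simp only
        congr 2
        rw [add_smul, neg_smul]; abel
      have h4 : G (p + h • e₁) - G p = ∫ ρ, (A (ρ + -h) - A ρ) * g (p + ρ • e₁) := by
        rw [h3, hG]
        simp only
        rw [← integral_sub (hI _ (by fun_prop) _ (by positivity) hs) (hI _ hAm _ hD.le hA1)]
        refine integral_congr_ae (ae_of_all _ fun ρ => ?_)
        simp only; ring
      have h5 : ‖G (p + h • e₁) - G p‖ₑ ≤ ENNReal.ofReal (D * |h| * (J * N)) := by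
        rw [h4]
        refine (enorm_integral_le_lintegral_enorm _).trans ?_
        simp only [enorm_mul]
        exact hconv _ _ (by positivity) hd p hp
      rw [← ofReal_norm, ENNReal.ofReal_le_ofReal_iff (by positivity)] at h5
      nlinarith [mul_nonneg (abs_nonneg h) hN0]
    · simp only [hp, Set.indicator_of_notMem, not_false_iff, sub_zero, norm_zero]; positivity

/-! ### Fractional Sobolev norms in `x` through difference quotients -/

/-- The weight `h^{-1-2s}` on the positive half line. -/
def slobWeight (s h : ℝ) : ℝ≥0∞ := (Set.Ioi 0).indicator (fun h => ENNReal.ofReal (h ^ (-1 - 2 * s))) h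

/-- `|e^{2πix} - 1|²`. -/
def expDiffSq (x : ℝ) : ℝ≥0∞ := ‖Complex.exp (↑(2 * Real.pi * x) * Complex.I) - 1‖ₑ ^ 2

lemma measurable_slobWeight (s : ℝ) : Measurable (slobWeight s) :=
  (by fun_prop : Measurable fun h : ℝ => ENNReal.ofReal (h ^ (-1 - 2 * s))).indicator measurableSet_Ioi

lemma measurable_expDiffSq : Measurable expDiffSq := by
  unfold expDiffSq
  have : Continuous fun x : ℝ => Complex.exp (↑(2 * Real.pi * x) * Complex.I) - 1 := by fun_prop
  exact this.measurable.enorm.pow_const 2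

lemma expDiffSq_abs (x : ℝ) : expDiffSq |x| = expDiffSq x := by
  rcases abs_choice x with h | h
  · rw [h]
  · rw [h, expDiffSq, expDiffSq, ← RCLike.enorm_conj (Complex.exp (↑(2 * Real.pi * x) * Complex.I) - 1)]
    congr 2
    simp only [map_sub, map_one, ← Complex.exp_conj, map_mul, Complex.conj_ofReal, Complex.conj_I]
    congr 2
    push_cast; ring

lemma expDiffSq_le (x : ℝ) : expDiffSq x ≤ 49 * ENNReal.ofReal (min 1 |x|) ^ 2 := by
  have h1 : ‖Complex.exp (↑(2 * Real.pi * x) * Complex.I) - 1‖ ≤ 7 * min 1 |x| := by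
    rcases le_total 1 |x| with h | h
    · rw [min_eq_left h]
      have := norm_sub_le (Complex.exp (↑(2 * Real.pi * x) * Complex.I)) 1
      rw [Complex.norm_exp_ofReal_mul_I, norm_one] at this
      linarith
    · rw [min_eq_right h]
      have := Real.norm_exp_I_mul_ofReal_sub_one_le (x := 2 * Real.pi * x)
      rw [mul_comm Complex.I, Real.norm_eq_abs, abs_mul, abs_of_pos (by positivity : 0 < 2 * Real.pi)] at this
      exact this.trans (by gcongr; exact two_pi_le)
  have h2 : ‖Complex.exp (↑(2 * Real.pi * x) * Complex.I) - 1‖ₑ ≤ 7 * ENNReal.ofReal (min 1 |x|) := by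
    rw [← ofReal_norm]
    refine (ENNReal.ofReal_le_ofReal h1).trans (le_of_eq ?_)
    rw [ENNReal.ofReal_mul (by norm_num)]; simp
  unfold expDiffSq
  refine (pow_le_pow_left₀ zero_le h2 2).trans (le_of_eq ?_)
  rw [mul_pow]; norm_num

/-- `∫₀^∞ h^{-1-2s} min(1,h)² dh`. -/
def slobTail (s : ℝ) : ℝ≥0∞ := ∫⁻ h, slobWeight s h * ENNReal.ofReal (min 1 |h|) ^ 2

/-- Near 0 the integrand is `h^{1-2s}`, integrable because `s < 1`; at infinity it is `h^{-1-2s}`,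
integrable because `s > 0`. -/
lemma slobTail_lt_top {s : ℝ} (hs : 0 < s) (hs1 : s < 1) : slobTail s < ⊤ := by
  have h1 : IntegrableOn (fun h : ℝ => h ^ (1 - 2 * s)) (Set.Ioc 0 1) volume := by
    have := intervalIntegral.intervalIntegrable_rpow' (a := 0) (b := 1) (by linarith : -1 < 1 - 2 * s)
    rwa [intervalIntegrable_iff_integrableOn_Ioc_of_le zero_le_one] at this
  have h2 : IntegrableOn (fun h : ℝ => h ^ (-1 - 2 * s)) (Set.Ioi 1) volume :=
    integrableOn_Ioi_rpow_of_lt (by linarith) one_pos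
  have f1 : ∫⁻ h in Set.Ioc (0 : ℝ) 1, ENNReal.ofReal (h ^ (1 - 2 * s)) < ⊤ := by
    refine lt_of_le_of_lt (lintegral_mono fun h => ?_) h1.hasFiniteIntegral
    rw [← ofReal_norm]; exact ENNReal.ofReal_le_ofReal (Real.le_norm_self _)
  have f2 : ∫⁻ h in Set.Ioi (1 : ℝ), ENNReal.ofReal (h ^ (-1 - 2 * s)) < ⊤ := by
    refine lt_of_le_of_lt (lintegral_mono fun h => ?_) h2.hasFiniteIntegral
    rw [← ofReal_norm]; exact ENNReal.ofReal_le_ofReal (Real.le_norm_self _)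
  refine lt_of_le_of_lt ?_ (ENNReal.add_lt_top.2 ⟨f1, f2⟩)
  rw [← lintegral_indicator measurableSet_Ioc, ← lintegral_indicator measurableSet_Ioi, slobTail,
    ← lintegral_add_left ((by fun_prop : Measurable fun h : ℝ =>
      ENNReal.ofReal (h ^ (1 - 2 * s))).indicator measurableSet_Ioc)]
  refine lintegral_mono fun h => ?_
  by_cases h0 : 0 < h
  · rw [slobWeight, Set.indicator_of_mem (Set.mem_Ioi.2 h0), abs_of_pos h0]
    rcases le_or_gt h 1 with hh | hh
    · rw [Set.indicator_of_mem (Set.mem_Ioc.2 ⟨h0, hh⟩), min_eq_right hh]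
      refine le_add_right (le_of_eq ?_)
      rw [← ENNReal.ofReal_pow h0.le, ← ENNReal.ofReal_mul (by positivity), ← Real.rpow_natCast,
        ← Real.rpow_add h0]
      congr 2; push_cast; ring
    · rw [Set.indicator_of_mem (s := Set.Ioi 1) (Set.mem_Ioi.2 hh), min_eq_left hh.le]
      simp
  · rw [slobWeight, Set.indicator_of_notMem (by simpa using h0)]; simp

/-- `∫₀^∞ h^{-1-2s} |e^{2πihξ} - 1|² dh`. -/
def slobSymbol (s ξ : ℝ) : ℝ≥0∞ := ∫⁻ h, slobWeight s h * expDiffSq (h * ξ)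

lemma slobSymbol_one_lt_top {s : ℝ} (hs : 0 < s) (hs1 : s < 1) : slobSymbol s 1 < ⊤ := by
  refine lt_of_le_of_lt (b := 49 * slobTail s) ?_
    (ENNReal.mul_lt_top (by norm_num) (slobTail_lt_top hs hs1))
  rw [slobSymbol, slobTail, ← lintegral_const_mul' _ _ (by norm_num)]
  refine lintegral_mono fun h => ?_
  rw [mul_one]
  calc _ ≤ slobWeight s h * (49 * ENNReal.ofReal (min 1 |h|) ^ 2) := by gcongr; exact expDiffSq_le h
    _ = _ := by ring

/-- `e^{2πih} = 1` only at integers, so the integrand is positive on `(0, 1)`. Nonvanishing allows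
division by this constant when passing back from difference quotients to Fourier weights. -/
lemma slobSymbol_one_ne_zero (s : ℝ) : slobSymbol s 1 ≠ 0 := by
  rw [slobSymbol, Ne, lintegral_eq_zero_iff (by
    have := measurable_slobWeight s; have := measurable_expDiffSq; fun_prop)]
  intro h
  have h2 : ∀ᵐ x : ℝ, x ∉ Set.Ioo (0 : ℝ) 1 := by
    filter_upwards [h] with x hx hx1
    simp only [mul_one, Pi.zero_apply, mul_eq_zero] at hx
    rcases hx with hx | hx
    · rw [slobWeight, Set.indicator_of_mem (Set.mem_Ioi.2 hx1.1)] at hx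
      have := Real.rpow_pos_of_pos hx1.1 (-1 - 2 * s)
      rw [ENNReal.ofReal_eq_zero] at hx
      linarith
    · simp only [expDiffSq, ne_eq, OfNat.ofNat_ne_zero, not_false_eq_true, pow_eq_zero_iff,
        enorm_eq_zero, sub_eq_zero] at hx
      rw [Complex.exp_eq_one_iff] at hx
      obtain ⟨n, hn⟩ := hx
      have h3 : (x : ℂ) = n := by
        have hpi : (2 * Real.pi * Complex.I : ℂ) ≠ 0 := Complex.two_pi_I_ne_zero
        apply mul_right_cancel₀ hpi
        rw [← hn]; push_cast; ring
      have h4 : x = n := by exact_mod_cast h3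
      rw [h4] at hx1
      have h5 : (0 : ℤ) < n := by exact_mod_cast hx1.1
      have h6 : n < (1 : ℤ) := by exact_mod_cast hx1.2
      omega
  have h3 : volume (Set.Ioo (0 : ℝ) 1) = 0 := by
    have : Set.Ioo (0 : ℝ) 1 = {x | ¬ (x ∉ Set.Ioo (0 : ℝ) 1)} := by ext; simp
    rw [this]; exact h2
  simp at h3

lemma lintegral_comp_mul {r : ℝ} (hr : 0 < r) (w : ℝ → ℝ≥0∞) :
    ∫⁻ x, w (r * x) = (ENNReal.ofReal r)⁻¹ * ∫⁻ y, w y := by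
  have h1 := lintegral_comp_affine_le hr.ne' 0 w
  have h2 := lintegral_comp_affine_le (inv_pos.2 hr).ne' 0 (fun x => w (r * x))
  simp only [zero_add, abs_of_pos hr, abs_of_pos (inv_pos.2 hr), mul_inv_cancel_left₀ hr.ne'] at h1 h2
  refine le_antisymm h1 ?_
  rw [ENNReal.ofReal_inv_of_pos hr, inv_inv] at h2
  have h0 : ENNReal.ofReal r ≠ 0 := by simpa using hr
  rw [← ENNReal.div_eq_inv_mul]
  exact ENNReal.div_le_of_le_mul' h2

/-- Scaling `h ↦ |ξ|h`: the weight is homogeneous of degree `-1 - 2s`, and one power is returned by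
the Jacobian. -/
lemma slobSymbol_eq {s : ℝ} (hs : 0 < s) (ξ : ℝ) :
    slobSymbol s ξ = ENNReal.ofReal (|ξ| ^ (2 * s)) * slobSymbol s 1 := by
  by_cases hξ : ξ = 0
  · have : (0 : ℝ) ^ (2 * s) = 0 := Real.zero_rpow (by positivity)
    simp [hξ, slobSymbol, expDiffSq, this]
  have hr : 0 < |ξ| := abs_pos.2 hξ
  have h1 : ∀ h, slobWeight s h * expDiffSq (h * ξ) =
      ENNReal.ofReal (|ξ| ^ (1 + 2 * s)) * (slobWeight s (|ξ| * h) * expDiffSq (|ξ| * h * 1)) := by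
    intro h
    by_cases h0 : 0 < h
    · have h2 : 0 < |ξ| * h := by positivity
      rw [slobWeight, slobWeight, Set.indicator_of_mem (Set.mem_Ioi.2 h0),
        Set.indicator_of_mem (Set.mem_Ioi.2 h2), ← expDiffSq_abs (h * ξ), abs_mul, abs_of_pos h0,
        mul_one, mul_comm h, ← mul_assoc, ← ENNReal.ofReal_mul (by positivity)]
      congr 2
      rw [Real.mul_rpow hr.le h0.le, ← mul_assoc, ← Real.rpow_add hr]
      simp
    · have h2 : ¬ 0 < |ξ| * h := by
        rw [mul_pos_iff_of_pos_left hr]; exact h0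
      rw [slobWeight, slobWeight, Set.indicator_of_notMem (by simpa using h0),
        Set.indicator_of_notMem (by simpa using h2)]
      simp
  rw [slobSymbol]
  simp_rw [h1]
  rw [lintegral_const_mul' _ _ ENNReal.ofReal_ne_top,
    lintegral_comp_mul hr (fun y => slobWeight s y * expDiffSq (y * 1)), ← mul_assoc,
    ← ENNReal.ofReal_inv_of_pos hr, ← ENNReal.ofReal_mul (by positivity)]
  congr 2
  rw [← Real.rpow_neg_one, ← Real.rpow_add hr]
  congr 1; ring

lemma memLp_translate {f : Plane → ℂ} {p : ℝ≥0∞} (hf : MemLp f p volume) (a : Plane) :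
    MemLp (fun x => f (x + a)) p volume :=
  hf.comp_measurePreserving (measurePreserving_add_right volume a)

lemma lintegral_fourier_sq {z : 𝓢'(Plane, ℂ)} {V H : Plane → ℂ} (hz : IsFun z V)
    (hH : IsFun (𝓕 z) H) (hV : MemLp V 2 volume) : ∫⁻ ζ, ‖H ζ‖ₑ ^ 2 = ∫⁻ x, ‖V x‖ₑ ^ 2 := by
  rw [← eLpNorm_two_sq, ← eLpNorm_two_sq, eLpNorm_fourier_eq hz hH hV]

lemma lintegral_translate_sub_sq {z : 𝓢'(Plane, ℂ)} {V H : Plane → ℂ} (hz : IsFun z V)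
    (hH : IsFun (𝓕 z) H) (hV : MemLp V 2 volume) (h : ℝ) :
    ∫⁻ x, ‖V (x + h • e₁) - V x‖ₑ ^ 2 = ∫⁻ ζ, expDiffSq (h * ζ.fst) * ‖H ζ‖ₑ ^ 2 := by
  have hT := memLp_translate hV (h • e₁)
  obtain ⟨w, hw⟩ := exists_isFun_of_memLp hT
  have hwF := hz.fourier_translate hH (h • e₁) hw
  have h1 := hw.add (hz.const_smul (-1))
  have h2 : IsFun (𝓕 (w + (-1 : ℂ) • z)) (fun ζ =>
      Complex.exp (↑(2 * Real.pi * inner ℝ (h • e₁) ζ) * Complex.I) * H ζ + (-1) * H ζ) := by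
    rw [FourierTransform.fourier_add, FourierTransform.fourier_smul]
    exact hwF.add (hH.const_smul (-1))
  have h3 := lintegral_fourier_sq h1 h2 (hT.add (hV.const_mul (-1)))
  simp only [neg_one_mul, ← sub_eq_add_neg] at h3
  rw [← h3]
  refine lintegral_congr fun ζ => ?_
  rw [expDiffSq, ← mul_pow, ← enorm_mul, sub_mul, one_mul, inner_smul_left, inner_e₁]
  rfl

/-- Plancherel for each difference `V(· + h e₁) - V`, then Tonelli in `h`. It expresses the
homogeneous Sobolev norm in `x` through differences, to which the product rule applies. -/
lemma lintegral_slob_eq {z : 𝓢'(Plane, ℂ)} {V H : Plane → ℂ} (hz : IsFun z V)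
    (hH : IsFun (𝓕 z) H) (hHm : Measurable H) (hV : MemLp V 2 volume) {s : ℝ} (hs : 0 < s) :
    ∫⁻ h, slobWeight s h * ∫⁻ x, ‖V (x + h • e₁) - V x‖ₑ ^ 2 =
      slobSymbol s 1 * ∫⁻ ζ : Plane, ENNReal.ofReal (|ζ.fst| ^ (2 * s)) * ‖H ζ‖ₑ ^ 2 := by
  have hm1 := measurable_slobWeight s
  have hm2 := measurable_expDiffSq
  have hm3 := measurable_plane_fst
  have hm : Measurable fun q : ℝ × Plane => slobWeight s q.1 * (expDiffSq (q.1 * q.2.fst) * ‖H q.2‖ₑ ^ 2) := by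
    have : Measurable fun q : ℝ × Plane => q.2.fst := hm3.comp measurable_snd
    fun_prop
  simp_rw [lintegral_translate_sub_sq hz hH hV]
  have h1 : ∀ h, slobWeight s h * ∫⁻ ζ : Plane, expDiffSq (h * ζ.fst) * ‖H ζ‖ₑ ^ 2 =
      ∫⁻ ζ : Plane, slobWeight s h * (expDiffSq (h * ζ.fst) * ‖H ζ‖ₑ ^ 2) := by
    intro h
    rw [lintegral_const_mul]
    fun_prop
  simp_rw [h1]
  rw [lintegral_lintegral_swap hm.aemeasurable, ← lintegral_const_mul _ (by fun_prop)]
  refine lintegral_congr fun ζ => ?_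
  have h2 : ∀ h, slobWeight s h * (expDiffSq (h * ζ.fst) * ‖H ζ‖ₑ ^ 2) =
      slobWeight s h * expDiffSq (h * ζ.fst) * ‖H ζ‖ₑ ^ 2 := fun h => by ring
  simp_rw [h2]
  rw [lintegral_mul_const _ (by fun_prop), ← slobSymbol, slobSymbol_eq hs]
  ring

lemma add_sq_le_four (a b : ℝ≥0∞) : (a + b) ^ 2 ≤ 4 * (a ^ 2 + b ^ 2) := by
  have h : a + b ≤ 2 * max a b := by
    rw [two_mul]; exact add_le_add (le_max_left _ _) (le_max_right _ _)
  calc (a + b) ^ 2 ≤ (2 * max a b) ^ 2 := pow_le_pow_left₀ zero_le h 2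
    _ = 4 * (max a b) ^ 2 := by rw [mul_pow]; norm_num
    _ ≤ _ := by
      gcongr
      rcases max_choice a b with h | h <;> rw [h]
      · exact le_add_right le_rfl
      · exact le_add_left le_rfl

/-- Multiplication by a bounded function that is Lipschitz in `x` is bounded on `L²_t H^s_x`,
`0 ≤ s < 1`. -/
lemma exists_low_mul_bound {s : ℝ} (hs : 0 ≤ s) (hs1 : s < 1) : ∃ C : ℝ, 0 < C ∧
    ∀ (u z : 𝓢'(Plane, ℂ)) (U F g H : Plane → ℂ) (B : ℝ), IsFun u U → IsFun (𝓕 u) F →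
      MemLp U 2 volume → Measurable F → Measurable g → Measurable H → (∀ p, ‖g p‖ ≤ B) →
      (∀ h p, |h| ≤ 1 → ‖g (p + h • e₁) - g p‖ ≤ B * |h|) →
      IsFun z (fun p => U p * g p) → IsFun (𝓕 z) H →
      ∫⁻ ζ : Plane, ENNReal.ofReal (jb (2 * Real.pi * ζ.fst) ^ s) ^ 2 * ‖H ζ‖ₑ ^ 2 ≤
        ENNReal.ofReal C * ENNReal.ofReal B ^ 2 *
          ∫⁻ ζ : Plane, ENNReal.ofReal (jb (2 * Real.pi * ζ.fst) ^ s) ^ 2 * ‖F ζ‖ₑ ^ 2 := by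
  -- The numbers come from `⟨2πξ⟩^{2s} ≤ 1 + 49|ξ|^{2s}` and the two terms with constants 4 and 16
  -- below: `197 = 1 + 49 · 4` and `784 = 49 · 16`. For `s = 0` Plancherel suffices and `C = 1`.
  obtain ⟨C, hC, hκ⟩ : ∃ C : ℝ, 0 < C ∧ (0 < s → 784 * (slobTail s / slobSymbol s 1) + 197 ≤
      ENNReal.ofReal C ∧ slobSymbol s 1 < ⊤) ∧ 1 ≤ ENNReal.ofReal C := by
    rcases hs.eq_or_lt with h0 | h0
    · exact ⟨1, one_pos, fun h => absurd h (by simp [← h0]), by simp⟩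
    · have hfin : 784 * (slobTail s / slobSymbol s 1) + 197 < ⊤ :=
        ENNReal.add_lt_top.2 ⟨ENNReal.mul_lt_top (by norm_num)
          (ENNReal.div_lt_top (slobTail_lt_top h0 hs1).ne (slobSymbol_one_ne_zero s)), by norm_num⟩
      have h1 : 1 ≤ 784 * (slobTail s / slobSymbol s 1) + 197 :=
        le_add_left (by norm_num)
      refine ⟨(784 * (slobTail s / slobSymbol s 1) + 197).toReal,
        ENNReal.toReal_pos (by positivity) hfin.ne,
        fun _ => ⟨(ENNReal.ofReal_toReal hfin.ne).ge, slobSymbol_one_lt_top h0 hs1⟩, ?_⟩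
      rwa [ENNReal.ofReal_toReal hfin.ne]
  refine ⟨C, hC, fun u z U F g H B hU hF hU2 hFm hgm hHm hgB hgL hz hH => ?_⟩
  have hB : 0 ≤ B := (norm_nonneg _).trans (hgB 0)
  have hV2 : MemLp (fun p => U p * g p) 2 volume := by
    refine (hU2.const_mul (B : ℂ)).of_le (hU2.1.mul hgm.aestronglyMeasurable)
      (ae_of_all _ fun p => ?_)
    rw [norm_mul, norm_mul, Complex.norm_real, Real.norm_of_nonneg hB, mul_comm]
    gcongr
    exact hgB p
  have hgB' : ∀ p, ‖g p‖ₑ ≤ ENNReal.ofReal B := fun p => by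
    rw [← ofReal_norm]; exact ENNReal.ofReal_le_ofReal (hgB p)
  have hH0 : ∫⁻ ζ, ‖H ζ‖ₑ ^ 2 ≤ ENNReal.ofReal B ^ 2 * ∫⁻ ζ, ‖F ζ‖ₑ ^ 2 := by
    rw [lintegral_fourier_sq hz hH hV2, lintegral_fourier_sq hU hF hU2,
      ← lintegral_const_mul' _ _ (ENNReal.pow_ne_top ENNReal.ofReal_ne_top)]
    refine lintegral_mono fun p => ?_
    rw [enorm_mul, mul_pow, mul_comm]
    gcongr
    exact hgB' p
  rcases hs.eq_or_lt with h0 | h0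
  · simp only [← h0, Real.rpow_zero, ENNReal.ofReal_one, one_pow, one_mul]
    refine hH0.trans ?_
    rw [mul_assoc]
    exact le_mul_of_one_le_left zero_le hκ.2
  obtain ⟨hκ1, hκfin⟩ := hκ.1 h0
  set κ := slobSymbol s 1
  have hκ0 : κ ≠ 0 := slobSymbol_one_ne_zero s
  set j : Plane → ℝ≥0∞ := fun ζ => ENNReal.ofReal (jb (2 * Real.pi * ζ.fst) ^ s) ^ 2 with hj
  set m : Plane → ℝ≥0∞ := fun ζ => ENNReal.ofReal (|ζ.fst| ^ (2 * s)) with hm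
  have hjm : Measurable j := by
    have := (continuous_jb_rpow s).measurable.comp (measurable_plane_fst.const_mul (2 * Real.pi))
    exact this.ennreal_ofReal.pow_const 2
  have hmm : Measurable m := by have := measurable_plane_fst; fun_prop
  have hjeq : ∀ ζ, j ζ = ENNReal.ofReal ((1 + (2 * Real.pi * ζ.fst) ^ 2) ^ s) := by
    intro ζ
    rw [hj]
    simp only
    rw [← ENNReal.ofReal_pow (Real.rpow_nonneg (jb_pos _).le _), ← Real.rpow_natCast,
      ← Real.rpow_mul (jb_pos _).le, mul_comm s, Real.rpow_mul (jb_pos _).le, Real.rpow_natCast, jb_sq]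
  have h1j : ∀ ζ, 1 ≤ j ζ := fun ζ => by
    rw [hjeq, ENNReal.one_le_ofReal]
    exact Real.one_le_rpow (by nlinarith [sq_nonneg (2 * Real.pi * ζ.fst)]) hs
  have hsqrpow : ∀ x : ℝ, (x ^ 2) ^ s = |x| ^ (2 * s) := fun x => by
    rw [← sq_abs, ← Real.rpow_natCast, ← Real.rpow_mul (abs_nonneg x)]; norm_num
  have hmj : ∀ ζ, m ζ ≤ j ζ := fun ζ => by
    rw [hjeq, hm]
    apply ENNReal.ofReal_le_ofReal
    rw [← hsqrpow]
    apply Real.rpow_le_rpow (by positivity) _ hs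
    rw [mul_pow]
    nlinarith [sq_nonneg ζ.fst, one_le_pow₀ (n := 2) one_le_two_pi]
  have hjle : ∀ ζ, j ζ ≤ 1 + 49 * m ζ := fun ζ => by
    rw [hjeq, hm, show (1 : ℝ≥0∞) = ENNReal.ofReal 1 by simp,
      show (49 : ℝ≥0∞) = ENNReal.ofReal 49 by simp]
    simp only
    rw [← ENNReal.ofReal_mul (by norm_num), ← ENNReal.ofReal_add (by norm_num) (by positivity)]
    apply ENNReal.ofReal_le_ofReal
    refine (Real.rpow_add_le_add_rpow zero_le_one (sq_nonneg _) hs hs1.le).trans ?_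
    rw [Real.one_rpow, hsqrpow, abs_mul, Real.mul_rpow (abs_nonneg _) (abs_nonneg _)]
    gcongr
    rw [abs_of_pos (by positivity)]
    calc (2 * Real.pi) ^ (2 * s) ≤ (2 * Real.pi) ^ (2 : ℝ) :=
          Real.rpow_le_rpow_of_exponent_le one_le_two_pi (by linarith)
      _ = (2 * Real.pi) ^ 2 := by norm_cast
      _ ≤ 7 ^ 2 := by gcongr; exact two_pi_le
      _ = 49 := by norm_num
  set b := ENNReal.ofReal B ^ 2
  have hb : b ≠ ⊤ := ENNReal.pow_ne_top ENNReal.ofReal_ne_top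
  have hfirst : κ * ∫⁻ ζ, m ζ * ‖H ζ‖ₑ ^ 2 ≤
      4 * b * (κ * ∫⁻ ζ, m ζ * ‖F ζ‖ₑ ^ 2) + 16 * b * slobTail s * ∫⁻ ζ, ‖F ζ‖ₑ ^ 2 := by
    rw [← lintegral_slob_eq hz hH hHm hV2 h0, ← lintegral_slob_eq hU hF hFm hU2 h0, slobTail]
    -- Discrete product rule: the difference falls on `U`, costing `sup |g|`, or on `g`, costing `2B
    -- min(1, |h|)` by the Lipschitz bound for small `h` and the sup bound for large `h`.
    have hpt : ∀ h x, ‖U (x + h • e₁) * g (x + h • e₁) - U x * g x‖ₑ ^ 2 ≤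
        4 * b * ‖U (x + h • e₁) - U x‖ₑ ^ 2 + 16 * b * ENNReal.ofReal (min 1 |h|) ^ 2 * ‖U x‖ₑ ^ 2 := by
      intro h x
      have hd : ‖g (x + h • e₁) - g x‖ₑ ≤ ENNReal.ofReal (2 * B * min 1 |h|) := by
        rw [← ofReal_norm]
        apply ENNReal.ofReal_le_ofReal
        rcases le_total 1 |h| with hh | hh
        · rw [min_eq_left hh]
          linarith [norm_sub_le (g (x + h • e₁)) (g x), hgB x, hgB (x + h • e₁)]
        · rw [min_eq_right hh]
          have := hgL h x hh
          nlinarith [mul_nonneg hB (abs_nonneg h)]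
      have hdec : U (x + h • e₁) * g (x + h • e₁) - U x * g x =
          (U (x + h • e₁) - U x) * g (x + h • e₁) + U x * (g (x + h • e₁) - g x) := by ring
      rw [hdec]
      calc _ ≤ (‖(U (x + h • e₁) - U x) * g (x + h • e₁)‖ₑ + ‖U x * (g (x + h • e₁) - g x)‖ₑ) ^ 2 :=
            pow_le_pow_left₀ zero_le (enorm_add_le _ _) 2
        _ ≤ 4 * (‖(U (x + h • e₁) - U x) * g (x + h • e₁)‖ₑ ^ 2 +
              ‖U x * (g (x + h • e₁) - g x)‖ₑ ^ 2) := add_sq_le_four _ _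
        _ ≤ 4 * (‖U (x + h • e₁) - U x‖ₑ ^ 2 * ENNReal.ofReal B ^ 2 +
              ‖U x‖ₑ ^ 2 * ENNReal.ofReal (2 * B * min 1 |h|) ^ 2) := by
            rw [enorm_mul, enorm_mul, mul_pow, mul_pow]
            gcongr
            exact hgB' _
        _ = _ := by
            rw [ENNReal.ofReal_mul (by positivity), ENNReal.ofReal_mul (by norm_num)]
            simp only [ENNReal.ofReal_ofNat, b]
            ring
    calc _ ≤ ∫⁻ h, slobWeight s h * (4 * b * (∫⁻ x, ‖U (x + h • e₁) - U x‖ₑ ^ 2) +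
          16 * b * ENNReal.ofReal (min 1 |h|) ^ 2 * ∫⁻ x, ‖U x‖ₑ ^ 2) := by
          refine lintegral_mono fun h => mul_le_mul_right ?_ _
          refine (lintegral_mono (hpt h)).trans (le_of_eq ?_)
          rw [lintegral_add_right' _ (hU2.1.enorm.pow_const 2 |>.const_mul _),
            lintegral_const_mul' _ _ (ENNReal.mul_ne_top (by norm_num) hb),
            lintegral_const_mul' _ _ (ENNReal.mul_ne_top (ENNReal.mul_ne_top (by norm_num) hb)
              (ENNReal.pow_ne_top ENNReal.ofReal_ne_top))]
      _ = ∫⁻ h, (4 * b * (slobWeight s h * ∫⁻ x, ‖U (x + h • e₁) - U x‖ₑ ^ 2) +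
          16 * b * (∫⁻ x, ‖U x‖ₑ ^ 2) * (slobWeight s h * ENNReal.ofReal (min 1 |h|) ^ 2)) := by
          refine lintegral_congr fun h => ?_
          ring
      _ = _ := by
          have hms := measurable_slobWeight s
          rw [lintegral_add_right _ (by fun_prop),
            lintegral_const_mul' _ _ (ENNReal.mul_ne_top (by norm_num) hb),
            lintegral_const_mul _ (by fun_prop), lintegral_fourier_sq hU hF hU2]
          ring
  have hsecond : ∫⁻ ζ, m ζ * ‖H ζ‖ₑ ^ 2 ≤
      4 * b * (∫⁻ ζ, m ζ * ‖F ζ‖ₑ ^ 2) + 16 * b * (slobTail s / κ) * ∫⁻ ζ, ‖F ζ‖ₑ ^ 2 := by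
    have : ∫⁻ ζ, m ζ * ‖H ζ‖ₑ ^ 2 ≤ (4 * b * (κ * ∫⁻ ζ, m ζ * ‖F ζ‖ₑ ^ 2) +
        16 * b * slobTail s * ∫⁻ ζ, ‖F ζ‖ₑ ^ 2) / κ := by
      rw [ENNReal.le_div_iff_mul_le (Or.inl hκ0) (Or.inl hκfin.ne), mul_comm]
      exact hfirst
    refine this.trans (le_of_eq ?_)
    rw [ENNReal.add_div]
    congr 1
    · rw [mul_left_comm, mul_comm κ, ENNReal.mul_div_cancel_right hκ0 hκfin.ne]
    · simp only [div_eq_mul_inv]; ring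
  have hFj : ∫⁻ ζ, ‖F ζ‖ₑ ^ 2 ≤ ∫⁻ ζ, j ζ * ‖F ζ‖ₑ ^ 2 :=
    lintegral_mono fun ζ => le_mul_of_one_le_left zero_le (h1j ζ)
  have hmFj : ∫⁻ ζ, m ζ * ‖F ζ‖ₑ ^ 2 ≤ ∫⁻ ζ, j ζ * ‖F ζ‖ₑ ^ 2 :=
    lintegral_mono fun ζ => mul_le_mul_left (hmj ζ) _
  set I := ∫⁻ ζ, j ζ * ‖F ζ‖ₑ ^ 2
  calc ∫⁻ ζ, j ζ * ‖H ζ‖ₑ ^ 2 ≤ ∫⁻ ζ, (‖H ζ‖ₑ ^ 2 + 49 * (m ζ * ‖H ζ‖ₑ ^ 2)) := by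
        refine lintegral_mono fun ζ => ?_
        refine (mul_le_mul_left (hjle ζ) _).trans (le_of_eq ?_)
        ring
    _ = (∫⁻ ζ, ‖H ζ‖ₑ ^ 2) + 49 * ∫⁻ ζ, m ζ * ‖H ζ‖ₑ ^ 2 := by
        rw [lintegral_add_left (by fun_prop), lintegral_const_mul _ (by fun_prop)]
    _ ≤ b * I + 49 * (4 * b * I + 16 * b * (slobTail s / κ) * I) := by
        refine add_le_add (hH0.trans (by gcongr)) (mul_le_mul_right (hsecond.trans ?_) _)
        gcongr
    _ = (784 * (slobTail s / κ) + 197) * b * I := by ring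
    _ ≤ _ := by gcongr

/-! ### Dyadic pieces -/

lemma eta_eq_zero_of_lt {η₀ : ℝ → ℝ} (hη : IsCutoff η₀) {j : ℕ} {y : ℝ} (h : 8 / 5 * 2 ^ j < |y|) :
    eta η₀ j y = 0 := by
  cases j with
  | zero => exact hη.eq_zero (by simpa using h)
  | succ k =>
    have hp : (0 : ℝ) < 2 ^ k := by positivity
    rw [pow_succ] at h
    simp only [eta]
    rw [hη.eq_zero, hη.eq_zero, sub_zero]
    · rw [abs_div, abs_of_pos hp, lt_div_iff₀ hp]; linarith
    · rw [abs_div, pow_succ, abs_of_pos (by positivity : (0 : ℝ) < 2 ^ k * 2),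
        lt_div_iff₀ (by positivity)]
      linarith

/-- Inside the annulus, `|y| < (5/8)2^{k+1} = (5/4)2^k`, so both dilated cutoffs equal 1 and cancel.
-/
lemma eta_succ_eq_zero {η₀ : ℝ → ℝ} (hη : IsCutoff η₀) {k : ℕ} {y : ℝ}
    (h : y ∉ annulus (2 ^ (k + 1))) : eta η₀ (k + 1) y = 0 := by
  by_cases h1 : 8 / 5 * 2 ^ (k + 1) < |y|
  · exact eta_eq_zero_of_lt hη h1
  · have h2 : |y| < 5 / 8 * 2 ^ (k + 1) := by
      by_contra h3
      exact h ⟨not_lt.1 h3, not_lt.1 h1⟩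
    have hp : (0 : ℝ) < 2 ^ k := by positivity
    rw [pow_succ] at h2
    simp only [eta]
    rw [hη.eq_one_of_abs_le, hη.eq_one_of_abs_le, sub_self]
    · rw [abs_div, abs_of_pos hp, div_le_iff₀ hp]; linarith
    · rw [abs_div, pow_succ, abs_of_pos (by positivity : (0 : ℝ) < 2 ^ k * 2),
        div_le_iff₀ (by positivity)]
      linarith

/-- The sum telescopes. -/
lemma sum_eta (η₀ : ℝ → ℝ) (m : ℕ) (x : ℝ) :
    ∑ k ∈ Finset.range (m + 1), eta η₀ k x = η₀ (x / 2 ^ m) := by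
  induction m with
  | zero => simp [eta]
  | succ m ih => rw [Finset.sum_range_succ, ih]; simp [eta]

lemma IsCutoff.eventually_eq_one {η₀ : ℝ → ℝ} (hη : IsCutoff η₀) (x : ℝ) :
    ∀ᶠ m : ℕ in atTop, η₀ (x / 2 ^ m) = 1 := by
  have h : Tendsto (fun m : ℕ => (2 : ℝ) ^ m) atTop atTop :=
    tendsto_pow_atTop_atTop_of_one_lt (by norm_num)
  filter_upwards [h.eventually_ge_atTop |x|] with m hm
  apply hη.eq_one_of_abs_le
  have hp : (0 : ℝ) < 2 ^ m := by positivity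
  rw [abs_div, abs_of_pos hp, div_le_iff₀ hp]
  linarith

lemma IsCutoff.norm_le_one {η₀ : ℝ → ℝ} (hη : IsCutoff η₀) (x : ℝ) : ‖((η₀ x : ℝ) : ℂ)‖ ≤ 1 := by
  rw [Complex.norm_real, Real.norm_of_nonneg (hη.mem_Icc x).1]
  exact (hη.mem_Icc x).2

lemma continuous_eta {η₀ : ℝ → ℝ} (hη : IsCutoff η₀) (j : ℕ) : Continuous (eta η₀ j) := by
  have := hη.smooth.continuous
  cases j with
  | zero => exact this
  | succ k => simp only [eta]; fun_prop

lemma enorm_le_tsum_eta {η₀ : ℝ → ℝ} (hη : IsCutoff η₀) (y : ℝ) (c : ℂ) :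
    ‖c‖ₑ ≤ ∑' j, ‖((eta η₀ j y : ℝ) : ℂ) * c‖ₑ := by
  obtain ⟨m, hm⟩ := (hη.eventually_eq_one y).exists
  have h1 : c = ∑ k ∈ Finset.range (m + 1), ((eta η₀ k y : ℝ) : ℂ) * c := by
    rw [← Finset.sum_mul, ← Complex.ofReal_sum, sum_eta, hm]; simp
  calc ‖c‖ₑ = ‖∑ k ∈ Finset.range (m + 1), ((eta η₀ k y : ℝ) : ℂ) * c‖ₑ := by rw [← h1]
    _ ≤ ∑ k ∈ Finset.range (m + 1), ‖((eta η₀ k y : ℝ) : ℂ) * c‖ₑ := enorm_sum_le _ _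
    _ ≤ _ := ENNReal.sum_le_tsum _

lemma fourier_P (η₀ : ℝ → ℝ) (k : ℕ) (u : 𝓢'(Plane, ℂ)) :
    𝓕 (P η₀ k u) = TemperedDistribution.smulLeftCLM ℂ
      (fun ζ : Plane => ((eta η₀ k (2 * Real.pi * ζ.fst) : ℝ) : ℂ)) (𝓕 u) := by
  rw [P, TemperedDistribution.fourierMultiplierCLM_apply, FourierTransform.fourier_fourierInv_eq]

lemma IsFun.fourier_P {η₀ : ℝ → ℝ} (hη : IsCutoff η₀) {u : 𝓢'(Plane, ℂ)} {F : Plane → ℂ}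
    (hF : IsFun (𝓕 u) F) (k : ℕ) :
    IsFun (𝓕 (P η₀ k u)) fun ζ => ((eta η₀ k (2 * Real.pi * ζ.fst) : ℝ) : ℂ) * F ζ := by
  rw [NLSKdV.fourier_P]
  exact hF.smulLeft (hasTemperateGrowth_eta hη k)

lemma IsFun.fourier_Ple {η₀ : ℝ → ℝ} (hη : IsCutoff η₀) {u : 𝓢'(Plane, ℂ)} {F : Plane → ℂ}
    (hF : IsFun (𝓕 u) F) (m : ℕ) :
    IsFun (𝓕 (Ple η₀ m u)) fun ζ => ((η₀ (2 * Real.pi * ζ.fst / 2 ^ m) : ℝ) : ℂ) * F ζ := by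
  have h1 : 𝓕 (Ple η₀ m u) = ∑ k ∈ Finset.range (m + 1), 𝓕 (P η₀ k u) :=
    map_sum (FourierTransform.fourierCLM ℂ 𝓢'(Plane, ℂ)) _ _
  rw [h1]
  have := IsFun.sum (Finset.range (m + 1)) fun k _ => hF.fourier_P hη k
  refine this.congr (ae_of_all _ fun ζ => ?_)
  simp only
  rw [← Finset.sum_mul, ← Complex.ofReal_sum, sum_eta]

/-- The Fourier transform of `P_k v` lives on the annulus of radius `2^k`. -/
lemma IsFun.ae_eq_zero_of_fourier_P {η₀ : ℝ → ℝ} (hη : IsCutoff η₀) {k : ℕ} {v : 𝓢'(Plane, ℂ)}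
    {G : Plane → ℂ} (hG : IsFun (𝓕 (P η₀ (k + 1) v)) G) :
    ∀ᵐ ζ : Plane, 2 * Real.pi * ζ.fst ∉ annulus (2 ^ (k + 1)) → G ζ = 0 := by
  have hO : IsOpen {ζ : Plane | 2 * Real.pi * ζ.fst ∉ annulus (2 ^ (k + 1))} := by
    have hc : IsClosed (annulus (2 ^ (k + 1))) :=
      (isClosed_le continuous_const continuous_abs).inter
        (isClosed_le continuous_abs continuous_const)
    exact hc.isOpen_compl.preimage (by fun_prop : Continuous fun ζ : Plane => 2 * Real.pi * ζ.fst)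
  refine hO.ae_eq_zero_of_integral_contDiff_smul_eq_zero (hG.locallyIntegrable.locallyIntegrableOn _)
    fun g hg hgc hgs => ?_
  obtain ⟨φ, hφ⟩ := exists_schwartz_of_contDiff hg hgc
  have h1 := (hG φ).2
  -- The Fourier transform of `v` need not be a function, so the support is found by duality: the
  -- symbol annihilates every test function supported off the annulus.
  have h2 : SchwartzMap.smulLeftCLM ℂ
      (fun ζ : Plane => ((eta η₀ (k + 1) (2 * Real.pi * ζ.fst) : ℝ) : ℂ)) φ = 0 := by
    ext ζ
    rw [SchwartzMap.smulLeftCLM_apply_apply (hasTemperateGrowth_eta hη (k + 1)), hφ]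
    by_cases h : 2 * Real.pi * ζ.fst ∈ annulus (2 ^ (k + 1))
    · have : g ζ = 0 := by
        by_contra h0
        exact hgs (subset_tsupport g h0) h
      simp [this]
    · simp [eta_succ_eq_zero hη h]
  have h3 : (𝓕 (P η₀ (k + 1) v)) φ = 0 := by
    rw [NLSKdV.fourier_P]
    exact (congrArg (fun φ => (𝓕 v : 𝓢'(Plane, ℂ)) φ) h2).trans (map_zero (𝓕 v : 𝓢'(Plane, ℂ)))
  rw [← h3, h1]
  refine integral_congr_ae (ae_of_all _ fun ζ => ?_)
  simp only [hφ, Complex.real_smul, mul_comm]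

/-! ### The triangle inequality in `L²` for non-negative functions -/

/-- The `L²` norm of a non-negative function. -/
def lTwo (f : Plane → ℝ≥0∞) : ℝ≥0∞ := (∫⁻ x, f x ^ 2) ^ (1 / 2 : ℝ)

lemma lTwo_sq (f : Plane → ℝ≥0∞) : lTwo f ^ 2 = ∫⁻ x, f x ^ 2 := by
  rw [lTwo, ← ENNReal.rpow_natCast, ← ENNReal.rpow_mul]; norm_num

lemma lTwo_mono {f g : Plane → ℝ≥0∞} (h : ∀ x, f x ≤ g x) : lTwo f ≤ lTwo g := by
  unfold lTwo
  gcongr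
  exact h _

lemma lTwo_le_of_sq_le {f : Plane → ℝ≥0∞} {c : ℝ≥0∞} (h : ∫⁻ x, f x ^ 2 ≤ c ^ 2) : lTwo f ≤ c := by
  rwa [← ENNReal.pow_le_pow_left_iff two_ne_zero, lTwo_sq]

lemma lTwo_add_le {f g : Plane → ℝ≥0∞} (hf : Measurable f) (hg : Measurable g) :
    lTwo (fun x => f x + g x) ≤ lTwo f + lTwo g := by
  have := ENNReal.lintegral_Lp_add_le (p := 2) hf.aemeasurable hg.aemeasurable (μ := volume)
    (by norm_num)
  simpa [lTwo] using this

lemma lTwo_tsum_le {f : ℕ → Plane → ℝ≥0∞} (hf : ∀ j, Measurable (f j)) :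
    lTwo (fun x => ∑' j, f j x) ≤ ∑' j, lTwo (f j) := by
  have hfin : ∀ n, lTwo (fun x => ∑ j ∈ Finset.range n, f j x) ≤ ∑ j ∈ Finset.range n, lTwo (f j) := by
    intro n
    induction n with
    | zero => simp [lTwo]
    | succ n ih =>
      simp only [Finset.sum_range_succ]
      refine (lTwo_add_le (Finset.measurable_sum _ fun j _ => hf j) (hf n)).trans ?_
      gcongr
  refine lTwo_le_of_sq_le ?_
  have h1 : ∀ x, (∑' j, f j x) ^ 2 = ⨆ n, (∑ j ∈ Finset.range n, f j x) ^ 2 := by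
    intro x
    rw [ENNReal.tsum_eq_iSup_nat, ENNReal.iSup_pow]
  simp_rw [h1]
  rw [lintegral_iSup]
  · refine iSup_le fun n => ?_
    rw [← lTwo_sq]
    gcongr
    exact (hfin n).trans (ENNReal.sum_le_tsum _)
  · intro n
    exact (Finset.measurable_sum _ fun j _ => hf j).pow_const 2
  · intro a b hab x
    simp only
    gcongr

/-! ### Consequences of a finite `F̄^s` norm -/

/-- The norm `∑_j 2^{j/2} ‖η_j(τ - ξ³) f‖_{L²}` in normalized frequency variables. -/
def yNorm (η₀ : ℝ → ℝ) (G : Plane → ℂ) : ℝ≥0∞ :=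
  ∑' j : ℕ, (2 : ℝ≥0∞) ^ ((j : ℝ) / 2) * lTwo fun ζ =>
    ‖((eta η₀ j (2 * Real.pi * ζ.snd - hAiry (2 * Real.pi * ζ.fst)) : ℝ) : ℂ) * G ζ‖ₑ

lemma measurable_eta_mod {η₀ : ℝ → ℝ} (hη : IsCutoff η₀) (j : ℕ) : Measurable fun ζ : Plane =>
    ((eta η₀ j (2 * Real.pi * ζ.snd - hAiry (2 * Real.pi * ζ.fst)) : ℝ) : ℂ) := by
  refine Complex.measurable_ofReal.comp ((continuous_eta hη j).measurable.comp ?_)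
  unfold hAiry
  fun_prop

lemma yNorm_le_YPieceNorm {η₀ : ℝ → ℝ} {k : ℕ} {v : 𝓢'(Plane, ℂ)} {G : Plane → ℂ}
    (hG : IsFun (𝓕 (P η₀ k v)) G) : yNorm η₀ G ≤ YPieceNorm η₀ hAiry k v := by
  refine le_iInf₂ fun f hf => ?_
  refine ENNReal.tsum_le_tsum fun j => mul_le_mul_right (lTwo_le_of_sq_le ?_) _
  rw [eLpNorm_two_sq, lintegral_comp_two_pi (fun p =>
    ‖((eta η₀ j (p.snd - hAiry p.fst) : ℝ) : ℂ) * f p‖ₑ ^ 2)]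
  refine le_trans (le_of_eq (lintegral_congr_ae ?_)) (le_mul_of_one_le_left zero_le
      (ENNReal.one_le_ofReal.2 (one_le_pow₀ one_le_two_pi)))
  have hae : (fun ζ : Plane => f ((2 * Real.pi) • ζ)) =ᵐ[volume] G := IsFun.ae_eq hf hG
  filter_upwards [hae] with ζ hζ
  rw [← hζ]
  simp

lemma lTwo_le_yNorm {η₀ : ℝ → ℝ} (hη : IsCutoff η₀) {G : Plane → ℂ} (hG : Measurable G) :
    lTwo (fun ζ => ‖G ζ‖ₑ) ≤ yNorm η₀ G := by
  refine (lTwo_mono fun ζ => enorm_le_tsum_eta hη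
    (2 * Real.pi * ζ.snd - hAiry (2 * Real.pi * ζ.fst)) (G ζ)).trans ?_
  refine (lTwo_tsum_le fun j => ((measurable_eta_mod hη j).mul hG).enorm).trans ?_
  refine ENNReal.tsum_le_tsum fun j => le_mul_of_one_le_left zero_le ?_
  rw [← ENNReal.rpow_zero (x := 2)]
  exact ENNReal.rpow_le_rpow_of_exponent_le (by norm_num) (by positivity)

lemma FbarNorm_sq (η₀ : ℝ → ℝ) (s : ℝ) (v : 𝓢'(Plane, ℂ)) : FbarNorm η₀ s v ^ 2 =
    (∑' k : ℕ, (2 : ℝ≥0∞) ^ (2 * s * ((k : ℝ) + 1)) * YPieceNorm η₀ hAiry (k + 1) v ^ (2 : ℕ))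
    + lowNorm η₀ v ^ (2 : ℕ) := by
  rw [FbarNorm, ← ENNReal.rpow_natCast, ← ENNReal.rpow_mul]; norm_num

lemma lowNorm_le_FbarNorm (η₀ : ℝ → ℝ) (s : ℝ) (v : 𝓢'(Plane, ℂ)) :
    lowNorm η₀ v ≤ FbarNorm η₀ s v := by
  rw [← ENNReal.pow_le_pow_left_iff two_ne_zero, FbarNorm_sq]
  exact le_add_left le_rfl

lemma YPieceNorm_le_FbarNorm (η₀ : ℝ → ℝ) (s : ℝ) (v : 𝓢'(Plane, ℂ)) (k : ℕ) :
    YPieceNorm η₀ hAiry (k + 1) v ≤ (2 : ℝ≥0∞) ^ (-(s * ((k : ℝ) + 1))) * FbarNorm η₀ s v := by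
  have h : ((2 : ℝ≥0∞) ^ (s * ((k : ℝ) + 1)) * YPieceNorm η₀ hAiry (k + 1) v) ^ 2 ≤
      FbarNorm η₀ s v ^ 2 := by
    rw [FbarNorm_sq, mul_pow, ← ENNReal.rpow_natCast (2 ^ _), ← ENNReal.rpow_mul]
    refine le_add_right (le_trans (le_of_eq ?_) (ENNReal.le_tsum k))
    congr 2
    push_cast; ring
  rw [ENNReal.pow_le_pow_left_iff two_ne_zero] at h
  refine le_trans (le_of_eq ?_) (mul_le_mul_right h _)
  rw [← mul_assoc, ← ENNReal.rpow_add _ _ (by norm_num) (by norm_num), neg_add_cancel,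
    ENNReal.rpow_zero, one_mul]

lemma exists_of_lowNorm_lt_top {η₀ : ℝ → ℝ} {v : 𝓢'(Plane, ℂ)} (h : lowNorm η₀ v < ⊤) :
    ∃ g, IsFun (Ple η₀ 0 v) g ∧ L2xLinftyt g ≤ lowNorm η₀ v := by
  have h' := h
  simp only [lowNorm, iInf_lt_iff] at h'
  obtain ⟨g, hg, -⟩ := h'
  exact ⟨g, hg, le_iInf₂ fun f hf => (L2xLinftyt_congr (hg.ae_eq hf)).le⟩

/-- The high frequency pieces of an element of `F̄^s`. -/
lemma exists_high_piece {η₀ : ℝ → ℝ} (hη : IsCutoff η₀) {s : ℝ} {v : 𝓢'(Plane, ℂ)}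
    (h : FbarNorm η₀ s v < ⊤) (k : ℕ) : ∃ G V : Plane → ℂ, Measurable G ∧
      IsFun (𝓕 (P η₀ (k + 1) v)) G ∧ IsFun (P η₀ (k + 1) v) V ∧ MemLp V 2 volume ∧
      (∀ ζ, 2 * Real.pi * ζ.fst ∉ annulus (2 ^ (k + 1)) → G ζ = 0) ∧
      yNorm η₀ G ≤ (2 : ℝ≥0∞) ^ (-(s * ((k : ℝ) + 1))) * FbarNorm η₀ s v := by
  have hY := YPieceNorm_le_FbarNorm η₀ s v k
  have htop : (2 : ℝ≥0∞) ^ (-(s * ((k : ℝ) + 1))) ≠ ⊤ :=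
    ENNReal.rpow_ne_top_of_ne_zero (by norm_num) (by norm_num)
  have hfin := hY.trans_lt (ENNReal.mul_lt_top htop.lt_top h)
  have h' := hfin
  simp only [YPieceNorm, iInf_lt_iff] at h'
  obtain ⟨f, hf, -⟩ := h'
  obtain ⟨G₀, hG₀m, hG₀⟩ := IsFun.exists_measurable hf
  set S : Set Plane := {ζ | 2 * Real.pi * ζ.fst ∈ annulus (2 ^ (k + 1))} with hS
  have hSm : MeasurableSet S :=
    (by fun_prop : Measurable fun ζ : Plane => 2 * Real.pi * ζ.fst) (measurableSet_annulus _)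
  -- Truncating to the annulus changes nothing almost everywhere and makes the support condition
  -- hold at every point.
  have hG : IsFun (𝓕 (P η₀ (k + 1) v)) (S.indicator G₀) := by
    refine hG₀.congr ?_
    filter_upwards [hG₀.ae_eq_zero_of_fourier_P hη] with ζ hζ
    by_cases hs : ζ ∈ S
    · rw [Set.indicator_of_mem hs]
    · rw [Set.indicator_of_notMem hs, hζ hs]
  have hGm : Measurable (S.indicator G₀) := hG₀m.indicator hSm
  have hyY := yNorm_le_YPieceNorm hG
  have h2 : MemLp (S.indicator G₀) 2 volume := by
    refine ⟨hGm.aestronglyMeasurable, ?_⟩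
    have : eLpNorm (S.indicator G₀) 2 volume = lTwo fun ζ => ‖S.indicator G₀ ζ‖ₑ := by
      rw [← (ENNReal.pow_right_strictMono two_ne_zero).injective.eq_iff, lTwo_sq, eLpNorm_two_sq]
    rw [this]
    exact (lTwo_le_yNorm hη hGm).trans_lt (hyY.trans_lt hfin)
  obtain ⟨V, hV, hV2⟩ := exists_isFun_of_fourier hG h2
  exact ⟨_, V, hGm, hG, hV, hV2, fun ζ hζ => Set.indicator_of_notMem (show ζ ∉ S from hζ) _, hyY.trans hY⟩

/-! ### The Schrödinger–Airy interaction at high frequency -/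

/-- The frequencies with `|ξ| ~ N` and `|τ - ξ³| ≲ L`, in normalized variables. -/
def airyBlock (N L : ℝ) : Set Plane :=
  {p | 2 * Real.pi * p.fst ∈ annulus N ∧ |2 * Real.pi * p.snd - hAiry (2 * Real.pi * p.fst)| ≤ 8 / 5 * L}

lemma measurableSet_airyBlock (N L : ℝ) : MeasurableSet (airyBlock N L) := by
  have hh := continuous_hAiry.measurable
  have h1 : MeasurableSet {p : Plane | |2 * Real.pi * p.snd - hAiry (2 * Real.pi * p.fst)| ≤ 8 / 5 * L} :=
    measurableSet_le (by fun_prop) measurable_const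
  exact ((by fun_prop : Measurable fun ζ : Plane => 2 * Real.pi * ζ.fst)
    (measurableSet_annulus N)).inter h1

/-- The symbol of the Schrödinger–Airy interaction. -/
def airySymbol (lam s θ N L : ℝ) (ζ η : Plane) : ℝ≥0∞ :=
  (airyBlock N L).indicator (fun _ => ENNReal.ofReal (wt (hSchr lam) s (-(1 / 2) + 2 * θ) ζ *
    (wt (hSchr lam) s (1 / 2 + θ) η)⁻¹)) (ζ - η)

lemma measurable_airySymbol (lam s θ N L : ℝ) :
    Measurable (Function.uncurry (airySymbol lam s θ N L)) := by
  have h1 := (continuous_wt (continuous_hSchr lam) s (-(1 / 2) + 2 * θ)).measurable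
  have h2 := (continuous_wt (continuous_hSchr lam) s (1 / 2 + θ)).measurable
  have h3 : MeasurableSet {q : Plane × Plane | q.1 - q.2 ∈ airyBlock N L} :=
    (measurable_fst.sub measurable_snd) (measurableSet_airyBlock N L)
  exact Measurable.indicator
    ((h1.comp measurable_fst).mul (h2.comp measurable_snd).inv).ennreal_ofReal h3

/-- The output frequency is the sum of the input frequencies, and `⟨ξ₂⟩ ≤ 1 + 8N/5 ≤ 3N` on the
annulus. Hence moving `s` spatial derivatives onto `u` costs `(2 · 3N)^s`. -/
lemma wt_ratio_sq_le {lam s θ N : ℝ} (hs : 0 ≤ s) (hN : 2 ≤ N) (ζ η : Plane)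
    (h : 2 * Real.pi * (ζ - η).fst ∈ annulus N) :
    (wt (hSchr lam) s (-(1 / 2) + 2 * θ) ζ * (wt (hSchr lam) s (1 / 2 + θ) η)⁻¹) ^ 2 ≤
      (6 * N) ^ (2 * s) * (jb (2 * Real.pi * ζ.snd + lam * (2 * Real.pi * ζ.fst) ^ 2) ^ (-1 + 4 * θ) *
        jb (2 * Real.pi * η.snd + lam * (2 * Real.pi * η.fst) ^ 2) ^ (-(1 + 2 * θ))) := by
  set x := 2 * Real.pi * (ζ - η).fst
  set X := 2 * Real.pi * ζ.fst
  set Y := 2 * Real.pi * η.fst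
  have hx : x + Y = X := by simp only [x, X, Y, WithLp.sub_fst]; ring
  unfold wt
  simp only [hSchr, neg_mul, sub_neg_eq_add]
  have hsq : ∀ (x r : ℝ), (jb x ^ r) ^ 2 = jb x ^ (2 * r) := fun x r => by
    rw [← Real.rpow_natCast, ← Real.rpow_mul (jb_pos x).le]; congr 1; push_cast; ring
  have hx3 : jb x ^ s ≤ (3 * N) ^ s := by
    refine Real.rpow_le_rpow (jb_pos x).le ?_ hs
    have := jb_le_one_add_abs x
    linarith [h.2]
  have h1 : jb X ^ s * (jb Y ^ s)⁻¹ ≤ (6 * N) ^ s := by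
    rw [← div_eq_mul_inv, div_le_iff₀ (Real.rpow_pos_of_pos (jb_pos Y) s), ← hx]
    refine (jb_rpow_add_le x Y hs).trans ?_
    rw [show 6 * N = 2 * (3 * N) by ring, Real.mul_rpow (by norm_num) (by positivity), mul_assoc]
    have := Real.rpow_nonneg (jb_pos Y).le s
    gcongr
  have h2 : (6 * N) ^ (2 * s) = ((6 * N) ^ s) ^ 2 := by
    rw [← Real.rpow_natCast, ← Real.rpow_mul (by positivity)]; congr 1; push_cast; ring
  have h0 : 0 ≤ jb X ^ s * (jb Y ^ s)⁻¹ :=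
    mul_nonneg (Real.rpow_nonneg (jb_pos X).le s) (inv_nonneg.2 (Real.rpow_nonneg (jb_pos Y).le s))
  set σ := 2 * Real.pi * ζ.snd + lam * X ^ 2
  set σ₁ := 2 * Real.pi * η.snd + lam * Y ^ 2
  have e6 : jb σ₁ ^ (-(1 + 2 * θ)) = ((jb σ₁ ^ (1 / 2 + θ))⁻¹) ^ 2 := by
    rw [inv_pow, hsq, Real.rpow_neg (jb_pos _).le]; congr 2; ring
  have e7 : jb σ ^ (-1 + 4 * θ) = (jb σ ^ (-(1 / 2) + 2 * θ)) ^ 2 := by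
    rw [hsq]; congr 1; ring
  rw [e6, e7, h2]
  calc _ = (jb X ^ s * (jb Y ^ s)⁻¹) ^ 2 * ((jb σ ^ (-(1 / 2) + 2 * θ)) ^ 2 *
        ((jb σ₁ ^ (1 / 2 + θ))⁻¹) ^ 2) := by rw [mul_inv]; ring
    _ ≤ _ := by gcongr

/-- Reduces to `airy_kernel_le`: take the frequency `p = ζ - η` of the Airy factor as variable, undo
the normalization by `2π`, and replace `τ₂` by the modulation `ρ = τ₂ - ξ₂³`. -/
lemma lintegral_airySymbol_le {lam s θ N L : ℝ} (hl : 0 < lam) (hl1 : lam ≤ 1) (hs : 0 ≤ s)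
    (hθ : 0 < θ) (hθ1 : θ ≤ 1 / 4) (hN : 2 ≤ N) (hL : 0 ≤ L) (ζ : Plane) :
    ∫⁻ η, airySymbol lam s θ N L ζ η ^ 2 ≤
      ENNReal.ofReal ((6 * N) ^ (2 * s)) * (airyConst θ * ENNReal.ofReal (N ^ (-2 + 12 * θ) * L)) := by
  set X := 2 * Real.pi * ζ.fst with hX
  set T := 2 * Real.pi * ζ.snd with hT
  set S : Set Plane := {q | q.fst ∈ annulus N ∧ |q.snd - hAiry q.fst| ≤ 8 / 5 * L} with hS
  have hSm : MeasurableSet S := by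
    have hh := continuous_hAiry.measurable
    have h1 : MeasurableSet {q : Plane | |q.snd - hAiry q.fst| ≤ 8 / 5 * L} :=
      measurableSet_le (by fun_prop) measurable_const
    exact (measurable_plane_fst (measurableSet_annulus N)).inter h1
  set f : Plane → ℝ≥0∞ := fun q => ENNReal.ofReal (jb (T + lam * X ^ 2) ^ (-1 + 4 * θ) *
      jb (T - q.snd + lam * (X - q.fst) ^ 2) ^ (-(1 + 2 * θ))) with hf
  have hfm : Measurable f := by
    have := (continuous_jb_rpow (-(1 + 2 * θ))).measurable.comp
      (by fun_prop : Measurable fun q : Plane => T - q.snd + lam * (X - q.fst) ^ 2)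
    exact (this.const_mul _).ennreal_ofReal
  set g : Plane → ℝ≥0∞ := S.indicator f with hg
  have hgm : Measurable g := hfm.indicator hSm
  have hpt : ∀ p, airySymbol lam s θ N L ζ (ζ - p) ^ 2 ≤
      ENNReal.ofReal ((6 * N) ^ (2 * s)) * g ((2 * Real.pi) • p) := by
    intro p
    rw [airySymbol, sub_sub_cancel]
    by_cases hp : p ∈ airyBlock N L
    · have hp' : (2 * Real.pi) • p ∈ S := by simpa [hS, airyBlock] using hp
      rw [Set.indicator_of_mem hp, hg, Set.indicator_of_mem hp', hf]
      have h := wt_ratio_sq_le (lam := lam) (θ := θ) hs hN ζ (ζ - p) (by simpa using hp.1)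
      simp only
      have p1 := wt_pos (hSchr lam) s (-(1 / 2) + 2 * θ) ζ
      have p2 := wt_pos (hSchr lam) s (1 / 2 + θ) (ζ - p)
      rw [← ENNReal.ofReal_pow (by positivity), ← ENNReal.ofReal_mul (by positivity)]
      refine ENNReal.ofReal_le_ofReal (h.trans (le_of_eq ?_))
      simp only [WithLp.sub_fst, WithLp.sub_snd, WithLp.smul_fst, WithLp.smul_snd, smul_eq_mul, hX, hT]
      ring_nf
    · rw [Set.indicator_of_notMem hp]; simp
  rw [← lintegral_sub_left_eq_self _ ζ]
  calc _ ≤ ∫⁻ p : Plane, ENNReal.ofReal ((6 * N) ^ (2 * s)) * g ((2 * Real.pi) • p) :=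
        lintegral_mono hpt
    _ = ENNReal.ofReal ((6 * N) ^ (2 * s)) * ∫⁻ p : Plane, g ((2 * Real.pi) • p) :=
        lintegral_const_mul' _ _ ENNReal.ofReal_ne_top
    _ ≤ ENNReal.ofReal ((6 * N) ^ (2 * s)) * ∫⁻ q, g q :=
        mul_le_mul_right (lintegral_comp_two_pi_le g) _
    _ ≤ _ := by
        refine mul_le_mul_right (le_trans (le_of_eq ?_)
          (airy_kernel_le hθ hθ1 hl hl1 hN hL X T)) _
        rw [lintegral_plane hgm, ← lintegral_indicator (measurableSet_annulus N)]
        refine lintegral_congr fun x => ?_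
        rw [← lintegral_add_right_eq_self _ (x ^ 3)]
        by_cases hx : x ∈ annulus N
        · rw [Set.indicator_of_mem hx, ← lintegral_indicator measurableSet_Icc]
          refine lintegral_congr fun ρ => ?_
          have hiff : WithLp.toLp 2 (x, ρ + x ^ 3) ∈ S ↔ ρ ∈ Set.Icc (-(8 / 5 * L)) (8 / 5 * L) := by
            change (x ∈ annulus N ∧ |ρ + x ^ 3 - x ^ 3| ≤ 8 / 5 * L) ↔ _
            rw [add_sub_cancel_right, abs_le, and_iff_right hx, Set.mem_Icc]
          by_cases hρ : ρ ∈ Set.Icc (-(8 / 5 * L)) (8 / 5 * L)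
          · rw [Set.indicator_of_mem hρ, hg, Set.indicator_of_mem (hiff.2 hρ), hf]
            change ENNReal.ofReal (_ * jb (T - (ρ + x ^ 3) + lam * (X - x) ^ 2) ^ _) = _
            congr 4
            ring
          · rw [Set.indicator_of_notMem hρ, hg, Set.indicator_of_notMem (mt hiff.1 hρ)]
        · rw [Set.indicator_of_notMem hx]
          have : ∀ ρ, g (WithLp.toLp 2 (x, ρ + x ^ 3)) = 0 := fun ρ => by
            rw [hg, Set.indicator_of_notMem (fun h => hx h.1)]
          simp [this]

/-- The constant of the high frequency estimate. -/
def highConst (s θ : ℝ) : ℝ≥0∞ := (ENNReal.ofReal (6 ^ (2 * s)) * airyConst θ) ^ (1 / 2 : ℝ)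

lemma highConst_lt_top {s θ : ℝ} (hθ : 0 < θ) : highConst s θ < ⊤ :=
  ENNReal.rpow_lt_top_of_nonneg (by norm_num)
    (ENNReal.mul_lt_top ENNReal.ofReal_lt_top (airyConst_lt_top hθ)).ne

lemma high_const_eq (s θ : ℝ) (k j : ℕ) :
    ENNReal.ofReal ((6 * 2 ^ (k + 1)) ^ (2 * s)) *
      (airyConst θ * ENNReal.ofReal ((2 ^ (k + 1)) ^ (-2 + 12 * θ) * 2 ^ j)) =
    (highConst s θ * ((2 : ℝ≥0∞) ^ ((s - 1 + 6 * θ) * ((k : ℝ) + 1)) * 2 ^ ((j : ℝ) / 2))) ^ 2 := by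
  have h1 : highConst s θ ^ 2 = ENNReal.ofReal (6 ^ (2 * s)) * airyConst θ := by
    rw [highConst, ← ENNReal.rpow_natCast, ← ENNReal.rpow_mul]; norm_num
  have h2 : ∀ x : ℝ, (2 : ℝ≥0∞) ^ x = ENNReal.ofReal (2 ^ x) := fun x => by
    rw [← ENNReal.ofReal_rpow_of_pos (by norm_num)]; simp
  have h3 : ((2 : ℝ) ^ (k + 1)) = 2 ^ ((k : ℝ) + 1) := by
    rw [← Real.rpow_natCast]; push_cast; rfl
  rw [mul_pow, h1, h2, h2, ← ENNReal.ofReal_mul (by positivity), ← ENNReal.ofReal_pow (by positivity),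
    Real.mul_rpow (by norm_num) (by positivity), ENNReal.ofReal_mul (by positivity), h3,
    ← Real.rpow_mul (by norm_num), ← Real.rpow_mul (by norm_num), ← Real.rpow_natCast 2 j,
    ← Real.rpow_add (by norm_num), ← Real.rpow_add (by norm_num), ← Real.rpow_natCast (2 ^ _),
    ← Real.rpow_mul (by norm_num)]
  rw [mul_assoc, mul_assoc, mul_left_comm (ENNReal.ofReal (2 ^ _)), ← ENNReal.ofReal_mul (by positivity),
    ← Real.rpow_add (by norm_num)]
  congr 4
  push_cast; ring

variable {lam s θ : ℝ}

/-- Cauchy–Schwarz on one dyadic block `N = 2^{k+1}`, `L = 2^j`. The square root of the kernel bound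
gives `N^{s-1+6θ} L^{1/2}`. -/
lemma high_block_le (hl : 0 < lam) (hl1 : lam ≤ 1) (hs : 0 ≤ s) (hθ : 0 < θ) (hθ1 : θ ≤ 1 / 4)
    (k j : ℕ) {f B : Plane → ℝ≥0∞} (hf : Measurable f) (hB : Measurable B)
    (hBs : ∀ p, p ∉ airyBlock (2 ^ (k + 1)) (2 ^ j) → B p = 0) :
    lTwo (fun ζ => ENNReal.ofReal (wt (hSchr lam) s (-(1 / 2) + 2 * θ) ζ) * ∫⁻ η, f η * B (ζ - η)) ≤
      highConst s θ * ((2 : ℝ≥0∞) ^ ((s - 1 + 6 * θ) * ((k : ℝ) + 1)) * 2 ^ ((j : ℝ) / 2)) *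
        (lTwo (fun η => ENNReal.ofReal (wt (hSchr lam) s (1 / 2 + θ) η) * f η) * lTwo B) := by
  have hwm := (continuous_wt (continuous_hSchr lam) s (1 / 2 + θ)).measurable
  refine lTwo_le_of_sq_le ?_
  rw [mul_pow _ (_ * _), mul_pow (lTwo _), lTwo_sq, lTwo_sq, ← high_const_eq]
  refine le_trans (le_of_eq (lintegral_congr fun ζ => ?_)) (lintegral_sq_conv_le
    (K := airySymbol lam s θ (2 ^ (k + 1)) (2 ^ j))
    (A := fun η => ENNReal.ofReal (wt (hSchr lam) s (1 / 2 + θ) η) * f η)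
    (measurable_airySymbol _ _ _ _ _) (hwm.ennreal_ofReal.mul hf) hB
    (lintegral_airySymbol_le hl hl1 hs hθ hθ1 ?_ (by positivity)))
  · congr 1
    rw [← lintegral_const_mul' _ _ ENNReal.ofReal_ne_top]
    refine lintegral_congr fun η => ?_
    by_cases h : ζ - η ∈ airyBlock (2 ^ (k + 1)) (2 ^ j)
    · rw [airySymbol, Set.indicator_of_mem h, ENNReal.ofReal_mul (wt_pos _ _ _ _).le]
      conv_lhs => rw [← ofReal_inv_wt_cancel (h := hSchr lam) (s := s) (b := 1 / 2 + θ) η (f η)]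
      ring
    · rw [hBs _ h]; simp
  · rw [pow_succ]
    linarith [one_le_pow₀ (M₀ := ℝ) (n := k) one_le_two]

/-- Summation over the modulation scales of the Airy factor. The loss `2^{j/2}` of each block is
exactly the weight in `yNorm`, so the sum closes with no loss in `j`. -/
lemma high_piece_le {η₀ : ℝ → ℝ} (hη : IsCutoff η₀) (hl : 0 < lam) (hl1 : lam ≤ 1) (hs : 0 ≤ s)
    (hθ : 0 < θ) (hθ1 : θ ≤ 1 / 4) (k : ℕ) {f : Plane → ℝ≥0∞} {G : Plane → ℂ} (hf : Measurable f)
    (hG : Measurable G) (hGs : ∀ ζ, 2 * Real.pi * ζ.fst ∉ annulus (2 ^ (k + 1)) → G ζ = 0) :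
    lTwo (fun ζ => ENNReal.ofReal (wt (hSchr lam) s (-(1 / 2) + 2 * θ) ζ) *
        ∫⁻ η, f η * ‖G (ζ - η)‖ₑ) ≤
      highConst s θ * (2 : ℝ≥0∞) ^ ((s - 1 + 6 * θ) * ((k : ℝ) + 1)) *
        (lTwo (fun η => ENNReal.ofReal (wt (hSchr lam) s (1 / 2 + θ) η) * f η) * yNorm η₀ G) := by
  have hwm := (continuous_wt (continuous_hSchr lam) s (-(1 / 2) + 2 * θ)).measurable
  set B : ℕ → Plane → ℝ≥0∞ := fun j p =>
    ‖((eta η₀ j (2 * Real.pi * p.snd - hAiry (2 * Real.pi * p.fst)) : ℝ) : ℂ) * G p‖ₑ with hB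
  have hBm : ∀ j, Measurable (B j) := fun j => ((measurable_eta_mod hη j).mul hG).enorm
  have hBs : ∀ j p, p ∉ airyBlock (2 ^ (k + 1)) (2 ^ j) → B j p = 0 := by
    intro j p hp
    by_cases h1 : 2 * Real.pi * p.fst ∈ annulus (2 ^ (k + 1))
    · have h2 : 8 / 5 * 2 ^ j < |2 * Real.pi * p.snd - hAiry (2 * Real.pi * p.fst)| := by
        by_contra h3
        exact hp ⟨h1, not_lt.1 h3⟩
      simp [hB, eta_eq_zero_of_lt hη h2]
    · simp [hB, hGs p h1]
  have hm : ∀ j, Measurable fun ζ => ∫⁻ η, f η * B j (ζ - η) := fun j =>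
    Measurable.lintegral_prod_right' (f := fun q : Plane × Plane => f q.2 * B j (q.1 - q.2))
      (by have := hBm j; fun_prop)
  calc _ ≤ lTwo (fun ζ => ∑' j, ENNReal.ofReal (wt (hSchr lam) s (-(1 / 2) + 2 * θ) ζ) *
        ∫⁻ η, f η * B j (ζ - η)) := by
        refine lTwo_mono fun ζ => ?_
        rw [ENNReal.tsum_mul_left, ← lintegral_tsum fun j => by
          have := hBm j; exact Measurable.aemeasurable (by fun_prop)]
        gcongr with η
        rw [ENNReal.tsum_mul_left]
        gcongr
        exact enorm_le_tsum_eta hη _ _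
    _ ≤ ∑' j, lTwo (fun ζ => ENNReal.ofReal (wt (hSchr lam) s (-(1 / 2) + 2 * θ) ζ) *
        ∫⁻ η, f η * B j (ζ - η)) := lTwo_tsum_le fun j => hwm.ennreal_ofReal.mul (hm j)
    _ ≤ ∑' j : ℕ, highConst s θ * (2 : ℝ≥0∞) ^ ((s - 1 + 6 * θ) * ((k : ℝ) + 1)) *
        (lTwo (fun η => ENNReal.ofReal (wt (hSchr lam) s (1 / 2 + θ) η) * f η) *
          (2 ^ ((j : ℝ) / 2) * lTwo (B j))) := by
        refine ENNReal.tsum_le_tsum fun j => ?_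
        refine (high_block_le hl hl1 hs hθ hθ1 k j hf (hBm j) (hBs j)).trans (le_of_eq ?_)
        ring
    _ = _ := by
        rw [ENNReal.tsum_mul_left, ENNReal.tsum_mul_left, yNorm]

/-- The sum of the geometric series `∑_{k ≥ 1} 2^{rk}`. -/
def dyadicSum (r : ℝ) : ℝ≥0∞ := ∑' k : ℕ, (2 : ℝ≥0∞) ^ (r * ((k : ℝ) + 1))

lemma dyadicSum_lt_top {r : ℝ} (hr : r < 0) : dyadicSum r < ⊤ := by
  have h : ∀ k : ℕ, (2 : ℝ≥0∞) ^ (r * ((k : ℝ) + 1)) = (2 ^ r) * (2 ^ r) ^ k := fun k => by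
    rw [← ENNReal.rpow_natCast, ← ENNReal.rpow_mul, ← ENNReal.rpow_add _ _ (by norm_num) (by norm_num)]
    congr 1; ring
  have h1 : (2 : ℝ≥0∞) ^ r < 1 := ENNReal.rpow_lt_one_of_one_lt_of_neg (by norm_num) hr
  unfold dyadicSum
  simp_rw [h]
  rw [ENNReal.tsum_mul_left, ENNReal.tsum_geometric]
  refine ENNReal.mul_lt_top (h1.trans_le le_top) (ENNReal.inv_lt_top.2 (tsub_pos_of_lt h1))

/-- The sum of all high frequency interactions. -/
lemma high_le {η₀ : ℝ → ℝ} (hη : IsCutoff η₀) (hl : 0 < lam) (hl1 : lam ≤ 1) (hs : 0 ≤ s)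
    (hθ : 0 < θ) (hθ1 : θ ≤ 1 / 4) {f : Plane → ℝ≥0∞} {G : ℕ → Plane → ℂ} (hf : Measurable f)
    (hG : ∀ k, Measurable (G k))
    (hGs : ∀ k ζ, 2 * Real.pi * ζ.fst ∉ annulus (2 ^ (k + 1)) → G k ζ = 0) {s₂ : ℝ} {N : ℝ≥0∞}
    (hN : ∀ k, yNorm η₀ (G k) ≤ (2 : ℝ≥0∞) ^ (-(s₂ * ((k : ℝ) + 1))) * N) :
    lTwo (fun ζ => ENNReal.ofReal (wt (hSchr lam) s (-(1 / 2) + 2 * θ) ζ) *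
        ∑' k, ∫⁻ η, f η * ‖G k (ζ - η)‖ₑ) ≤
      highConst s θ * dyadicSum (s - s₂ - 1 + 6 * θ) *
        (lTwo (fun η => ENNReal.ofReal (wt (hSchr lam) s (1 / 2 + θ) η) * f η) * N) := by
  have hwm := (continuous_wt (continuous_hSchr lam) s (-(1 / 2) + 2 * θ)).measurable
  have hm : ∀ k, Measurable fun ζ => ∫⁻ η, f η * ‖G k (ζ - η)‖ₑ := fun k =>
    Measurable.lintegral_prod_right' (f := fun q : Plane × Plane => f q.2 * ‖G k (q.1 - q.2)‖ₑ)
      (by have := hG k; fun_prop)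
  set a := lTwo (fun η => ENNReal.ofReal (wt (hSchr lam) s (1 / 2 + θ) η) * f η)
  simp_rw [← ENNReal.tsum_mul_left]
  refine (lTwo_tsum_le fun k => hwm.ennreal_ofReal.mul (hm k)).trans ?_
  calc _ ≤ ∑' k : ℕ, highConst s θ * (a * N) * (2 : ℝ≥0∞) ^ ((s - s₂ - 1 + 6 * θ) * ((k : ℝ) + 1)) := by
        refine ENNReal.tsum_le_tsum fun k => ?_
        refine (high_piece_le hη hl hl1 hs hθ hθ1 k hf (hG k) (hGs k)).trans ?_
        refine (mul_le_mul_right (mul_le_mul_right (hN k) _) _).trans (le_of_eq ?_)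
        have : (2 : ℝ≥0∞) ^ ((s - s₂ - 1 + 6 * θ) * ((k : ℝ) + 1)) =
            2 ^ ((s - 1 + 6 * θ) * ((k : ℝ) + 1)) * 2 ^ (-(s₂ * ((k : ℝ) + 1))) := by
          rw [← ENNReal.rpow_add _ _ (by norm_num) (by norm_num)]
          congr 1; ring
        rw [this]
        ring
    _ = _ := by
        rw [ENNReal.tsum_mul_left, dyadicSum]; ring

/-! ### Convergence of the product -/

/-- The low frequency part of the product converges. -/
lemma tendsto_low_product {η₀ : ℝ → ℝ} (hη : IsCutoff η₀) {u z : 𝓢'(Plane, ℂ)} {U F g : Plane → ℂ}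
    (hU : IsFun u U) (hF : IsFun (𝓕 u) F) (hU2 : MemLp U 2 volume) {Um : ℕ → Plane → ℂ}
    (hUm : ∀ m, IsFun (Ple η₀ m u) (Um m)) (hUm2 : ∀ m, MemLp (Um m) 2 volume) {B : ℝ}
    (hgm : Measurable g) (hgB : ∀ p, ‖g p‖ ≤ B) {Z : ℕ → 𝓢'(Plane, ℂ)}
    (hZ : ∀ m, IsFun (Z m) fun p => Um m p * g p) (hz : IsFun z fun p => U p * g p)
    (φ : 𝓢(Plane, ℂ)) : Tendsto (fun m => Z m φ) atTop (𝓝 (z φ)) := by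
  have hgφ : MemLp (fun p => g p * φ p) 2 volume := by
    refine ((φ.memLp 2 volume).const_mul (B : ℂ)).of_le
      (hgm.aestronglyMeasurable.mul φ.continuous.aestronglyMeasurable) (ae_of_all _ fun p => ?_)
    rw [norm_mul, norm_mul, Complex.norm_real]
    gcongr
    exact (hgB p).trans (Real.le_norm_self B)
  obtain ⟨w, hw⟩ := exists_isFun_of_memLp hgφ
  obtain ⟨G, hG, hG2⟩ := exists_isFun_fourier hw hgφ
  have hG2' := memLp_comp_neg hG2
  obtain ⟨F', hF', hF2'⟩ := exists_isFun_fourier hU hU2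
  have hF2 : MemLp F 2 volume := hF2'.ae_eq (hF'.ae_eq hF)
  -- Since `g` is bounded, `gφ` is in L². Parseval moves the truncation of `u` to a cutoff on the
  -- Fourier side, bounded by 1 and tending pointwise to 1.
  have e1 : ∀ m, Z m φ = ∫ ζ, ((η₀ (2 * Real.pi * ζ.fst / 2 ^ m) : ℝ) : ℂ) * F ζ * G (-ζ) := by
    intro m
    rw [← integral_mul_eq_of_fourier (hUm m) (hF.fourier_Ple hη m) hw hG (hUm2 m) hgφ, (hZ m φ).2]
    simp only [mul_assoc]
  have e2 : z φ = ∫ ζ, F ζ * G (-ζ) := by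
    rw [← integral_mul_eq_of_fourier hU hF hw hG hU2 hgφ, (hz φ).2]
    simp only [mul_assoc]
  rw [e2]
  simp_rw [e1]
  have hηc := hη.smooth.continuous
  refine tendsto_integral_of_dominated_convergence (fun ζ => ‖F ζ * G (-ζ)‖) (fun m => ?_)
    (hF2.integrable_mul hG2').norm (fun m => ae_of_all _ fun ζ => ?_) (ae_of_all _ fun ζ => ?_)
  · refine (Continuous.aestronglyMeasurable ?_).mul hF2.1 |>.mul hG2'.1
    fun_prop
  · rw [mul_assoc, norm_mul]
    exact mul_le_of_le_one_left (norm_nonneg _) (hη.norm_le_one _)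
  · refine tendsto_const_nhds.congr' ?_
    filter_upwards [hη.eventually_eq_one (2 * Real.pi * ζ.fst)] with m hm
    rw [hm]; simp

/-- The high frequency part of the product converges. -/
lemma exists_tendsto_high_product {η₀ : ℝ → ℝ} (hη : IsCutoff η₀) {u : 𝓢'(Plane, ℂ)}
    {v : ℕ → 𝓢'(Plane, ℂ)} {F : Plane → ℂ} {G V : ℕ → Plane → ℂ} (hFm : Measurable F)
    (hF : IsFun (𝓕 u) F) {Um : ℕ → Plane → ℂ}
    (hUm : ∀ m, IsFun (Ple η₀ m u) (Um m)) (hUm2 : ∀ m, MemLp (Um m) 2 volume)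
    (hGm : ∀ k, Measurable (G k)) (hG : ∀ k, IsFun (𝓕 (v k)) (G k)) (hV : ∀ k, IsFun (v k) (V k))
    (hV2 : ∀ k, MemLp (V k) 2 volume) {Z : ℕ → ℕ → 𝓢'(Plane, ℂ)}
    (hZ : ∀ m k, IsFun (Z m k) fun p => Um m p * V k p) {W : Plane → ℝ} {C : ℝ} (hW : IsWeight W C)
    (hfin : ∫⁻ ζ, (ENNReal.ofReal (W ζ) * ∑' k, ∫⁻ η, ‖F η‖ₑ * ‖G k (ζ - η)‖ₑ) ^ 2 < ⊤) :
    ∃ (z : 𝓢'(Plane, ℂ)) (H : Plane → ℂ), IsFun (𝓕 z) H ∧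
      (∀ ζ, ‖H ζ‖ₑ ≤ ∑' k, ∫⁻ η, ‖F η‖ₑ * ‖G k (ζ - η)‖ₑ) ∧
      ∀ φ, Tendsto (fun m => ∑ k ∈ Finset.range m, Z m k φ) atTop (𝓝 (z φ)) := by
  set a : ℕ → Plane → ℝ≥0∞ := fun k ζ => ∫⁻ η, ‖F η‖ₑ * ‖G k (ζ - η)‖ₑ with ha
  have ham : ∀ k, Measurable (a k) := fun k =>
    Measurable.lintegral_prod_right' (f := fun q : Plane × Plane => ‖F q.2‖ₑ * ‖G k (q.1 - q.2)‖ₑ)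
      (by have := hGm k; fun_prop)
  set A : Plane → ℝ≥0∞ := fun ζ => ∑' k, a k ζ with hA
  have hAm : Measurable A := Measurable.tsum ham
  have hAfin : ∀ᵐ ζ, A ζ < ⊤ := by
    have h1 : AEMeasurable (fun ζ => (ENNReal.ofReal (W ζ) * A ζ) ^ 2) volume :=
      ((hW.measurable.ennreal_ofReal.mul hAm).pow_const 2).aemeasurable
    filter_upwards [ae_lt_top' h1 hfin.ne] with ζ hζ
    by_contra h
    rw [not_lt, top_le_iff] at h
    have hp : ENNReal.ofReal (W ζ) ≠ 0 := by simpa using hW.pos ζ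
    simp [h, ENNReal.mul_top hp] at hζ
  set c : ℕ → ℕ → Plane → ℂ := fun m k ζ =>
    ∫ η, ((η₀ (2 * Real.pi * η.fst / 2 ^ m) : ℝ) : ℂ) * F η * G k (ζ - η) with hc
  have hcF : ∀ m k, IsFun (𝓕 (Z m k)) (c m k) := fun m k =>
    (hUm m).fourier_mul (hF.fourier_Ple hη m) (hV k) (hG k) (hUm2 m) (hV2 k) (hZ m k)
  have hca : ∀ m k ζ, ‖c m k ζ‖ₑ ≤ a k ζ := by
    intro m k ζ
    refine (enorm_integral_le_lintegral_enorm _).trans (lintegral_mono fun η => ?_)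
    rw [mul_assoc, enorm_mul, enorm_mul]
    refine mul_le_of_le_one_left zero_le ?_
    rw [← ofReal_norm]
    exact ENNReal.ofReal_le_one.2 (hη.norm_le_one _)
  set H : Plane → ℂ := fun ζ => ∑' k, ∫ η, F η * G k (ζ - η) with hH
  have hHA : ∀ ζ, ‖H ζ‖ₑ ≤ A ζ := by
    intro ζ
    refine enorm_tsum_le_tsum_enorm.trans (ENNReal.tsum_le_tsum fun k => ?_)
    refine (enorm_integral_le_lintegral_enorm _).trans (le_of_eq ?_)
    simp only [enorm_mul, ha]
  have hle : ∀ {x : ℂ} {y : ℝ≥0∞}, ‖x‖ₑ ≤ y → y < ⊤ → ‖x‖ ≤ y.toReal := by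
    intro x y h1 h2
    rw [← toReal_enorm]
    exact ENNReal.toReal_mono h2.ne h1
  have hcm : ∀ m k, AEStronglyMeasurable (c m k) volume := fun m k => (hcF m k).aestronglyMeasurable
  -- The truncation index enters both the cutoff on `u` and the number of summands. Dominated
  -- convergence for series handles both, with majorant `a k ζ`, summable wherever `A ζ` is finite.
  have hlim : ∀ᵐ ζ, Tendsto (fun m => ∑ k ∈ Finset.range m, c m k ζ) atTop (𝓝 (H ζ)) := by
    filter_upwards [hAfin] with ζ hζ
    have hsum : Summable fun k => (a k ζ).toReal := ENNReal.summable_toReal hζ.ne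
    have hak : ∀ k, a k ζ < ⊤ := fun k => (ENNReal.le_tsum k).trans_lt hζ
    have h1 : ∀ m, ∑ k ∈ Finset.range m, c m k ζ =
        ∑' k, (if k ∈ Finset.range m then c m k ζ else 0) := fun m => by
      rw [tsum_eq_sum (s := Finset.range m) fun k hk => if_neg hk]
      exact Finset.sum_congr rfl fun k hk => (if_pos hk).symm
    simp_rw [h1]
    refine tendsto_tsum_of_dominated_convergence hsum (fun k => ?_) (Eventually.of_forall fun m k => ?_)
    · have h2 : Tendsto (fun m => c m k ζ) atTop (𝓝 (∫ η, F η * G k (ζ - η))) := by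
        have hηc := hη.smooth.continuous
        have hGk := hGm k
        refine tendsto_integral_of_dominated_convergence (fun η => ‖F η * G k (ζ - η)‖) (fun m => ?_)
          ?_ (fun m => ae_of_all _ fun η => ?_) (ae_of_all _ fun η => ?_)
        · refine ((Continuous.aestronglyMeasurable ?_).mul hFm.aestronglyMeasurable).mul
            (Measurable.aestronglyMeasurable ?_) <;> fun_prop
        · refine Integrable.norm ⟨Measurable.aestronglyMeasurable (by fun_prop), ?_⟩
          rw [HasFiniteIntegral]
          simp only [enorm_mul]
          exact hak k
        · rw [mul_assoc, norm_mul]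
          exact mul_le_of_le_one_left (norm_nonneg _) (hη.norm_le_one _)
        · refine tendsto_const_nhds.congr' ?_
          filter_upwards [hη.eventually_eq_one (2 * Real.pi * η.fst)] with m hm
          rw [hm]; simp
      refine h2.congr' ?_
      filter_upwards [eventually_gt_atTop k] with m hm
      rw [if_pos (Finset.mem_range.2 hm)]
    · split_ifs
      · exact hle (hca m k ζ) (hak k)
      · simp
  have hHm : AEStronglyMeasurable H volume := by
    refine aestronglyMeasurable_of_tendsto_ae atTop (fun m => ?_) hlim
    exact Finset.aestronglyMeasurable_fun_sum _ fun k _ => hcm m k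
  obtain ⟨T, hT⟩ := exists_isFun_of_isWeight hW hHm (by
    refine (lintegral_mono fun ζ => ?_).trans_lt hfin
    gcongr
    exact hHA ζ)
  -- The majorant `A` is also a tempered function; this supplies the integrable dominating function
  -- for the pairing with `χ`.
  obtain ⟨T', hT'⟩ := exists_isFun_of_isWeight hW (f := fun ζ => (((A ζ).toReal : ℝ) : ℂ))
    (Complex.measurable_ofReal.comp hAm.ennreal_toReal).aestronglyMeasurable (by
    refine (lintegral_mono fun ζ => ?_).trans_lt hfin
    gcongr
    rw [← ofReal_norm, Complex.norm_real, Real.norm_of_nonneg ENNReal.toReal_nonneg]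
    exact ENNReal.ofReal_toReal_le)
  have hTF : 𝓕 (𝓕⁻ T) = T := FourierTransform.fourier_fourierInv_eq T
  refine ⟨𝓕⁻ T, H, by rwa [hTF], hHA, fun φ => ?_⟩
  obtain ⟨χ, rfl⟩ : ∃ χ : 𝓢(Plane, ℂ), φ = 𝓕 χ := ⟨𝓕⁻ φ, (FourierTransform.fourier_fourierInv_eq φ).symm⟩
  have e1 : ∀ m, ∑ k ∈ Finset.range m, Z m k (𝓕 χ) =
      ∫ ζ, (∑ k ∈ Finset.range m, c m k ζ) * χ ζ := by
    intro m
    simp_rw [Finset.sum_mul]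
    rw [integral_finsetSum _ fun k _ => (hcF m k χ).1]
    refine Finset.sum_congr rfl fun k _ => ?_
    rw [← (hcF m k χ).2, TemperedDistribution.fourier_apply]
  have e2 : (𝓕⁻ T) (𝓕 χ) = ∫ ζ, H ζ * χ ζ := by
    rw [← (hT χ).2, ← TemperedDistribution.fourier_apply, hTF]
  rw [e2]
  simp_rw [e1]
  refine tendsto_integral_of_dominated_convergence
    (fun ζ => ‖(((A ζ).toReal : ℝ) : ℂ) * χ ζ‖) (fun m => ?_) (hT' χ).1.norm (fun m => ?_) ?_
  · exact (Finset.aestronglyMeasurable_fun_sum _ fun k _ => hcm m k).mul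
      χ.continuous.aestronglyMeasurable
  · filter_upwards [hAfin] with ζ hζ
    rw [norm_mul, norm_mul, Complex.norm_real, Real.norm_of_nonneg ENNReal.toReal_nonneg]
    gcongr
    refine hle ((enorm_sum_le _ _).trans ?_) hζ
    exact (Finset.sum_le_sum fun k _ => hca m k ζ).trans (ENNReal.sum_le_tsum _)
  · filter_upwards [hlim] with ζ hζ
    exact hζ.mul_const _

/-! ### The Schrödinger–Airy interaction -/

lemma Ple_eq (η₀ : ℝ → ℝ) (m : ℕ) (v : 𝓢'(Plane, ℂ)) :
    Ple η₀ m v = Ple η₀ 0 v + ∑ k ∈ Finset.range m, P η₀ (k + 1) v := by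
  rw [Ple, Ple, Finset.sum_range_succ', add_comm]
  simp

lemma temperedDistribution_sum_apply (u : 𝓢'(Plane, ℂ)) (Z : ℕ → 𝓢'(Plane, ℂ)) (s : Finset ℕ)
    (φ : 𝓢(Plane, ℂ)) : (u + ∑ k ∈ s, Z k) φ = u φ + ∑ k ∈ s, Z k φ := by
  classical
  induction s using Finset.induction_on with
  | empty => simp
  | insert i s hi ih =>
    rw [Finset.sum_insert hi, Finset.sum_insert hi, add_left_comm, add_left_comm (u φ), ← ih]
    rfl

lemma wt_le_jb {h : ℝ → ℝ} {s b : ℝ} (hb : b ≤ 0) (ζ : Plane) :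
    wt h s b ζ ≤ jb (2 * Real.pi * ζ.fst) ^ s :=
  mul_le_of_le_one_left (Real.rpow_nonneg (jb_pos _).le _) (jb_rpow_le_one hb)

lemma jb_le_wt {h : ℝ → ℝ} {s b : ℝ} (hb : 0 ≤ b) (ζ : Plane) :
    jb (2 * Real.pi * ζ.fst) ^ s ≤ wt h s b ζ :=
  le_mul_of_one_le_left (Real.rpow_nonneg (jb_pos _).le _)
    (Real.one_le_rpow (one_le_jb _) hb)

/-- For the low part both modulation weights are discarded and multiplication by `g` is estimated at
fixed regularity `s₁`. The high part is `high_le`. The sum is then localized by `ψ(t)`. -/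
theorem schr_airy_estimate {s₁ s₂ : ℝ} (hs₁ : 0 ≤ s₁) (hs₁' : s₁ < 1) {θ : ℝ} (hθ : 0 < θ)
    (hθ1 : θ ≤ 1 / 4) (hexp : s₁ - s₂ - 1 + 6 * θ < 0) {η₀ : ℝ → ℝ} (hη : IsCutoff η₀)
    {ψ : ℝ → ℝ} (hψ : ContDiff ℝ ∞ ψ) (hc : HasCompactSupport ψ) :
    ∃ C : ℝ, 0 < C ∧ ∀ lam : ℝ, 0 < lam → lam ≤ 1 → ∀ u v : 𝓢'(Plane, ℂ),
      XNorm (hSchr lam) s₁ (1 / 2 + θ) u < ⊤ → FbarNorm η₀ s₂ v < ⊤ →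
      ∃ z : 𝓢'(Plane, ℂ), HasProduct η₀ u v z ∧
        XNorm (hSchr lam) s₁ (-(1 / 2) + 2 * θ) (mulTime ψ z) ≤
          ENNReal.ofReal (C * lam ^ (-(1 / 2) : ℝ)) *
            (XNorm (hSchr lam) s₁ (1 / 2 + θ) u * FbarNorm η₀ s₂ v) := by
  obtain ⟨K, hK, hmul⟩ := exists_fourier_mulTime hψ hc (C := 14) (by norm_num)
  obtain ⟨C₀, hC₀, hlowb⟩ := exists_low_bounds hη
  obtain ⟨C₁, hC₁, hlowm⟩ := exists_low_mul_bound hs₁ hs₁'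
  set M := highConst s₁ θ * dyadicSum (s₁ - s₂ - 1 + 6 * θ)
  have hM : M < ⊤ := ENNReal.mul_lt_top (highConst_lt_top hθ) (dyadicSum_lt_top hexp)
  set D : ℝ := K * (4 * (C₁ * C₀ ^ 2 + M.toReal ^ 2)) + 1
  have hD : 0 < D := by positivity
  refine ⟨√D, Real.sqrt_pos.2 hD, fun lam hl hl1 u v hu hv => ?_⟩
  set Φ := FbarNorm η₀ s₂ v
  obtain ⟨F, hFm, hF⟩ := exists_of_XNorm_lt_top hu
  have hF2 := memLp_two_of_weighted hs₁ (by linarith) hu hF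
  obtain ⟨U, hU, hU2⟩ := exists_isFun_of_fourier hF hF2
  have hηc := hη.smooth.continuous
  have hFm2 : ∀ m : ℕ, MemLp (fun ζ : Plane => ((η₀ (2 * Real.pi * ζ.fst / 2 ^ m) : ℝ) : ℂ) * F ζ) 2
      volume := fun m => by
    refine hF2.of_le (Measurable.aestronglyMeasurable (by fun_prop)) (ae_of_all _ fun ζ => ?_)
    rw [norm_mul]
    exact mul_le_of_le_one_left (norm_nonneg _) (hη.norm_le_one _)
  choose Um hUm hUm2 using fun m => exists_isFun_of_fourier (hF.fourier_Ple hη m) (hFm2 m)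
  choose G V hGm hG hV hV2 hGs hGY using fun k => exists_high_piece hη hv k
  obtain ⟨g₀, hg₀, hg₀N⟩ := exists_of_lowNorm_lt_top
    ((lowNorm_le_FbarNorm η₀ s₂ v).trans_lt hv)
  have hg₀Φ : L2xLinftyt g₀ ≤ Φ := hg₀N.trans (lowNorm_le_FbarNorm η₀ s₂ v)
  obtain ⟨g, hgm, hg, hgB, hgL⟩ := hlowb v g₀ hg₀ (hg₀Φ.trans_lt hv)
  set B := C₀ * (L2xLinftyt g₀).toReal
  have hBΦ : ENNReal.ofReal B ≤ ENNReal.ofReal C₀ * Φ := by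
    rw [ENNReal.ofReal_mul hC₀.le]
    gcongr
    exact ENNReal.ofReal_toReal_le.trans hg₀Φ
  have hmulg : ∀ {X : Plane → ℂ}, MemLp X 2 volume → MemLp (fun p => X p * g p) 2 volume := by
    intro X hX
    refine (hX.const_mul (B : ℂ)).of_le (hX.1.mul hgm.aestronglyMeasurable)
      (ae_of_all _ fun p => ?_)
    rw [norm_mul, norm_mul, Complex.norm_real, mul_comm]
    gcongr
    exact (hgB p).trans (Real.le_norm_self B)
  obtain ⟨zl, hzl⟩ := exists_isFun_of_memLp (hmulg hU2)
  choose Zl hZl using fun m => exists_isFun_of_memLp (hmulg (hUm2 m))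
  choose Zh hZh using fun m k => exists_isFun_of_memLp
    (memLp_one_iff_integrable.2 ((hUm2 m).integrable_mul (hV2 k)))
  set W := wt (hSchr lam) s₁ (-(1 / 2) + 2 * θ)
  set w := wt (hSchr lam) s₁ (1 / 2 + θ)
  have hWt : IsWeight W 14 := isWeight_wt (continuous_hSchr lam) (hSchr_bound hl hl1) s₁
    (b := -(1 / 2) + 2 * θ) (by linarith) (by linarith)
  set a := ∫⁻ η, (ENNReal.ofReal (w η) * ‖F η‖ₑ) ^ 2 with ha
  have hXu : XNorm (hSchr lam) s₁ (1 / 2 + θ) u ^ 2 = ENNReal.ofReal ((2 * Real.pi) ^ 2) * a :=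
    XNorm_sq hF (hSchr lam) s₁ (1 / 2 + θ)
  have hafin : a < ⊤ := by
    have : a ≤ ENNReal.ofReal ((2 * Real.pi) ^ 2) * a :=
      le_mul_of_one_le_left zero_le (ENNReal.one_le_ofReal.2 (one_le_pow₀ one_le_two_pi))
    exact (this.trans_eq hXu.symm).trans_lt (ENNReal.pow_lt_top hu)
  have hhigh : ∫⁻ ζ, (ENNReal.ofReal (W ζ) * ∑' k, ∫⁻ η, ‖F η‖ₑ * ‖G k (ζ - η)‖ₑ) ^ 2 ≤
      M ^ 2 * (a * Φ ^ 2) := by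
    rw [← lTwo_sq, ha, ← lTwo_sq, ← mul_pow, ← mul_pow]
    gcongr
    exact high_le hη hl hl1 hs₁ hθ hθ1 hFm.enorm hGm hGs hGY
  have hrhs : M ^ 2 * (a * Φ ^ 2) < ⊤ := ENNReal.mul_lt_top (ENNReal.pow_lt_top hM)
    (ENNReal.mul_lt_top hafin (ENNReal.pow_lt_top hv))
  obtain ⟨zh, H, hH, hHA, hHlim⟩ := exists_tendsto_high_product hη hFm hF hUm hUm2 hGm hG hV hV2 hZh
    hWt (hhigh.trans_lt hrhs)
  obtain ⟨Hl₀, hHl₀, -⟩ := exists_isFun_fourier hzl (hmulg hU2)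
  obtain ⟨Hl, hHlm, hHl⟩ := hHl₀.exists_measurable
  -- `P_{≤m} v` is represented by `g` plus its first `m` high pieces, so the truncated product
  -- splits into `Um g` and a finite sum of products of L² functions.
  refine ⟨zl + zh, ⟨Um, fun m p => g p + ∑ k ∈ Finset.range m, V k p,
    fun m => Zl m + ∑ k ∈ Finset.range m, Zh m k, hUm, fun m => ?_, fun m => ?_, ?_⟩, ?_⟩
  · rw [Ple_eq]
    exact hg.add (IsFun.sum _ fun k _ => hV k)
  · refine ((hZl m).add (IsFun.sum (Finset.range m) fun k _ => hZh m k)).congr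
      (ae_of_all _ fun p => ?_)
    simp only [mul_add, Finset.mul_sum, Pi.mul_apply]
  · rw [PointwiseConvergenceCLM.tendsto_iff_forall_tendsto]
    intro φ
    simp_rw [temperedDistribution_sum_apply]
    exact (tendsto_low_product hη hU hF hU2 hUm hUm2 hgm hgB hZl hzl φ).add (hHlim φ)
  have hsum : IsFun (𝓕 (zl + zh)) fun ζ => Hl ζ + H ζ := by
    rw [FourierTransform.fourier_add]
    exact hHl.add hH
  obtain ⟨Ht, hHtm, hHt⟩ := hsum.exists_measurable
  have hlow : ∫⁻ ζ, (ENNReal.ofReal (W ζ) * ‖Hl ζ‖ₑ) ^ 2 ≤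
      ENNReal.ofReal C₁ * (ENNReal.ofReal C₀ * Φ) ^ 2 * a := by
    calc _ ≤ ∫⁻ ζ : Plane, ENNReal.ofReal (jb (2 * Real.pi * ζ.fst) ^ s₁) ^ 2 * ‖Hl ζ‖ₑ ^ 2 := by
          refine lintegral_mono fun ζ => ?_
          rw [mul_pow]
          gcongr
          exact wt_le_jb (by linarith) ζ
      _ ≤ _ := hlowm u zl U F g Hl B hU hF hU2 hFm hgm hHlm hgB (fun h p hh => by
          have := hgL h p hh
          rwa [mul_right_comm] at this) hzl hHl
      _ ≤ _ := by
          refine mul_le_mul' (by gcongr) ?_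
          refine lintegral_mono fun ζ => ?_
          rw [mul_pow]
          gcongr
          exact jb_le_wt (by linarith) ζ
  have hWm := hWt.measurable
  have htot : ∫⁻ ζ, (ENNReal.ofReal (W ζ) * ‖Ht ζ‖ₑ) ^ 2 ≤
      ENNReal.ofReal (4 * (C₁ * C₀ ^ 2 + M.toReal ^ 2)) * (a * Φ ^ 2) := by
    calc _ = ∫⁻ ζ, (ENNReal.ofReal (W ζ) * ‖Hl ζ + H ζ‖ₑ) ^ 2 := by
          refine lintegral_congr_ae ?_
          filter_upwards [hHt.ae_eq hsum] with ζ hζ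
          rw [hζ]
      _ ≤ ∫⁻ ζ, 4 * ((ENNReal.ofReal (W ζ) * ‖Hl ζ‖ₑ) ^ 2 + (ENNReal.ofReal (W ζ) *
            ∑' k, ∫⁻ η, ‖F η‖ₑ * ‖G k (ζ - η)‖ₑ) ^ 2) := by
          refine lintegral_mono fun ζ => ?_
          refine le_trans (pow_le_pow_left₀ zero_le ?_ 2) (add_sq_le_four _ _)
          rw [← mul_add]
          gcongr
          exact (enorm_add_le _ _).trans (add_le_add le_rfl (hHA ζ))
      _ ≤ 4 * (ENNReal.ofReal C₁ * (ENNReal.ofReal C₀ * Φ) ^ 2 * a + M ^ 2 * (a * Φ ^ 2)) := by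
          rw [lintegral_const_mul' _ _ (by norm_num), lintegral_add_left (by fun_prop)]
          gcongr
      _ = _ := by
          rw [ENNReal.ofReal_mul (by norm_num), ENNReal.ofReal_add (by positivity) (by positivity),
            ENNReal.ofReal_mul hC₁.le, ENNReal.ofReal_pow hC₀.le,
            ENNReal.ofReal_pow ENNReal.toReal_nonneg, ENNReal.ofReal_toReal hM.ne]
          simp only [ENNReal.ofReal_ofNat]
          ring
  obtain ⟨H', hH', hle'⟩ := hmul W hWt _ Ht hHtm hHt
    (htot.trans_lt (ENNReal.mul_lt_top ENNReal.ofReal_lt_top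
      (ENNReal.mul_lt_top hafin (ENNReal.pow_lt_top hv))))
  rw [← ENNReal.pow_le_pow_left_iff two_ne_zero, XNorm_sq hH' (hSchr lam) s₁ (-(1 / 2) + 2 * θ)]
  have hconst : ENNReal.ofReal K * ENNReal.ofReal (4 * (C₁ * C₀ ^ 2 + M.toReal ^ 2)) ≤
      ENNReal.ofReal (√D * lam ^ (-(1 / 2) : ℝ)) ^ 2 := by
    -- The bound obtained is uniform in `λ`; the factor `λ^{-1/2} ≥ 1` is only given away here.
    have h1 : 1 ≤ lam ^ (-(1 / 2) : ℝ) := Real.one_le_rpow_of_pos_of_le_one_of_nonpos hl hl1 (by norm_num)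
    rw [← ENNReal.ofReal_mul hK.le, ← ENNReal.ofReal_pow (by positivity)]
    apply ENNReal.ofReal_le_ofReal
    rw [mul_pow, Real.sq_sqrt hD.le]
    refine le_trans ?_ (le_mul_of_one_le_right hD.le (one_le_pow₀ h1))
    simp only [D]
    linarith
  set b := ENNReal.ofReal ((2 * Real.pi) ^ 2)
  calc _ ≤ b * (ENNReal.ofReal K *
        (ENNReal.ofReal (4 * (C₁ * C₀ ^ 2 + M.toReal ^ 2)) * (a * Φ ^ 2))) := by
        gcongr
        exact hle'.trans (by gcongr)
    _ = ENNReal.ofReal K * ENNReal.ofReal (4 * (C₁ * C₀ ^ 2 + M.toReal ^ 2)) * (b * a * Φ ^ 2) := by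
        ring
    _ ≤ ENNReal.ofReal (√D * lam ^ (-(1 / 2) : ℝ)) ^ 2 * (b * a * Φ ^ 2) := by gcongr
    _ = _ := by rw [mul_pow, mul_pow, hXu]

end NLSKdV

end

theorem lemma3p4 :
    -- part (a)
    (∀ s₁ s₂ : ℝ, 0 ≤ s₁ → -1 < s₂ → s₂ < -(1 / 2) → s₁ - s₂ < 1 →
      ∃ θ₀ : ℝ, 0 < θ₀ ∧ ∀ θ : ℝ, 0 < θ → θ < θ₀ →
      ∀ η₀ : ℝ → ℝ, NLSKdV.IsCutoff η₀ →
      ∀ ψ : ℝ → ℝ, ContDiff ℝ ∞ ψ → HasCompactSupport ψ →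
      ∃ C : ℝ, 0 < C ∧ ∀ lam : ℝ, 0 < lam → lam ≤ 1 →
      ∀ u v : 𝓢'(NLSKdV.Plane, ℂ),
        NLSKdV.XNorm (NLSKdV.hSchr lam) s₁ (1 / 2 + θ) u < ⊤ →
        NLSKdV.FbarNorm η₀ s₂ v < ⊤ →
        ∃ z : 𝓢'(NLSKdV.Plane, ℂ), NLSKdV.HasProduct η₀ u v z ∧
          NLSKdV.XNorm (NLSKdV.hSchr lam) s₁ (-(1 / 2) + 2 * θ) (NLSKdV.mulTime ψ z) ≤
            ENNReal.ofReal (C * lam ^ (-(1 / 2) : ℝ)) *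
              (NLSKdV.XNorm (NLSKdV.hSchr lam) s₁ (1 / 2 + θ) u * NLSKdV.FbarNorm η₀ s₂ v)) ∧
    -- part (b)
    (∀ s₁ s₂ : ℝ, 0 ≤ s₁ → s₂ - s₁ < -(1 / 2) →
      ∃ θ₀ : ℝ, 0 < θ₀ ∧ ∀ θ : ℝ, 0 < θ → θ < θ₀ →
      ∀ ψ : ℝ → ℝ, ContDiff ℝ ∞ ψ → HasCompactSupport ψ →
      ∃ C : ℝ, 0 < C ∧ ∀ lam : ℝ, 0 < lam → lam ≤ 1 →
      ∀ u w : 𝓢'(NLSKdV.Plane, ℂ),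
        NLSKdV.XNorm (NLSKdV.hSchr lam) s₁ (1 / 2 + θ) u < ⊤ →
        NLSKdV.XNorm (NLSKdV.hSchr lam) s₁ (1 / 2 + θ) w < ⊤ →
        ∃ (U W : NLSKdV.Plane → ℂ) (z : 𝓢'(NLSKdV.Plane, ℂ)),
          NLSKdV.IsFun u U ∧ NLSKdV.IsFun w W ∧
          NLSKdV.IsFun z (fun p => U p * (starRingEnd ℂ) (W p)) ∧
          NLSKdV.XNorm NLSKdV.hAiry s₂ (-(1 / 2) + 2 * θ)
              (NLSKdV.mulTime ψ (NLSKdV.dx z)) ≤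
            ENNReal.ofReal (C * lam ^ (-(1 / 2) : ℝ)) *
              (NLSKdV.XNorm (NLSKdV.hSchr lam) s₁ (1 / 2 + θ) u *
                NLSKdV.XNorm (NLSKdV.hSchr lam) s₁ (1 / 2 + θ) w)) := by
  refine ⟨fun s₁ s₂ hs₁ _ hs₂ hs => ?_, fun s₁ s₂ hs₁ hs => ⟨1 / 4, by norm_num,
    fun θ hθ hθ1 ψ hψ hc => NLSKdV.schr_schr_estimate hs₁ hs hθ hθ1.le hψ hc⟩⟩
  -- The bound `1/4` keeps the output exponent `-1/2 + 2θ` nonpositive. The second bound makes the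
  -- dyadic exponent `s₁ - s₂ - 1 + 6θ` negative. That `s₁ < 1` follows from `s₁ < 1 + s₂` and `s₂ <
  -- -1/2`.
  refine ⟨min (1 / 4) ((1 - (s₁ - s₂)) / 6), lt_min (by norm_num) (by linarith),
    fun θ hθ hθ1 η₀ hη ψ hψ hc => ?_⟩
  have h1 := hθ1.trans_le (min_le_left _ _)
  have h2 := hθ1.trans_le (min_le_right _ _)
  exact NLSKdV.schr_airy_estimate hs₁ (by linarith) hθ h1.le (by linarith) hη hψ hc
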